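/- Let $N\ge 0$ be an integer, $\mathbb K$ a field, and let $X=(x_1,\dots,x_{N-1})$ and $Y=(y_1,\dots,y_{N-2})$ be sequences of elements of $\mathbb K$. The Okada algebra $O_N(X,Y)$ is the unital associative $\mathbb K$-algebra with generators $e_1,\dots,e_{N-1}$ and relations $e_i^2=x_ie_i$ for $1\le i\le N-1$, $e_ie_j=e_je_i$ for $|i-j|\ge 2$, and $e_{i+1}e_ie_{i+1}=y_ie_{i+1}$ for $1\le i\le N-2$. Order the $2N$ nodes as $1<2<\dots<N<\overline N<\dots<\overline 2<\overline 1$, with $1,\dots,N$ on the left boundary and $\overline 1,\dots,\overline N$ on the right boundary of a rectangle, and put $|a|=|\overline a|=a$. An Okada arc-diagram of rank $N$ is a non-crossing perfect matching of the nodes in which every arc $\{a,b\}$ carries an integer label $\mathbf h(\{a,b\})$ with $1\le \mathbf h(\{a,b\})\le\min(|a|,|b|)$ and $\mathbf h(\{a,b\})\equiv\min(|a|,|b|) \pmod 2$, such that $\mathbf h(\{a,b\})>\mathbf h(\{c,d\})$ whenever $c<a<b<d$. For two such diagrams $C,D$, the composition $C\circ D$ is obtained by merging the right nodes of $C$ with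 the left nodes of $D$ and concatenating arcs; the label of each resulting arc or loop is the minimum of the labels of the arcs that comprise it. Let $[C\circ D]$ be the labelled diagram obtained by removing all loops, and let $\ell_k$ be the number of loops with label $k$. For a diagram $D$ and $1\le j\le N-1$ let $n_j(D)$ be half the number of nodes $a$ with $h\le j<|a|$, where $h$ is the label of the arc that ends in $a$. Let $\mathrm{OkArc}_N(X,Y)$ be the $\mathbb K$-vector space with the Okada arc-diagrams of rank $N$ as basis, with the bilinear product $$C\cdot D=\Big(\prod_{k=1}^{N-1}x_k^{\ell_k}\Big)\Big(\prod_{i=1}^{N-2}y_i^{m_i}\Big)[C\circ D],\qquad m_i=\sum_{j=i+1}^{N-1}(-1)^{j-i-1}\big(n_j(C)+n_j(D)-n_j([C\circ D])-\ell_j\big).$$ (For $Y=(1,\dots,1)$ this is $\prod_k x_k^{\ell_k}\,[C\circ D]$.) Let $\mathrm{id}_N$ be the diagram with arcs $\{a,\overline a\}$ labelled $a$, for $1\le a\le N$. For $1\le i\le N-1$ let the elementary diagram $g_i$ be the one with the arcs $\{i,i+1\}$ and $\{\overline i,\overline{i+1}\}$, both labelled $i$, and the arcs $\{j,\overline j\}$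 labelled $j$ for $j\ne i,i+1$. Theorem. The composition $[C\circ D]$ of two Okada arc-diagrams is an Okada arc-diagram, and $\mathrm{OkArc}_N(X,Y)$ is an associative algebra with unit $\mathrm{id}_N$. Its dimension is $N!$, and it is generated as a unital algebra by the elementary diagrams $g_1,\dots,g_{N-1}$. Furthermore, the assignment $e_i\mapsto g_i$ extends to a unique unital algebra homomorphism $\Theta:O_N(X,Y)\to\mathrm{OkArc}_N(X,Y)$, and $\Theta$ is an isomorphism. -/

import Mathlib

/-! ### The Okada algebra by generators and relations

The sequences `X = (x_1, …, x_{N-1})` and `Y = (y_1, …, y_{N-2})` are functions on `Fin (N - 1)`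
and `Fin (N - 2)`; the index `i` of `Fin` stands for the index `i + 1`. -/

/-- The defining relations of the Okada algebra. -/
inductive OkadaRel {K : Type*} [Field K] (N : ℕ) (X : Fin (N - 1) → K) (Y : Fin (N - 2) → K) :
    FreeAlgebra K (Fin (N - 1)) → FreeAlgebra K (Fin (N - 1)) → Prop
  | sq (i : Fin (N - 1)) :
      OkadaRel N X Y (FreeAlgebra.ι K i * FreeAlgebra.ι K i) (X i • FreeAlgebra.ι K i)
  | comm (i j : Fin (N - 1)) (h : i.val + 2 ≤ j.val ∨ j.val + 2 ≤ i.val) :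
      OkadaRel N X Y (FreeAlgebra.ι K i * FreeAlgebra.ι K j)
        (FreeAlgebra.ι K j * FreeAlgebra.ι K i)
  | shift (i : Fin (N - 2)) (lo hi : Fin (N - 1)) (hlo : lo.val = i.val)
      (hhi : hi.val = i.val + 1) :
      OkadaRel N X Y (FreeAlgebra.ι K hi * FreeAlgebra.ι K lo * FreeAlgebra.ι K hi)
        (Y i • FreeAlgebra.ι K hi)

/-- The Okada algebra `O_N(X, Y)`: the unital associative `K`-algebra presented by the generators
`e_1, …, e_{N-1}` and the relations `OkadaRel`. -/
abbrev OkadaAlgebra {K : Type*} [Field K] (N : ℕ) (X : Fin (N - 1) → K) (Y : Fin (N - 2) → K) :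
    Type _ :=
  RingQuot (OkadaRel N X Y)

/-- The generators `e_i` of the Okada algebra. -/
noncomputable def OkadaAlgebra.e {K : Type*} [Field K] {N : ℕ} (X : Fin (N - 1) → K)
    (Y : Fin (N - 2) → K) (i : Fin (N - 1)) : OkadaAlgebra N X Y :=
  RingQuot.mkAlgHom K (OkadaRel N X Y) (FreeAlgebra.ι K i)

/-! ### Height-labelled arc-diagrams -/

/-- The boundary nodes: `Sum.inl i` is the node `i + 1` on the left boundary, `Sum.inr i` is the
overlined node `i + 1` on the right boundary. -/
abbrev ArcNode (N : ℕ) : Type := Fin N ⊕ Fin N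

/-- The absolute value `|a|` of a node. -/
def ArcNode.level {N : ℕ} : ArcNode N → ℕ
  | Sum.inl i => i.val + 1
  | Sum.inr i => i.val + 1

/-- The position of a node in the total order in which `1, …, N` come first, in this order,
followed by the overlined `N, …, 1`, in this order. -/
def ArcNode.pos {N : ℕ} : ArcNode N → ℕ
  | Sum.inl i => i.val
  | Sum.inr i => 2 * N - 1 - i.val

/-- A graph on the boundary nodes, whose edges are the arcs, with a label at each node:
`height a` is the label of the arc that ends in `a`. -/
@[ext]
structure LabelledArcs (N : ℕ) where
  graph : SimpleGraph (ArcNode N)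
  height : ArcNode N → ℕ

/-- The conditions for labelled arcs to be an Okada arc-diagram of rank `N`: the arcs are a
non-crossing perfect matching, and the labels satisfy the three height conditions. -/
structure LabelledArcs.IsOkada {N : ℕ} (D : LabelledArcs N) : Prop where
  matching : ∀ a, ∃! b, D.graph.Adj a b
  noncrossing : ∀ a b c d, D.graph.Adj a c → D.graph.Adj b d →
    ¬ (a.pos < b.pos ∧ b.pos < c.pos ∧ c.pos < d.pos)
  height_eq : ∀ a b, D.graph.Adj a b → D.height a = D.height b
  one_le_height : ∀ a, 1 ≤ D.height a
  height_le : ∀ a b, D.graph.Adj a b → D.height a ≤ min a.level b.level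
  parity : ∀ a b, D.graph.Adj a b → D.height a ≡ min a.level b.level [MOD 2]
  nested : ∀ a b c d, D.graph.Adj a b → D.graph.Adj c d →
    c.pos < a.pos → a.pos < b.pos → b.pos < d.pos → D.height c < D.height a

/-- The set of Okada arc-diagrams of rank `N`. -/
abbrev OkadaDiagram (N : ℕ) : Type := {D : LabelledArcs N // D.IsOkada}

/-! ### Composition of diagrams -/

namespace LabelledArcs

variable {N : ℕ}

/-- The nodes of `C` in the composition `C ∘ D`, whose nodes form three columns: the left
boundary, the middle column where the two diagrams are merged, and the right boundary. -/
def nodeFst : ArcNode N → Fin 3 × Fin N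
  | Sum.inl i => (0, i)
  | Sum.inr i => (1, i)

/-- The nodes of `D` in the composition `C ∘ D`. -/
def nodeSnd : ArcNode N → Fin 3 × Fin N
  | Sum.inl i => (1, i)
  | Sum.inr i => (2, i)

/-- The boundary nodes of the composition `C ∘ D`. -/
def nodeOuter : ArcNode N → Fin 3 × Fin N
  | Sum.inl i => (0, i)
  | Sum.inr i => (2, i)

/-- The arc fragments of `C` and `D`, concatenated. The arcs and the loops of `C ∘ D` are the
connected components of this graph. -/
def glue (C D : LabelledArcs N) : SimpleGraph (Fin 3 × Fin N) :=
  C.graph.map nodeFst ⊔ D.graph.map nodeSnd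

/-- The height label of an arc or loop of `C ∘ D`: the minimum of the labels of the arc fragments
that comprise it. -/
noncomputable def compHeight (C D : LabelledArcs N) (γ : (glue C D).ConnectedComponent) : ℕ :=
  sInf ({h | ∃ a, (glue C D).connectedComponentMk (nodeFst a) = γ ∧ C.height a = h} ∪
    {h | ∃ a, (glue C D).connectedComponentMk (nodeSnd a) = γ ∧ D.height a = h})

/-- The labelled arcs `[C ∘ D]`, obtained from `C ∘ D` by removing all loops. -/
noncomputable def comp (C D : LabelledArcs N) : LabelledArcs N where
  graph :=
    { Adj := fun a b => a ≠ b ∧ (glue C D).Reachable (nodeOuter a) (nodeOuter b)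
      symm := ⟨fun _ _ h => ⟨h.1.symm, h.2.symm⟩⟩
      loopless := ⟨fun _ h => h.1 rfl⟩ }
  height := fun a => compHeight C D ((glue C D).connectedComponentMk (nodeOuter a))

/-- The number `ℓ_k` of loops of `C ∘ D` with height label `k`; a loop is a component that contains
no boundary node. -/
noncomputable def loops (C D : LabelledArcs N) (k : ℕ) : ℕ :=
  Set.ncard {γ : (glue C D).ConnectedComponent |
    (∀ a, (glue C D).connectedComponentMk (nodeOuter a) ≠ γ) ∧ compHeight C D γ = k}

/-- The number of boxes (double U-turns) in row `j` of the normal form of a diagram. In normal form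
an arc descends from each of its two ends `a` to the level given by its height, so it passes between
the levels `j` and `j + 1` once for each end `a` with `height a ≤ j < |a|`; a box in row `j` consists
of two such passages. -/
noncomputable def boxes (D : LabelledArcs N) (j : ℕ) : ℕ :=
  Set.ncard {a : ArcNode N | D.height a ≤ j ∧ j < a.level} / 2

/-- The exponent `m_i` of `y_i` in the product of `C` and `D`, that is, the number of rewriting
moves `e_{i+1} e_i e_{i+1} ⟼ y_i e_{i+1}` that bring `C ∘ D` to normal form. Such a move removes one
box in each of the rows `i` and `i + 1`, and the removal of a loop of height `j`, with weight `x_j`,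
removes one box in row `j`. So
`m_{j-1} + m_j = boxes C j + boxes D j - boxes [C ∘ D] j - ℓ_j` for `1 ≤ j ≤ N - 1`, with
`m_{N-1} = 0`; the alternating sum is the solution of these equations. -/
noncomputable def yExp (C D : LabelledArcs N) (i : ℕ) : ℕ :=
  (∑ j ∈ Finset.Ico (i + 1) N, (-1 : ℤ) ^ (j - (i + 1)) *
    ((boxes C j : ℤ) + boxes D j - boxes (comp C D) j - loops C D j)).toNat

/-- The scalar `∏ x_k ^ ℓ_k * ∏ y_i ^ m_i` of the product of `C` and `D`. -/
noncomputable def weight {K : Type*} [Field K] (X : Fin (N - 1) → K) (Y : Fin (N - 2) → K)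
    (C D : LabelledArcs N) : K :=
  (∏ k : Fin (N - 1), X k ^ loops C D (k.val + 1)) *
    ∏ i : Fin (N - 2), Y i ^ yExp C D (i.val + 1)

end LabelledArcs

/-! ### The identity diagram and the elementary diagrams -/

namespace OkadaDiagram

/-- The identity diagram: the arcs join `a` to the overlined `a`, with label `a`. -/
def id (N : ℕ) : OkadaDiagram N where
  val :=
    { graph := SimpleGraph.fromRel fun a b => ∃ j, a = Sum.inl j ∧ b = Sum.inr j
      height := ArcNode.level }
  property := by
    constructor
    · rintro (a | a)
      · exact ⟨Sum.inr a, by simp, by rintro (b | b) <;> simp [eq_comm]⟩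
      · exact ⟨Sum.inl a, by simp, by rintro (b | b) <;> simp [eq_comm]⟩
    all_goals
      simp only [SimpleGraph.fromRel_adj]
      first
      | (rintro (a | a) <;> simp [ArcNode.level]; done)
      | (rintro (a | a) (b | b) <;> simp [ArcNode.level, Nat.ModEq] <;> grind)
      | (rintro (a | a) (b | b) (c | c) (d | d) <;> simp [ArcNode.level, ArcNode.pos] <;> grind)

/-- The labelled arcs of `g_i` (with the index `i + 1` written for `i : Fin (N - 1)`): the nodes
`i` and `i + 1`, and the overlined `i` and `i + 1`, are joined by arcs with label `i`; every other
`j` is joined to the overlined `j` with label `j`. -/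
def gArcs {N : ℕ} (i : Fin (N - 1)) : LabelledArcs N where
  graph := SimpleGraph.fromRel fun a b =>
    (∃ j : Fin N, j.val ≠ i.val ∧ j.val ≠ i.val + 1 ∧ a = Sum.inl j ∧ b = Sum.inr j) ∨
    (∃ j k : Fin N, j.val = i.val ∧ k.val = i.val + 1 ∧ a = Sum.inl j ∧ b = Sum.inl k) ∨
    (∃ j k : Fin N, j.val = i.val ∧ k.val = i.val + 1 ∧ a = Sum.inr j ∧ b = Sum.inr k)
  height := fun a => if a.level = i.val + 2 then i.val + 1 else a.level

theorem gArcs_height {N : ℕ} (i : Fin (N - 1)) (a : ArcNode N) :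
    (a.level = i.val + 2 ∧ (gArcs i).height a = i.val + 1) ∨
      (a.level ≠ i.val + 2 ∧ (gArcs i).height a = a.level) := by
  simp only [gArcs]
  split_ifs with h <;> simp [h]

theorem gArcs_adj {N : ℕ} (i : Fin (N - 1)) {a b : ArcNode N} (h : (gArcs i).graph.Adj a b) :
    1 ≤ a.level ∧ a.level ≤ N ∧ 1 ≤ b.level ∧ b.level ≤ N ∧
    ((a.level = b.level ∧ a.level ≠ i.val + 1 ∧ a.level ≠ i.val + 2 ∧
      ((a.pos + 1 = a.level ∧ b.pos + b.level = 2 * N) ∨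
        (b.pos + 1 = b.level ∧ a.pos + a.level = 2 * N))) ∨
    (((a.level = i.val + 1 ∧ b.level = i.val + 2) ∨ (a.level = i.val + 2 ∧ b.level = i.val + 1)) ∧
      ((a.pos + 1 = a.level ∧ b.pos + 1 = b.level) ∨
        (a.pos + a.level = 2 * N ∧ b.pos + b.level = 2 * N)))) := by
  have hi := i.isLt
  rw [gArcs, SimpleGraph.fromRel_adj] at h
  obtain ⟨-, (⟨j, h1, h2, rfl, rfl⟩ | ⟨j, k, h1, h2, rfl, rfl⟩ | ⟨j, k, h1, h2, rfl, rfl⟩) |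
    (⟨j, h1, h2, rfl, rfl⟩ | ⟨j, k, h1, h2, rfl, rfl⟩ | ⟨j, k, h1, h2, rfl, rfl⟩)⟩ := h <;>
  simp [ArcNode.level, ArcNode.pos] <;> omega

theorem pos_level {N : ℕ} (a : ArcNode N) :
    1 ≤ a.level ∧ a.level ≤ N ∧ (a.pos + 1 = a.level ∨ a.pos + a.level = 2 * N) := by
  rcases a with a | a <;> simp [ArcNode.level, ArcNode.pos] <;> omega

theorem pos_injective {N : ℕ} {a b : ArcNode N} (h : a.pos = b.pos) : a = b := by
  rcases a with a | a <;> rcases b with b | b <;> simp only [ArcNode.pos] at h <;>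
    simp only [Sum.inl.injEq, Sum.inr.injEq, reduceCtorEq] <;> omega

theorem gArcs_exists {N : ℕ} (i : Fin (N - 1)) (a : ArcNode N) :
    ∃ b, (gArcs i).graph.Adj a b := by
  have hi := i.isLt
  simp only [gArcs, SimpleGraph.fromRel_adj]
  rcases a with a | a
  · by_cases h0 : a.val = i.val
    · exact ⟨Sum.inl ⟨i.val + 1, by omega⟩, by simp [Fin.ext_iff, h0],
        Or.inl (Or.inr (Or.inl ⟨_, _, h0, rfl, rfl, rfl⟩))⟩
    by_cases h1 : a.val = i.val + 1
    · exact ⟨Sum.inl ⟨i.val, by omega⟩, by simp [Fin.ext_iff, h1],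
        Or.inr (Or.inr (Or.inl ⟨⟨i.val, by omega⟩, a, rfl, h1, rfl, rfl⟩))⟩
    exact ⟨Sum.inr a, by simp, Or.inl (Or.inl ⟨a, h0, h1, rfl, rfl⟩)⟩
  · by_cases h0 : a.val = i.val
    · exact ⟨Sum.inr ⟨i.val + 1, by omega⟩, by simp [Fin.ext_iff, h0],
        Or.inl (Or.inr (Or.inr ⟨_, _, h0, rfl, rfl, rfl⟩))⟩
    by_cases h1 : a.val = i.val + 1
    · exact ⟨Sum.inr ⟨i.val, by omega⟩, by simp [Fin.ext_iff, h1],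
        Or.inr (Or.inr (Or.inr ⟨⟨i.val, by omega⟩, a, rfl, h1, rfl, rfl⟩))⟩
    exact ⟨Sum.inl a, by simp, Or.inr (Or.inl ⟨a, h0, h1, rfl, rfl⟩)⟩

/-- The elementary diagram `g_i`. -/
def g {N : ℕ} (i : Fin (N - 1)) : OkadaDiagram N where
  val := gArcs i
  property := by
    have hi := i.isLt
    constructor
    · intro a
      obtain ⟨b, hb⟩ := gArcs_exists i a
      refine ⟨b, hb, fun c hc => pos_injective ?_⟩
      have := gArcs_adj i hb
      have := gArcs_adj i hc
      omega
    · intro a b c d hac hbd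
      have := gArcs_adj i hac
      have := gArcs_adj i hbd
      omega
    · intro a b h
      have := gArcs_adj i h
      have := gArcs_height i a
      have := gArcs_height i b
      omega
    · intro a
      have := pos_level a
      have := gArcs_height i a
      omega
    · intro a b h
      have := gArcs_adj i h
      have := gArcs_height i a
      omega
    · intro a b h
      have := gArcs_adj i h
      have := gArcs_height i a
      unfold Nat.ModEq
      omega
    · intro a b c d hab hcd h1 h2 h3
      have := gArcs_adj i hab
      have := gArcs_adj i hcd
      have := gArcs_height i a
      have := gArcs_height i c
      omega

end OkadaDiagram

/-! ### The diagram algebra -/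

/-- The vector space `OkArc_N(X, Y)` with the Okada arc-diagrams of rank `N` as basis; the
parameters enter through the product. -/
def OkArc {K : Type*} [Field K] (N : ℕ) (_X : Fin (N - 1) → K) (_Y : Fin (N - 2) → K) : Type _ :=
  OkadaDiagram N →₀ K

namespace OkArc

variable {K : Type*} [Field K] {N : ℕ} (X : Fin (N - 1) → K) (Y : Fin (N - 2) → K)

noncomputable instance : AddCommGroup (OkArc N X Y) :=
  inferInstanceAs (AddCommGroup (OkadaDiagram N →₀ K))

noncomputable instance : Module K (OkArc N X Y) :=
  inferInstanceAs (Module K (OkadaDiagram N →₀ K))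

/-- A diagram as an element of `OkArc_N(X, Y)`. -/
noncomputable def diagram (D : OkadaDiagram N) : OkArc N X Y :=
  Finsupp.single D (1 : K)

open Classical in
/-- The product of two diagrams, `weight C D • [C ∘ D]`. (That `[C ∘ D]` is always an Okada
arc-diagram, so that the second case does not occur, is part of the theorem.) -/
noncomputable def mulDiagram (C D : OkadaDiagram N) : OkArc N X Y :=
  if h : (LabelledArcs.comp C.1 D.1).IsOkada then
    LabelledArcs.weight X Y C.1 D.1 • diagram X Y ⟨LabelledArcs.comp C.1 D.1, h⟩
  else 0

/-- The bilinear extension of the product of diagrams. -/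
noncomputable def mulHom : OkArc N X Y →ₗ[K] OkArc N X Y →ₗ[K] OkArc N X Y :=
  Finsupp.linearCombination K fun C : OkadaDiagram N =>
    (Finsupp.linearCombination K fun D : OkadaDiagram N => mulDiagram X Y C D :
      OkArc N X Y →ₗ[K] OkArc N X Y)

noncomputable instance : NonUnitalNonAssocRing (OkArc N X Y) where
  mul a b := mulHom X Y a b
  left_distrib a b c := map_add (mulHom X Y a) b c
  right_distrib a b c := LinearMap.congr_fun (map_add (mulHom X Y) a b) c
  zero_mul a := LinearMap.congr_fun (map_zero (mulHom X Y)) a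
  mul_zero a := map_zero (mulHom X Y a)

instance : IsScalarTower K (OkArc N X Y) (OkArc N X Y) where
  smul_assoc r a b := LinearMap.congr_fun (map_smul (mulHom X Y) r a) b

instance : SMulCommClass K (OkArc N X Y) (OkArc N X Y) where
  smul_comm r a b := (map_smul (mulHom X Y a) r b).symm

noncomputable instance : One (OkArc N X Y) where
  one := diagram X Y (OkadaDiagram.id N)

end OkArc

/-! ### Labelled components and contraction of a subgraph to its boundary -/

/-! Everything is reduced to left multiplication by one elementary diagram. The reduction needs
associativity, which is topological and holds for arbitrary labelled arcs. Both bracketings of three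
diagrams arise from the same gluing on four columns of nodes by contracting two adjacent diagrams to
their outer nodes (`SimpleGraph.IsContraction`). Hence `comp_assoc`, and counting the loops of the
triple gluing in two ways gives `loops_cocycle`. The box numbers cancel from the exponents of the
`y_i`, so these satisfy the same cocycle identity (`yExpInt_cocycle`).

The product of `g_i` with `D` is explicit. If `D` joins the left nodes `i` and `i + 1`, then that
arc closes to a loop and the cap of `g_i` takes its place. Otherwise the partners `p` and `c` of the
two nodes become joined, and the new arc carries the smaller of the two labels. A case analysis of
positions and parities shows that the result is an Okada diagram. The loss of boxes that is not due
to a loop fills an interval of rows of even length, so its alternating sum is `0` or `1`.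

Every diagram `D` other than the identity factors as `g_i` times `D'` with coefficient `1`, where
`D'` has a smaller total deficit `∑ (|a| - label)` (`exists_factorization`). Take the greatest level
`k` with a non-maximal label, and below it the greatest left node `i` with maximal label. Then `i`
and `i + 1` are joined, and the arc over them can be undone. The resulting induction
`okada_induction` transports closure, the right unit and the nonnegativity of the exponents from
`g_i` to all diagrams. It also gives generation by the `g_i`; the coefficients `1` make this
independent of whether the parameters vanish.

For the isomorphism, dimensions are squeezed. The relations hold for the `g_i`, so `Θ` exists, and
it is surjective by generation. The relations rewrite every word of the presented algebra into the
span of at most `N!` products of descending words (`mul_mem_span_words`). Conversely there are at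
least `N!` diagrams: a diagram with maximal labels above `k + 1` may have its top at any of the
first `k + 1` left nodes, and multiplication by elementary diagrams embeds the diagrams with maximal
labels above `k` into each of these classes (`factorial_le_card_maximalAbove`). Thus `N! ≤ dim OkArc
≤ dim O_N ≤ N!`. -/

theorem Nat.sInf_eq_of_cofinal {S T : Set ℕ} (hST : ∀ s ∈ S, ∃ t ∈ T, t ≤ s)
    (hTS : ∀ t ∈ T, ∃ s ∈ S, s ≤ t) : sInf S = sInf T := by
  rcases S.eq_empty_or_nonempty with rfl | hS
  · rcases T.eq_empty_or_nonempty with rfl | ⟨t, ht⟩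
    · rfl
    · obtain ⟨s, hs, -⟩ := hTS t ht
      exact hs.elim
  · obtain ⟨t, ht, hts⟩ := hST _ (Nat.sInf_mem hS)
    obtain ⟨s, hs, hst⟩ := hTS _ (Nat.sInf_mem ⟨t, ht⟩)
    exact le_antisymm ((Nat.sInf_le hs).trans hst) ((Nat.sInf_le ht).trans hts)

namespace SimpleGraph

variable {A B V V₁ V₂ W : Type*}

/-- The minimal label of a component, where each vertex carries a set of labels. -/
noncomputable def infLabel (G : SimpleGraph V) (H : V → Set ℕ) (γ : G.ConnectedComponent) : ℕ :=
  sInf {h | ∃ x, G.connectedComponentMk x = γ ∧ h ∈ H x}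

/-- The set of components with minimal label `k` that contain no vertex `o a`. -/
def closedComponents (G : SimpleGraph V) (H : V → Set ℕ) (o : A → V) (k : ℕ) :
    Set G.ConnectedComponent :=
  {γ | (∀ a, G.connectedComponentMk (o a) ≠ γ) ∧ G.infLabel H γ = k}

/-- The graph `T` is the union of `G₁` and `Q`, which meet in a set `B` of boundary vertices, and
`G₂` arises from `T` by contracting `G₁` to the reachability relation on `B`. -/
structure IsContraction (T : SimpleGraph W) (G₁ : SimpleGraph V₁) (G₂ Q : SimpleGraph V₂)
    (ι : V₁ → W) (κ : V₂ → W) (b : B → V₁) (j : B → V₂) : Prop where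
  inj_fst : Function.Injective ι
  inj_snd : Function.Injective κ
  comm : ∀ β, ι (b β) = κ (j β)
  meet : ∀ x v, ι x = κ v → ∃ β, b β = x ∧ j β = v
  cover : ∀ w, (∃ x, ι x = w) ∨ ∃ v, κ v = w
  adj : ∀ w w', T.Adj w w' → (∃ x x', G₁.Adj x x' ∧ ι x = w ∧ ι x' = w') ∨
    ∃ v v', Q.Adj v v' ∧ κ v = w ∧ κ v' = w'
  adj_fst : ∀ x x', G₁.Adj x x' → T.Adj (ι x) (ι x')
  adj_rest : ∀ v v', Q.Adj v v' → T.Adj (κ v) (κ v')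
  adj_snd : ∀ v v', G₂.Adj v v' → Q.Adj v v' ∨
    ∃ β β', G₁.Reachable (b β) (b β') ∧ j β = v ∧ j β' = v'
  rest_le : Q ≤ G₂
  reachable_snd : ∀ β β', G₁.Reachable (b β) (b β') → G₂.Reachable (j β) (j β')

namespace IsContraction

variable {T : SimpleGraph W} {G₁ : SimpleGraph V₁} {G₂ Q : SimpleGraph V₂}
  {ι : V₁ → W} {κ : V₂ → W} {b : B → V₁} {j : B → V₂}

theorem reachable_fst (c : IsContraction T G₁ G₂ Q ι κ b j) {x y : V₁}
    (h : G₁.Reachable x y) : T.Reachable (ι x) (ι y) := by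
  rw [reachable_iff_reflTransGen] at h
  induction h with
  | refl => exact Reachable.refl _
  | tail _ h ih => exact ih.trans (c.adj_fst _ _ h).reachable

theorem reachable_of_snd (c : IsContraction T G₁ G₂ Q ι κ b j) {u v : V₂}
    (h : G₂.Reachable u v) : T.Reachable (κ u) (κ v) := by
  rw [reachable_iff_reflTransGen] at h
  induction h with
  | refl => exact Reachable.refl _
  | tail _ h ih =>
    refine ih.trans ?_
    rcases c.adj_snd _ _ h with e | ⟨β, β', e, rfl, rfl⟩
    · exact (c.adj_rest _ _ e).reachable
    · rw [← c.comm, ← c.comm]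
      exact c.reachable_fst e

/-- Induction along a walk in `T`. While the walk is in the part from `G₁`, one remembers a boundary
vertex of the current `G₁`-component; when it returns to the boundary, the excursion is replaced by
a connection in `G₂`. -/
theorem invariant (c : IsContraction T G₁ G₂ Q ι κ b j) {u : V₂} {w : W}
    (h : T.Reachable (κ u) w) : (∀ v, κ v = w → G₂.Reachable u v) ∧
      ∀ x, ι x = w → ∃ β, G₁.Reachable (b β) x ∧ G₂.Reachable u (j β) := by
  rw [reachable_iff_reflTransGen] at h
  induction h with
  | refl =>
    refine ⟨fun v hv => c.inj_snd hv ▸ Reachable.refl _, fun x hx => ?_⟩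
    obtain ⟨β, rfl, rfl⟩ := c.meet x u hx
    exact ⟨β, Reachable.refl _, Reachable.refl _⟩
  | tail _ h ih =>
    rcases c.adj _ _ h with ⟨x, x', e, rfl, rfl⟩ | ⟨v, v', e, rfl, rfl⟩
    · obtain ⟨β, h1, h2⟩ := ih.2 x rfl
      have h3 := h1.trans e.reachable
      refine ⟨fun v hv => ?_, fun y hy => c.inj_fst hy ▸ ⟨β, h3, h2⟩⟩
      obtain ⟨β', rfl, rfl⟩ := c.meet x' v hv.symm
      exact h2.trans (c.reachable_snd _ _ h3)
    · have h3 := (ih.1 v rfl).trans (c.rest_le e).reachable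
      refine ⟨fun y hy => c.inj_snd hy ▸ h3, fun x hx => ?_⟩
      obtain ⟨β', rfl, rfl⟩ := c.meet x v' hx
      exact ⟨β', Reachable.refl _, h3⟩

theorem reachable_iff (c : IsContraction T G₁ G₂ Q ι κ b j) {u v : V₂} :
    T.Reachable (κ u) (κ v) ↔ G₂.Reachable u v :=
  ⟨fun h => (c.invariant h).1 v rfl, c.reachable_of_snd⟩

/-- An edge of `Q` could leave the image of `G₁` only at a boundary vertex, so a `G₁`-component
without boundary vertices stays a whole component of `T`. -/
theorem invariant_closed (c : IsContraction T G₁ G₂ Q ι κ b j) {x : V₁}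
    (hx : ∀ β, ¬ G₁.Reachable (b β) x) {w : W} (h : T.Reachable (ι x) w) :
    ∃ y, ι y = w ∧ G₁.Reachable x y := by
  rw [reachable_iff_reflTransGen] at h
  induction h with
  | refl => exact ⟨x, rfl, Reachable.refl _⟩
  | tail _ h ih =>
    obtain ⟨y, rfl, hy⟩ := ih
    rcases c.adj _ _ h with ⟨z, z', e, hz, rfl⟩ | ⟨v, v', e, hv, rfl⟩
    · exact ⟨z', rfl, hy.trans (c.inj_fst hz ▸ e.reachable)⟩
    · obtain ⟨β, rfl, rfl⟩ := c.meet _ _ hv.symm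
      exact (hx β hy.symm).elim

variable {H₁ : V₁ → Set ℕ} {H₂ HQ : V₂ → Set ℕ} {HT : W → Set ℕ}

/-- A minimum may be taken in stages: each excursion into `G₁` is represented by its minimal label
at a boundary vertex. Nonemptiness of the label sets ensures that this inner infimum is attained and
is not the default value `0` of `sInf ∅`. -/
theorem infLabel_snd (c : IsContraction T G₁ G₂ Q ι κ b j)
    (hne : ∀ x, (H₁ x).Nonempty)
    (hT : ∀ w h, h ∈ HT w ↔ (∃ x, ι x = w ∧ h ∈ H₁ x) ∨ ∃ v, κ v = w ∧ h ∈ HQ v)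
    (h₂ : ∀ v h, h ∈ H₂ v ↔
      (∃ β, j β = v ∧ G₁.infLabel H₁ (G₁.connectedComponentMk (b β)) = h) ∨ h ∈ HQ v) (u : V₂) :
    T.infLabel HT (T.connectedComponentMk (κ u)) =
      G₂.infLabel H₂ (G₂.connectedComponentMk u) := by
  apply Nat.sInf_eq_of_cofinal
  · rintro h ⟨w, hw, hh⟩
    have hw := c.invariant (ConnectedComponent.exact hw).symm
    rcases (hT _ _).1 hh with ⟨x, rfl, hx⟩ | ⟨v, rfl, hv⟩
    · obtain ⟨β, h1, h2⟩ := hw.2 x rfl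
      exact ⟨_, ⟨j β, ConnectedComponent.sound h2.symm, (h₂ _ _).2 (Or.inl ⟨β, rfl, rfl⟩)⟩,
        Nat.sInf_le ⟨x, ConnectedComponent.sound h1.symm, hx⟩⟩
    · exact ⟨h, ⟨v, ConnectedComponent.sound (hw.1 v rfl).symm, (h₂ _ _).2 (Or.inr hv)⟩, le_rfl⟩
  · rintro h ⟨v, hv, hh⟩
    have hv := c.reachable_of_snd (ConnectedComponent.exact hv)
    rcases (h₂ _ _).1 hh with ⟨β, rfl, rfl⟩ | hh
    · have hmem : G₁.infLabel H₁ (G₁.connectedComponentMk (b β)) ∈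
          {h | ∃ x, G₁.connectedComponentMk x = G₁.connectedComponentMk (b β) ∧ h ∈ H₁ x} := by
        obtain ⟨h, hh⟩ := hne (b β)
        exact Nat.sInf_mem ⟨h, b β, rfl, hh⟩
      obtain ⟨x, hx, hxm⟩ := hmem
      refine ⟨_, ⟨ι x, ConnectedComponent.sound ?_, (hT _ _).2 (Or.inl ⟨x, rfl, hxm⟩)⟩, le_rfl⟩
      exact (c.reachable_fst (ConnectedComponent.exact hx)).trans (c.comm β ▸ hv)
    · exact ⟨h, ⟨κ v, ConnectedComponent.sound hv, (hT _ _).2 (Or.inr ⟨v, rfl, hh⟩)⟩, le_rfl⟩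

theorem infLabel_fst (c : IsContraction T G₁ G₂ Q ι κ b j)
    (hT : ∀ w h, h ∈ HT w ↔ (∃ x, ι x = w ∧ h ∈ H₁ x) ∨ ∃ v, κ v = w ∧ h ∈ HQ v)
    {x : V₁} (hx : ∀ β, ¬ G₁.Reachable (b β) x) :
    T.infLabel HT (T.connectedComponentMk (ι x)) =
      G₁.infLabel H₁ (G₁.connectedComponentMk x) := by
  unfold infLabel
  congr 1
  ext h
  constructor
  · rintro ⟨w, hw, hh⟩
    obtain ⟨y, rfl, hy⟩ := c.invariant_closed hx (ConnectedComponent.exact hw).symm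
    refine ⟨y, ConnectedComponent.sound hy.symm, ?_⟩
    rcases (hT _ _).1 hh with ⟨z, hz, hh⟩ | ⟨v, hv, -⟩
    · exact c.inj_fst hz ▸ hh
    · obtain ⟨β, rfl, rfl⟩ := c.meet _ _ hv.symm
      exact (hx β hy.symm).elim
  · rintro ⟨y, hy, hh⟩
    exact ⟨ι y, ConnectedComponent.sound (c.reachable_fst (ConnectedComponent.exact hy)),
      (hT _ _).2 (Or.inl ⟨y, rfl, hh⟩)⟩

/-- A component of `T` that avoids the outer vertices either lies in the interior of `G₁`, or meets
`V₂` and then corresponds to a component of `G₂`. Labels agree in both cases, and the two kinds are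
disjoint because the first avoids the boundary. -/
theorem ncard_closedComponents (c : IsContraction T G₁ G₂ Q ι κ b j) [Finite W]
    (hne : ∀ x, (H₁ x).Nonempty)
    (hT : ∀ w h, h ∈ HT w ↔ (∃ x, ι x = w ∧ h ∈ H₁ x) ∨ ∃ v, κ v = w ∧ h ∈ HQ v)
    (h₂ : ∀ v h, h ∈ H₂ v ↔
      (∃ β, j β = v ∧ G₁.infLabel H₁ (G₁.connectedComponentMk (b β)) = h) ∨ h ∈ HQ v)
    (o : A → V₂) (k : ℕ) :
    (T.closedComponents HT (κ ∘ o) k).ncard =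
      (G₁.closedComponents H₁ b k).ncard + (G₂.closedComponents H₂ o k).ncard := by
  classical
  let F₁ : G₁.ConnectedComponent → T.ConnectedComponent :=
    ConnectedComponent.lift (fun x => T.connectedComponentMk (ι x))
      fun _ _ p _ => ConnectedComponent.sound (c.reachable_fst p.reachable)
  let F₂ : G₂.ConnectedComponent → T.ConnectedComponent :=
    ConnectedComponent.lift (fun x => T.connectedComponentMk (κ x))
      fun _ _ p _ => ConnectedComponent.sound (c.reachable_of_snd p.reachable)
  have mem₁ : ∀ {x}, G₁.connectedComponentMk x ∈ G₁.closedComponents H₁ b k →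
      ∀ β, ¬ G₁.Reachable (b β) x :=
    fun h β hβ => h.1 β (ConnectedComponent.sound hβ)
  have inj₁ : Set.InjOn F₁ (G₁.closedComponents H₁ b k) := by
    intro γ hγ δ hδ
    induction γ using ConnectedComponent.ind with | _ x
    induction δ using ConnectedComponent.ind with | _ y
    intro h
    obtain ⟨z, hz, hxz⟩ := c.invariant_closed (mem₁ hγ) (ConnectedComponent.exact h)
    exact ConnectedComponent.sound (c.inj_fst hz ▸ hxz)
  have inj₂ : Function.Injective F₂ := by
    intro γ δ
    induction γ using ConnectedComponent.ind with | _ x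
    induction δ using ConnectedComponent.ind with | _ y
    exact fun h => ConnectedComponent.sound (c.reachable_iff.1 (ConnectedComponent.exact h))
  rw [← inj₁.ncard_image, ← Set.ncard_image_of_injective _ inj₂,
    ← Set.ncard_union_eq _ (Set.toFinite _) (Set.toFinite _)]
  · congr 1
    ext γ
    induction γ using ConnectedComponent.ind with | _ w
    constructor
    · rintro ⟨h1, h2⟩
      by_cases hw : ∃ v, T.Reachable (κ v) w
      · obtain ⟨v, hv⟩ := hw
        have hv' := ConnectedComponent.sound hv
        right
        refine ⟨G₂.connectedComponentMk v, ⟨fun a ha => h1 a ?_, ?_⟩, hv'⟩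
        · rw [← hv']
          exact ConnectedComponent.sound (c.reachable_of_snd (ConnectedComponent.exact ha))
        · rw [← c.infLabel_snd hne hT h₂, hv', h2]
      · push Not at hw
        rcases c.cover w with ⟨x, rfl⟩ | ⟨v, rfl⟩
        · have hx : ∀ β, ¬ G₁.Reachable (b β) x := fun β hβ =>
            hw (j β) (c.comm β ▸ c.reachable_fst hβ)
          refine Or.inl ⟨G₁.connectedComponentMk x,
            ⟨fun β hβ => hx β (ConnectedComponent.exact hβ), ?_⟩, rfl⟩
          rw [← c.infLabel_fst hT hx, h2]
        · exact (hw v (Reachable.refl _)).elim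
    · rintro (⟨γ, hγ, h⟩ | ⟨γ, hγ, h⟩)
      · induction γ using ConnectedComponent.ind with | _ x
        rw [← h]
        refine ⟨fun a ha => ?_, (c.infLabel_fst hT (mem₁ hγ)).trans hγ.2⟩
        obtain ⟨y, hy, hxy⟩ := c.invariant_closed (mem₁ hγ) (ConnectedComponent.exact ha).symm
        obtain ⟨β, rfl, -⟩ := c.meet _ _ hy
        exact mem₁ hγ β hxy.symm
      · induction γ using ConnectedComponent.ind with | _ v
        rw [← h]
        refine ⟨fun a ha => hγ.1 a ?_, (c.infLabel_snd hne hT h₂ v).trans hγ.2⟩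
        exact ConnectedComponent.sound (c.reachable_iff.1 (ConnectedComponent.exact ha))
  · rw [Set.disjoint_left]
    rintro _ ⟨γ, hγ, rfl⟩ ⟨δ, -, h⟩
    induction γ using ConnectedComponent.ind with | _ x
    induction δ using ConnectedComponent.ind with | _ v
    obtain ⟨y, hy, hxy⟩ := c.invariant_closed (mem₁ hγ) (ConnectedComponent.exact h).symm
    obtain ⟨β, rfl, -⟩ := c.meet _ _ hy
    exact mem₁ hγ β hxy.symm

end IsContraction

end SimpleGraph

/-! ### Associativity of the composition -/

namespace LabelledArcs

open SimpleGraph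

variable {N : ℕ}

/-- The labels of the arc fragments that end in a node of `C ∘ D`. -/
def ends (C D : LabelledArcs N) (w : Fin 3 × Fin N) : Set ℕ :=
  {h | (∃ a, nodeFst a = w ∧ C.height a = h) ∨ ∃ a, nodeSnd a = w ∧ D.height a = h}

theorem nodeFst_injective : Function.Injective (nodeFst (N := N)) := by
  rintro (a | a) (b | b) <;> simp [nodeFst]

theorem nodeSnd_injective : Function.Injective (nodeSnd (N := N)) := by
  rintro (a | a) (b | b) <;> simp [nodeSnd]

theorem glue_adj {C D : LabelledArcs N} {w w' : Fin 3 × Fin N} :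
    (glue C D).Adj w w' ↔ (∃ a b, C.graph.Adj a b ∧ nodeFst a = w ∧ nodeFst b = w') ∨
      ∃ a b, D.graph.Adj a b ∧ nodeSnd a = w ∧ nodeSnd b = w' := by
  unfold glue
  rw [sup_adj]
  exact or_congr (map_adj ⟨nodeFst, nodeFst_injective⟩ C.graph w w')
    (map_adj ⟨nodeSnd, nodeSnd_injective⟩ D.graph w w')

theorem compHeight_eq (C D : LabelledArcs N) (γ : (glue C D).ConnectedComponent) :
    compHeight C D γ = (glue C D).infLabel (ends C D) γ := by
  unfold compHeight infLabel
  congr 1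
  ext h
  simp only [ends, Set.mem_union, Set.mem_ofPred_eq]
  constructor
  · rintro (⟨a, h1, h2⟩ | ⟨a, h1, h2⟩)
    exacts [⟨_, h1, Or.inl ⟨a, rfl, h2⟩⟩, ⟨_, h1, Or.inr ⟨a, rfl, h2⟩⟩]
  · rintro ⟨_, h1, ⟨a, rfl, h2⟩ | ⟨a, rfl, h2⟩⟩
    exacts [Or.inl ⟨a, h1, h2⟩, Or.inr ⟨a, h1, h2⟩]

theorem loops_eq (C D : LabelledArcs N) (k : ℕ) :
    loops C D k = ((glue C D).closedComponents (ends C D) nodeOuter k).ncard := by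
  simp only [loops, closedComponents, compHeight_eq]

theorem ends_nonempty (C D : LabelledArcs N) (w : Fin 3 × Fin N) : (ends C D w).Nonempty := by
  obtain ⟨c, i⟩ := w
  fin_cases c
  · exact ⟨_, Or.inl ⟨Sum.inl i, rfl, rfl⟩⟩
  · exact ⟨_, Or.inl ⟨Sum.inr i, rfl, rfl⟩⟩
  · exact ⟨_, Or.inr ⟨Sum.inr i, rfl, rfl⟩⟩

/-! ### Composition of three diagrams on four columns of nodes. -/

/-- The nodes of a diagram between the columns `p` and `q` of a composition of three diagrams. -/
def nodeBetween (p q : Fin 4) : ArcNode N → Fin 4 × Fin N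
  | Sum.inl i => (p, i)
  | Sum.inr i => (q, i)

theorem nodeBetween_injective {p q : Fin 4} (h : p ≠ q) :
    Function.Injective (nodeBetween (N := N) p q) := by
  rintro (a | a) (b | b) <;> simp [nodeBetween, h, h.symm]

/-- The arc fragments of three diagrams, concatenated. -/
def tripleGlue (C D E : LabelledArcs N) : SimpleGraph (Fin 4 × Fin N) :=
  C.graph.map (nodeBetween 0 1) ⊔ D.graph.map (nodeBetween 1 2) ⊔ E.graph.map (nodeBetween 2 3)

/-- The labels of the arc fragments that end in a node of a composition of three diagrams. -/
def tripleEnds (C D E : LabelledArcs N) (w : Fin 4 × Fin N) : Set ℕ :=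
  {h | (∃ a, nodeBetween 0 1 a = w ∧ C.height a = h) ∨
    (∃ a, nodeBetween 1 2 a = w ∧ D.height a = h) ∨
    ∃ a, nodeBetween 2 3 a = w ∧ E.height a = h}

theorem tripleGlue_adj {C D E : LabelledArcs N} {w z : Fin 4 × Fin N} :
    (tripleGlue C D E).Adj w z ↔
      (∃ a b, C.graph.Adj a b ∧ nodeBetween 0 1 a = w ∧ nodeBetween 0 1 b = z) ∨
      (∃ a b, D.graph.Adj a b ∧ nodeBetween 1 2 a = w ∧ nodeBetween 1 2 b = z) ∨
      ∃ a b, E.graph.Adj a b ∧ nodeBetween 2 3 a = w ∧ nodeBetween 2 3 b = z := by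
  unfold tripleGlue
  rw [sup_adj, sup_adj, or_assoc]
  exact or_congr (map_adj ⟨_, nodeBetween_injective (by decide)⟩ C.graph w z)
    (or_congr (map_adj ⟨_, nodeBetween_injective (by decide)⟩ D.graph w z)
      (map_adj ⟨_, nodeBetween_injective (by decide)⟩ E.graph w z))

/-- The inclusion of the nodes of a composition of two diagrams into those of a composition of
three, given by the columns. -/
def columns (f : Fin 3 → Fin 4) (w : Fin 3 × Fin N) : Fin 4 × Fin N := (f w.1, w.2)

theorem columns_injective {f : Fin 3 → Fin 4} (hf : Function.Injective f) :
    Function.Injective (columns (N := N) f) := by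
  rintro ⟨c, i⟩ ⟨d, j⟩ h
  simp only [columns, Prod.mk.injEq] at h
  simp [hf h.1, h.2]

theorem columns_nodeFst (f : Fin 3 → Fin 4) (a : ArcNode N) :
    columns f (nodeFst a) = nodeBetween (f 0) (f 1) a := by
  rcases a with a | a <;> rfl

theorem columns_nodeSnd (f : Fin 3 → Fin 4) (a : ArcNode N) :
    columns f (nodeSnd a) = nodeBetween (f 1) (f 2) a := by
  rcases a with a | a <;> rfl

theorem columns_nodeOuter (f : Fin 3 → Fin 4) (a : ArcNode N) :
    columns f (nodeOuter a) = nodeBetween (f 0) (f 2) a := by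
  rcases a with a | a <;> rfl

/-- Adjacency in `comp` is reachability off the diagonal, so the case `a = b` has to be treated
apart. -/
theorem reachable_of_comp_adj {C D : LabelledArcs N} {a b : ArcNode N} {V : Type*}
    {G : SimpleGraph V} {f : ArcNode N → V}
    (hG : ∀ a b, (comp C D).graph.Adj a b → G.Adj (f a) (f b))
    (h : (glue C D).Reachable (nodeOuter a) (nodeOuter b)) : G.Reachable (f a) (f b) := by
  by_cases hab : a = b
  · rw [hab]
  · exact (hG a b ⟨hab, h⟩).reachable

/-- The gluing of `C` and `D` occupies columns `0, 1, 2`. Contracting it deletes the inner column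
`1` and leaves the columns `0, 2, 3` of the gluing of `comp C D` with `E`; the common boundary
consists of columns `0` and `2`. -/
theorem isContraction_left (C D E : LabelledArcs N) :
    IsContraction (tripleGlue C D E) (glue C D) (glue (comp C D) E) (E.graph.map nodeSnd)
      (columns ![0, 1, 2]) (columns ![0, 2, 3]) nodeOuter nodeFst where
  inj_fst := columns_injective (by decide)
  inj_snd := columns_injective (by decide)
  comm β := by simp [columns_nodeOuter, columns_nodeFst]
  meet := by
    rintro ⟨c, i⟩ ⟨d, j⟩ h
    simp only [columns, Prod.mk.injEq] at h
    obtain ⟨h, rfl⟩ := h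
    fin_cases c <;> fin_cases d <;> simp at h
    exacts [⟨Sum.inl i, rfl, rfl⟩, ⟨Sum.inr i, rfl, rfl⟩]
  cover := by
    rintro ⟨c, i⟩
    fin_cases c
    exacts [Or.inl ⟨(0, i), rfl⟩, Or.inl ⟨(1, i), rfl⟩, Or.inl ⟨(2, i), rfl⟩, Or.inr ⟨(2, i), rfl⟩]
  adj w w' h := by
    rcases tripleGlue_adj.1 h with ⟨a, b, e, rfl, rfl⟩ | ⟨a, b, e, rfl, rfl⟩ | ⟨a, b, e, rfl, rfl⟩
    · exact Or.inl ⟨_, _, glue_adj.2 (Or.inl ⟨a, b, e, rfl, rfl⟩),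
        columns_nodeFst _ _, columns_nodeFst _ _⟩
    · exact Or.inl ⟨_, _, glue_adj.2 (Or.inr ⟨a, b, e, rfl, rfl⟩),
        columns_nodeSnd _ _, columns_nodeSnd _ _⟩
    · exact Or.inr ⟨_, _, (map_adj ⟨_, nodeSnd_injective⟩ _ _ _).2 ⟨a, b, e, rfl, rfl⟩,
        columns_nodeSnd _ _, columns_nodeSnd _ _⟩
  adj_fst x x' h := by
    rcases glue_adj.1 h with ⟨a, b, e, rfl, rfl⟩ | ⟨a, b, e, rfl, rfl⟩
    · rw [columns_nodeFst, columns_nodeFst]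
      exact tripleGlue_adj.2 (Or.inl ⟨a, b, e, rfl, rfl⟩)
    · rw [columns_nodeSnd, columns_nodeSnd]
      exact tripleGlue_adj.2 (Or.inr (Or.inl ⟨a, b, e, rfl, rfl⟩))
  adj_rest x x' h := by
    obtain ⟨a, b, e, rfl, rfl⟩ := (map_adj ⟨_, nodeSnd_injective⟩ _ _ _).1 h
    simp only [Function.Embedding.coeFn_mk, columns_nodeSnd]
    exact tripleGlue_adj.2 (Or.inr (Or.inr ⟨a, b, e, rfl, rfl⟩))
  adj_snd v v' h := by
    rcases glue_adj.1 h with ⟨a, b, e, rfl, rfl⟩ | ⟨a, b, e, rfl, rfl⟩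
    · exact Or.inr ⟨a, b, e.2, rfl, rfl⟩
    · exact Or.inl ((map_adj ⟨_, nodeSnd_injective⟩ _ _ _).2 ⟨a, b, e, rfl, rfl⟩)
  rest_le := le_sup_right
  reachable_snd _ _ h := reachable_of_comp_adj
    (fun a b e => glue_adj.2 (Or.inl ⟨a, b, e, rfl, rfl⟩)) h

theorem isContraction_right (C D E : LabelledArcs N) :
    IsContraction (tripleGlue C D E) (glue D E) (glue C (comp D E)) (C.graph.map nodeFst)
      (columns ![1, 2, 3]) (columns ![0, 1, 3]) nodeOuter nodeSnd where
  inj_fst := columns_injective (by decide)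
  inj_snd := columns_injective (by decide)
  comm β := by simp [columns_nodeOuter, columns_nodeSnd]
  meet := by
    rintro ⟨c, i⟩ ⟨d, j⟩ h
    simp only [columns, Prod.mk.injEq] at h
    obtain ⟨h, rfl⟩ := h
    fin_cases c <;> fin_cases d <;> simp at h
    exacts [⟨Sum.inl i, rfl, rfl⟩, ⟨Sum.inr i, rfl, rfl⟩]
  cover := by
    rintro ⟨c, i⟩
    fin_cases c
    exacts [Or.inr ⟨(0, i), rfl⟩, Or.inl ⟨(0, i), rfl⟩, Or.inl ⟨(1, i), rfl⟩, Or.inl ⟨(2, i), rfl⟩]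
  adj w w' h := by
    rcases tripleGlue_adj.1 h with ⟨a, b, e, rfl, rfl⟩ | ⟨a, b, e, rfl, rfl⟩ | ⟨a, b, e, rfl, rfl⟩
    · exact Or.inr ⟨_, _, (map_adj ⟨_, nodeFst_injective⟩ _ _ _).2 ⟨a, b, e, rfl, rfl⟩,
        columns_nodeFst _ _, columns_nodeFst _ _⟩
    · exact Or.inl ⟨_, _, glue_adj.2 (Or.inl ⟨a, b, e, rfl, rfl⟩),
        columns_nodeFst _ _, columns_nodeFst _ _⟩
    · exact Or.inl ⟨_, _, glue_adj.2 (Or.inr ⟨a, b, e, rfl, rfl⟩),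
        columns_nodeSnd _ _, columns_nodeSnd _ _⟩
  adj_fst x x' h := by
    rcases glue_adj.1 h with ⟨a, b, e, rfl, rfl⟩ | ⟨a, b, e, rfl, rfl⟩
    · rw [columns_nodeFst, columns_nodeFst]
      exact tripleGlue_adj.2 (Or.inr (Or.inl ⟨a, b, e, rfl, rfl⟩))
    · rw [columns_nodeSnd, columns_nodeSnd]
      exact tripleGlue_adj.2 (Or.inr (Or.inr ⟨a, b, e, rfl, rfl⟩))
  adj_rest x x' h := by
    obtain ⟨a, b, e, rfl, rfl⟩ := (map_adj ⟨_, nodeFst_injective⟩ _ _ _).1 h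
    simp only [Function.Embedding.coeFn_mk, columns_nodeFst]
    exact tripleGlue_adj.2 (Or.inl ⟨a, b, e, rfl, rfl⟩)
  adj_snd v v' h := by
    rcases glue_adj.1 h with ⟨a, b, e, rfl, rfl⟩ | ⟨a, b, e, rfl, rfl⟩
    · exact Or.inl ((map_adj ⟨_, nodeFst_injective⟩ _ _ _).2 ⟨a, b, e, rfl, rfl⟩)
    · exact Or.inr ⟨a, b, e.2, rfl, rfl⟩
  rest_le := le_sup_left
  reachable_snd _ _ h := reachable_of_comp_adj
    (fun a b e => glue_adj.2 (Or.inr ⟨a, b, e, rfl, rfl⟩)) h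

theorem tripleEnds_left (C D E : LabelledArcs N) (w : Fin 4 × Fin N) (h : ℕ) :
    h ∈ tripleEnds C D E w ↔ (∃ x, columns ![0, 1, 2] x = w ∧ h ∈ ends C D x) ∨
      ∃ v, columns ![0, 2, 3] v = w ∧ h ∈ {h | ∃ a, nodeSnd a = v ∧ E.height a = h} := by
  simp only [tripleEnds, ends, Set.mem_ofPred_eq]
  constructor
  · rintro (⟨a, rfl, h⟩ | ⟨a, rfl, h⟩ | ⟨a, rfl, h⟩)
    · exact Or.inl ⟨_, columns_nodeFst _ a, Or.inl ⟨a, rfl, h⟩⟩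
    · exact Or.inl ⟨_, columns_nodeSnd _ a, Or.inr ⟨a, rfl, h⟩⟩
    · exact Or.inr ⟨_, columns_nodeSnd _ a, ⟨a, rfl, h⟩⟩
  · rintro (⟨_, rfl, ⟨a, rfl, h⟩ | ⟨a, rfl, h⟩⟩ | ⟨_, rfl, a, rfl, h⟩)
    · exact Or.inl ⟨a, (columns_nodeFst ![0, 1, 2] a).symm, h⟩
    · exact Or.inr (Or.inl ⟨a, (columns_nodeSnd ![0, 1, 2] a).symm, h⟩)
    · exact Or.inr (Or.inr ⟨a, (columns_nodeSnd ![0, 2, 3] a).symm, h⟩)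

theorem tripleEnds_right (C D E : LabelledArcs N) (w : Fin 4 × Fin N) (h : ℕ) :
    h ∈ tripleEnds C D E w ↔ (∃ x, columns ![1, 2, 3] x = w ∧ h ∈ ends D E x) ∨
      ∃ v, columns ![0, 1, 3] v = w ∧ h ∈ {h | ∃ a, nodeFst a = v ∧ C.height a = h} := by
  simp only [tripleEnds, ends, Set.mem_ofPred_eq]
  constructor
  · rintro (⟨a, rfl, h⟩ | ⟨a, rfl, h⟩ | ⟨a, rfl, h⟩)
    · exact Or.inr ⟨_, columns_nodeFst _ a, ⟨a, rfl, h⟩⟩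
    · exact Or.inl ⟨_, columns_nodeFst _ a, Or.inl ⟨a, rfl, h⟩⟩
    · exact Or.inl ⟨_, columns_nodeSnd _ a, Or.inr ⟨a, rfl, h⟩⟩
  · rintro (⟨_, rfl, ⟨a, rfl, h⟩ | ⟨a, rfl, h⟩⟩ | ⟨_, rfl, a, rfl, h⟩)
    · exact Or.inr (Or.inl ⟨a, (columns_nodeFst ![1, 2, 3] a).symm, h⟩)
    · exact Or.inr (Or.inr ⟨a, (columns_nodeSnd ![1, 2, 3] a).symm, h⟩)
    · exact Or.inl ⟨a, (columns_nodeFst ![0, 1, 3] a).symm, h⟩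

theorem ends_comp_left (C D E : LabelledArcs N) (v : Fin 3 × Fin N) (h : ℕ) :
    h ∈ ends (comp C D) E v ↔ (∃ β, nodeFst β = v ∧ (glue C D).infLabel (ends C D)
      ((glue C D).connectedComponentMk (nodeOuter β)) = h) ∨
      h ∈ {h | ∃ a, nodeSnd a = v ∧ E.height a = h} := by
  simp only [ends, comp, compHeight_eq, Set.mem_ofPred_eq]

theorem ends_comp_right (C D E : LabelledArcs N) (v : Fin 3 × Fin N) (h : ℕ) :
    h ∈ ends C (comp D E) v ↔ (∃ β, nodeSnd β = v ∧ (glue D E).infLabel (ends D E)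
      ((glue D E).connectedComponentMk (nodeOuter β)) = h) ∨
      h ∈ {h | ∃ a, nodeFst a = v ∧ C.height a = h} := by
  simp only [ends, comp, compHeight_eq, Set.mem_ofPred_eq]
  rw [or_comm]

/-- Reachability between outer nodes and minimal labels are preserved by both contractions of the
triple gluing, and the two embeddings agree on the outer columns `0` and `3`. -/
theorem comp_assoc (C D E : LabelledArcs N) :
    comp (comp C D) E = comp C (comp D E) := by
  have hl := isContraction_left C D E
  have hr := isContraction_right C D E
  have key : ∀ a : ArcNode N,
      columns ![0, 2, 3] (nodeOuter a) = columns ![0, 1, 3] (nodeOuter a) := by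
    intro a
    rw [columns_nodeOuter, columns_nodeOuter]
    rfl
  ext a b
  · change (a ≠ b ∧ (glue (comp C D) E).Reachable _ _) ↔ (a ≠ b ∧ (glue C (comp D E)).Reachable _ _)
    rw [← hl.reachable_iff, ← hr.reachable_iff, key, key]
  · change compHeight (comp C D) E _ = compHeight C (comp D E) _
    rw [compHeight_eq, compHeight_eq,
      ← hl.infLabel_snd (ends_nonempty C D) (tripleEnds_left C D E) (ends_comp_left C D E),
      ← hr.infLabel_snd (ends_nonempty D E) (tripleEnds_right C D E) (ends_comp_right C D E), key]

/-- Both sides count the loops with label `k` in the triple gluing, sorted by whether they already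
close up in the first pair glued. -/
theorem loops_cocycle (C D E : LabelledArcs N) (k : ℕ) :
    loops C D k + loops (comp C D) E k = loops D E k + loops C (comp D E) k := by
  have hl := (isContraction_left C D E).ncard_closedComponents (ends_nonempty C D)
    (tripleEnds_left C D E) (ends_comp_left C D E) nodeOuter k
  have hr := (isContraction_right C D E).ncard_closedComponents (ends_nonempty D E)
    (tripleEnds_right C D E) (ends_comp_right C D E) nodeOuter k
  have key : columns (N := N) ![0, 2, 3] ∘ nodeOuter = columns ![0, 1, 3] ∘ nodeOuter := by
    funext a
    simp only [Function.comp_apply, columns_nodeOuter]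
    rfl
  rw [loops_eq, loops_eq, loops_eq, loops_eq, ← hl, ← hr, key]

/-- The integer of which `yExp` is the truncation. -/
noncomputable def yExpInt (C D : LabelledArcs N) (i : ℕ) : ℤ :=
  ∑ j ∈ Finset.Ico (i + 1) N, (-1 : ℤ) ^ (j - (i + 1)) *
    ((boxes C j : ℤ) + boxes D j - boxes (comp C D) j - loops C D j)

/-- In each row the box numbers on both sides add up to those of `C`, `D` and `E` minus those of the
triple composition; what remains is `loops_cocycle`. -/
theorem yExpInt_cocycle (C D E : LabelledArcs N) (i : ℕ) :
    yExpInt C D i + yExpInt (comp C D) E i = yExpInt D E i + yExpInt C (comp D E) i := by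
  unfold yExpInt
  rw [← Finset.sum_add_distrib, ← Finset.sum_add_distrib]
  refine Finset.sum_congr rfl fun j _ => ?_
  have h := loops_cocycle C D E j
  rw [comp_assoc]
  zify at h
  linear_combination (-1 : ℤ) * (-1 : ℤ) ^ (j - (i + 1)) * h

end LabelledArcs

/-! ### Criterion for computing a composition -/

namespace LabelledArcs

open SimpleGraph

variable {N : ℕ}

/-- The map `ψ` sends each node of `C ∘ D` to a boundary node of the same component, and the
relation `R` on boundary nodes is the matching by the arcs of `C ∘ D`. -/
structure IsResolution (C D : LabelledArcs N) (R : ArcNode N → ArcNode N → Prop)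
    (ψ : Fin 3 × Fin N → Option (ArcNode N)) : Prop where
  symm : ∀ a b, R a b → R b a
  irrefl : ∀ a, ¬ R a a
  unique : ∀ a b c, R a b → R a c → b = c
  outer : ∀ a, ψ (nodeOuter a) = some a
  adj_fst : ∀ a b, C.graph.Adj a b → ψ (nodeFst a) = ψ (nodeFst b) ∨
    ∃ c d, ψ (nodeFst a) = some c ∧ ψ (nodeFst b) = some d ∧ R c d
  adj_snd : ∀ a b, D.graph.Adj a b → ψ (nodeSnd a) = ψ (nodeSnd b) ∨
    ∃ c d, ψ (nodeSnd a) = some c ∧ ψ (nodeSnd b) = some d ∧ R c d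
  reachable : ∀ w a, ψ w = some a → (glue C D).Reachable w (nodeOuter a)
  reachable_adj : ∀ a b, R a b → (glue C D).Reachable (nodeOuter a) (nodeOuter b)

namespace IsResolution

variable {C D : LabelledArcs N} {R : ArcNode N → ArcNode N → Prop}
  {ψ : Fin 3 × Fin N → Option (ArcNode N)}

/-- Each edge of the gluing either keeps the representative `ψ` or passes along `R`. Since `R` is a
partial matching, passing twice leads back, so a walk from `a` sees only `a` and its partner. -/
theorem reachable_iff (r : IsResolution C D R ψ) {a : ArcNode N} {w : Fin 3 × Fin N} :
    (glue C D).Reachable (nodeOuter a) w ↔ ∃ b, ψ w = some b ∧ (a = b ∨ R a b) := by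
  constructor
  · intro h
    rw [reachable_iff_reflTransGen] at h
    induction h with
    | refl => exact ⟨a, r.outer a, Or.inl rfl⟩
    | @tail x y _ h ih =>
      obtain ⟨b, hb, hab⟩ := ih
      have key : ψ x = ψ y ∨ ∃ c d, ψ x = some c ∧ ψ y = some d ∧ R c d := by
        rcases glue_adj.1 h with ⟨s, t, e, rfl, rfl⟩ | ⟨s, t, e, rfl, rfl⟩
        exacts [r.adj_fst _ _ e, r.adj_snd _ _ e]
      rcases key with e | ⟨c, d, hc, hd, hcd⟩
      · exact ⟨b, e ▸ hb, hab⟩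
      · obtain rfl : b = c := Option.some.inj (hb.symm.trans hc)
        refine ⟨d, hd, ?_⟩
        rcases hab with rfl | hab
        · exact Or.inr hcd
        · exact Or.inl (r.unique _ _ _ (r.symm _ _ hab) hcd)
  · rintro ⟨b, hb, rfl | hab⟩
    · exact (r.reachable _ _ hb).symm
    · exact (r.reachable_adj _ _ hab).trans (r.reachable _ _ hb).symm

theorem comp_adj (r : IsResolution C D R ψ) {a b : ArcNode N} :
    (comp C D).graph.Adj a b ↔ R a b := by
  change a ≠ b ∧ (glue C D).Reachable _ _ ↔ _
  rw [r.reachable_iff]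
  constructor
  · rintro ⟨hab, c, hc, h⟩
    obtain rfl : b = c := Option.some.inj ((r.outer b).symm.trans hc)
    exact h.resolve_left hab
  · exact fun h => ⟨fun e => r.irrefl b (e ▸ h), b, r.outer b, Or.inr h⟩

/-- The hypotheses on `C` and `D` make `H` a lower bound for all labels in the component, and `ha`
says that the bound is attained. -/
theorem comp_height (r : IsResolution C D R ψ) {H : ArcNode N → ℕ}
    (hR : ∀ a b, R a b → H a = H b)
    (h₁ : ∀ x b, ψ (nodeFst x) = some b → H b ≤ C.height x)
    (h₂ : ∀ x b, ψ (nodeSnd x) = some b → H b ≤ D.height x) (a : ArcNode N)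
    (ha : ∃ w, (glue C D).Reachable (nodeOuter a) w ∧ H a ∈ ends C D w) :
    (comp C D).height a = H a := by
  change compHeight C D _ = _
  rw [compHeight_eq]
  obtain ⟨w, hw, hwa⟩ := ha
  have hmem : H a ∈ {h | ∃ x, (glue C D).connectedComponentMk x =
      (glue C D).connectedComponentMk (nodeOuter a) ∧ h ∈ ends C D x} :=
    ⟨w, ConnectedComponent.sound hw.symm, hwa⟩
  refine le_antisymm (Nat.sInf_le hmem) (le_csInf ⟨_, hmem⟩ ?_)
  rintro h ⟨x, hx, hh⟩
  obtain ⟨b, hb, hab⟩ := r.reachable_iff.1 (ConnectedComponent.exact hx).symm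
  have hH : H a = H b := hab.elim (congrArg H) (hR a b)
  rw [hH]
  rcases hh with ⟨y, rfl, rfl⟩ | ⟨y, rfl, rfl⟩
  exacts [h₁ _ _ hb, h₂ _ _ hb]

theorem loops_eq_zero (r : IsResolution C D R ψ) (hψ : ∀ w, (ψ w).isSome) (k : ℕ) :
    loops C D k = 0 := by
  rw [loops_eq, Set.ncard_eq_zero (Set.toFinite _), Set.eq_empty_iff_forall_notMem]
  intro γ hγ
  induction γ using ConnectedComponent.ind with | _ w
  obtain ⟨a, ha⟩ := Option.isSome_iff_exists.1 (hψ w)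
  exact hγ.1 a (ConnectedComponent.sound (r.reachable _ _ ha).symm)

end IsResolution

/-- The map of the nodes of `C ∘ D` that is the identity on the boundary and `m` on the middle
column. -/
def resolve (m : Fin N → Option (ArcNode N)) : Fin 3 × Fin N → Option (ArcNode N)
  | (0, k) => some (Sum.inl k)
  | (1, k) => m k
  | (2, k) => some (Sum.inr k)

theorem resolve_outer (m : Fin N → Option (ArcNode N)) (a : ArcNode N) :
    resolve m (nodeOuter a) = some a := by
  rcases a with a | a <;> rfl

theorem reachable_snd {C D : LabelledArcs N} {a b : ArcNode N} (h : D.graph.Adj a b) :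
    (glue C D).Reachable (nodeSnd a) (nodeSnd b) :=
  (glue_adj.2 (Or.inr ⟨a, b, h, rfl, rfl⟩)).reachable

theorem reachable_fst {C D : LabelledArcs N} {a b : ArcNode N} (h : C.graph.Adj a b) :
    (glue C D).Reachable (nodeFst a) (nodeFst b) :=
  (glue_adj.2 (Or.inl ⟨a, b, h, rfl, rfl⟩)).reachable

/-! ### Left multiplication by the identity diagram -/

theorem IsOkada.unique {D : LabelledArcs N} (hD : D.IsOkada) {a b c : ArcNode N}
    (h : D.graph.Adj a b) (h' : D.graph.Adj a c) : b = c :=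
  (hD.matching a).unique h h'

theorem id_adj {a b : ArcNode N} : (OkadaDiagram.id N).1.graph.Adj a b ↔
    ∃ j, (a = Sum.inl j ∧ b = Sum.inr j) ∨ (a = Sum.inr j ∧ b = Sum.inl j) := by
  simp only [OkadaDiagram.id, SimpleGraph.fromRel_adj]
  grind

theorem id_resolution {D : LabelledArcs N} (hD : D.IsOkada) :
    IsResolution (OkadaDiagram.id N).1 D D.graph.Adj (resolve fun k => some (Sum.inl k)) := by
  have hsnd : ∀ a : ArcNode N, resolve (fun k => some (Sum.inl k)) (nodeSnd a) = some a := by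
    rintro (a | a) <;> rfl
  have hout : ∀ a : ArcNode N,
      (glue (OkadaDiagram.id N).1 D).Reachable (nodeSnd a) (nodeOuter a) := by
    rintro (a | a)
    · exact reachable_fst (a := Sum.inr a) (b := Sum.inl a) (id_adj.2 ⟨a, Or.inr ⟨rfl, rfl⟩⟩)
    · exact Reachable.refl _
  refine ⟨fun _ _ h => h.symm, fun _ h => h.ne rfl, fun _ _ _ => hD.unique,
    resolve_outer _, ?_, fun a b h => ?_, ?_, fun a b h => ?_⟩
  · intro a b h
    obtain ⟨j, ⟨rfl, rfl⟩ | ⟨rfl, rfl⟩⟩ := id_adj.1 h <;> exact Or.inl rfl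
  · exact Or.inr ⟨a, b, hsnd a, hsnd b, h⟩
  · rintro ⟨c, k⟩ a h
    fin_cases c <;> cases h
    exacts [Reachable.refl _, hout (Sum.inl k), Reachable.refl _]
  · exact ((hout a).symm.trans (reachable_snd h)).trans (hout b)

theorem IsOkada.height_le_level {D : LabelledArcs N} (hD : D.IsOkada) (a : ArcNode N) :
    D.height a ≤ a.level := by
  obtain ⟨b, hb, -⟩ := hD.matching a
  exact (hD.height_le a b hb).trans (min_le_left _ _)

theorem id_comp {D : LabelledArcs N} (hD : D.IsOkada) :
    comp (OkadaDiagram.id N).1 D = D := by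
  have r := id_resolution hD
  have hsnd : ∀ a : ArcNode N, resolve (fun k => some (Sum.inl k)) (nodeSnd a) = some a := by
    rintro (a | a) <;> rfl
  ext a b
  · exact r.comp_adj
  · refine r.comp_height hD.height_eq ?_ ?_ a ⟨nodeSnd a, r.reachable_iff.2 ⟨a, hsnd a, Or.inl rfl⟩,
      Or.inr ⟨a, rfl, rfl⟩⟩
    · rintro (x | x) b h <;> cases h <;> exact hD.height_le_level (Sum.inl x)
    · rintro x b h
      rw [hsnd] at h
      cases h
      exact le_rfl

theorem loops_id {D : LabelledArcs N} (hD : D.IsOkada) (k : ℕ) :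
    loops (OkadaDiagram.id N).1 D k = 0 := by
  refine (id_resolution hD).loops_eq_zero ?_ k
  rintro ⟨c, i⟩
  fin_cases c <;> rfl

theorem boxes_id (j : ℕ) : boxes (OkadaDiagram.id N).1 j = 0 := by
  have : {a : ArcNode N | (OkadaDiagram.id N).1.height a ≤ j ∧ j < a.level} = ∅ := by
    rw [Set.eq_empty_iff_forall_notMem]
    rintro a ⟨h1, h2⟩
    exact absurd h2 (not_lt.2 h1)
  rw [boxes, this, Set.ncard_empty]

theorem yExpInt_id {D : LabelledArcs N} (hD : D.IsOkada) (i : ℕ) :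
    yExpInt (OkadaDiagram.id N).1 D i = 0 := by
  refine Finset.sum_eq_zero fun j _ => ?_
  rw [id_comp hD, boxes_id, loops_id hD]
  simp

/-! ### Left multiplication by an elementary diagram -/

/-- The adjacency relation in which `s, t` and `s', t'` are joined, and all other nodes are joined
as in `G`. -/
def SwapAdj {V : Type*} (G : SimpleGraph V) (s t s' t' a b : V) : Prop :=
  (a = s ∧ b = t) ∨ (a = t ∧ b = s) ∨ (a = s' ∧ b = t') ∨ (a = t' ∧ b = s') ∨
    ((a ≠ s ∧ a ≠ t ∧ a ≠ s' ∧ a ≠ t') ∧ (b ≠ s ∧ b ≠ t ∧ b ≠ s' ∧ b ≠ t') ∧ G.Adj a b)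

theorem SwapAdj.symm {V : Type*} {G : SimpleGraph V} {s t s' t' a b : V}
    (h : SwapAdj G s t s' t' a b) : SwapAdj G s t s' t' b a := by
  rcases h with ⟨rfl, rfl⟩ | ⟨rfl, rfl⟩ | ⟨rfl, rfl⟩ | ⟨rfl, rfl⟩ | ⟨ha, hb, h⟩
  · exact Or.inr (Or.inl ⟨rfl, rfl⟩)
  · exact Or.inl ⟨rfl, rfl⟩
  · exact Or.inr (Or.inr (Or.inr (Or.inl ⟨rfl, rfl⟩)))
  · exact Or.inr (Or.inr (Or.inl ⟨rfl, rfl⟩))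
  · exact Or.inr (Or.inr (Or.inr (Or.inr ⟨hb, ha, h.symm⟩)))

theorem SwapAdj.ne {V : Type*} {G : SimpleGraph V} {s t s' t' a b : V}
    (h : SwapAdj G s t s' t' a b) (hst : s ≠ t) (hst' : s' ≠ t') : a ≠ b := by
  rcases h with ⟨rfl, rfl⟩ | ⟨rfl, rfl⟩ | ⟨rfl, rfl⟩ | ⟨rfl, rfl⟩ | ⟨ha, hb, h⟩
  exacts [hst, hst.symm, hst', hst'.symm, h.ne]

theorem SwapAdj.unique {V : Type*} {G : SimpleGraph V} {s t s' t' a b c : V}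
    (hG : ∀ a b c, G.Adj a b → G.Adj a c → b = c) (hst : s ≠ t) (hst' : s' ≠ t')
    (h₁ : s ≠ s') (h₂ : s ≠ t') (h₃ : t ≠ s') (h₄ : t ≠ t')
    (h : SwapAdj G s t s' t' a b) (h' : SwapAdj G s t s' t' a c) : b = c := by
  rcases h with ⟨rfl, rfl⟩ | ⟨rfl, rfl⟩ | ⟨rfl, rfl⟩ | ⟨rfl, rfl⟩ | ⟨ha, hb, h⟩ <;>
  rcases h' with ⟨e, e'⟩ | ⟨e, e'⟩ | ⟨e, e'⟩ | ⟨e, e'⟩ | ⟨ha', hb', h'⟩ <;>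
  first
  | exact e'.symm
  | exact (by assumption : _ ≠ _) e |>.elim
  | exact Ne.symm (by assumption) e |>.elim
  | exact (hG _ _ _ h h')
  | (exfalso; simp_all)

end LabelledArcs

/-- The left node `i`. -/
def ArcNode.lo {N : ℕ} (i : Fin (N - 1)) : ArcNode N := Sum.inl ⟨i.val, by omega⟩

/-- The left node `i + 1`. -/
def ArcNode.hi {N : ℕ} (i : Fin (N - 1)) : ArcNode N := Sum.inl ⟨i.val + 1, by omega⟩

namespace LabelledArcs

open SimpleGraph ArcNode OkadaDiagram

variable {N : ℕ}

theorem lo_ne_hi (i : Fin (N - 1)) : lo i ≠ hi i := by simp [lo, hi]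

theorem level_lo (i : Fin (N - 1)) : (lo i).level = i.val + 1 := rfl

theorem level_hi (i : Fin (N - 1)) : (hi i).level = i.val + 2 := rfl

theorem gArcs_adj_lo_hi (i : Fin (N - 1)) : (gArcs i).graph.Adj (lo i) (hi i) := by
  simp only [gArcs, fromRel_adj]
  exact ⟨lo_ne_hi i, Or.inl (Or.inr (Or.inl ⟨_, _, rfl, rfl, rfl, rfl⟩))⟩

theorem gArcs_adj_inr (i : Fin (N - 1)) : (gArcs i).graph.Adj
    (Sum.inr ⟨i.val, by omega⟩) (Sum.inr ⟨i.val + 1, by omega⟩) := by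
  simp only [gArcs, fromRel_adj]
  exact ⟨by simp, Or.inl (Or.inr (Or.inr ⟨_, _, rfl, rfl, rfl, rfl⟩))⟩

theorem gArcs_adj_through (i : Fin (N - 1)) {j : Fin N} (h : Sum.inl j ≠ lo i)
    (h' : Sum.inl j ≠ hi i) : (gArcs i).graph.Adj (Sum.inl j) (Sum.inr j) := by
  simp only [gArcs, fromRel_adj]
  refine ⟨by simp, Or.inl (Or.inl ⟨j, ?_, ?_, rfl, rfl⟩)⟩
  · exact fun e => h (by simp [lo, ← e])
  · exact fun e => h' (by simp [hi, ← e])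

theorem gArcs_adj_induction (i : Fin (N - 1)) {P : ArcNode N → ArcNode N → Prop}
    (hs : ∀ a b, P a b → P b a)
    (h₁ : ∀ j : Fin N, Sum.inl j ≠ lo i → Sum.inl j ≠ hi i → P (Sum.inl j) (Sum.inr j))
    (h₂ : P (lo i) (hi i))
    (h₃ : P (Sum.inr ⟨i.val, by omega⟩) (Sum.inr ⟨i.val + 1, by omega⟩)) {a b : ArcNode N}
    (h : (gArcs i).graph.Adj a b) : P a b := by
  rw [gArcs, fromRel_adj] at h
  have key : ∀ a b : ArcNode N,
      ((∃ j : Fin N, j.val ≠ i.val ∧ j.val ≠ i.val + 1 ∧ a = Sum.inl j ∧ b = Sum.inr j) ∨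
      (∃ j k : Fin N, j.val = i.val ∧ k.val = i.val + 1 ∧ a = Sum.inl j ∧ b = Sum.inl k) ∨
      (∃ j k : Fin N, j.val = i.val ∧ k.val = i.val + 1 ∧ a = Sum.inr j ∧ b = Sum.inr k)) →
      P a b := by
    rintro a b (⟨j, h1, h2, rfl, rfl⟩ | ⟨⟨j, hj⟩, ⟨k, hk⟩, h1, h2, rfl, rfl⟩ |
      ⟨⟨j, hj⟩, ⟨k, hk⟩, h1, h2, rfl, rfl⟩)
    · refine h₁ j ?_ ?_ <;> simp [lo, hi, Fin.ext_iff, h1, h2]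
    · subst h1 h2
      exact h₂
    · subst h1 h2
      exact h₃
  exact h.2.elim (key a b) fun h => hs _ _ (key b a h)

theorem reachable_snd_outer (i : Fin (N - 1)) (D : LabelledArcs N) {x : ArcNode N} (h : x ≠ lo i)
    (h' : x ≠ hi i) : (glue (gArcs i) D).Reachable (nodeSnd x) (nodeOuter x) := by
  rcases x with x | x
  · exact reachable_fst (gArcs_adj_through i h h').symm
  · exact Reachable.refl _

theorem reachable_snd_lo_hi (i : Fin (N - 1)) (D : LabelledArcs N) :
    (glue (gArcs i) D).Reachable (nodeSnd (lo i)) (nodeSnd (hi i)) :=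
  reachable_fst (gArcs_adj_inr i)

theorem reachable_outer_lo_hi (i : Fin (N - 1)) (D : LabelledArcs N) :
    (glue (gArcs i) D).Reachable (nodeOuter (lo i)) (nodeOuter (hi i)) :=
  reachable_fst (gArcs_adj_lo_hi i)

theorem gArcs_height_lo (i : Fin (N - 1)) : (gArcs i).height (lo i) = i.val + 1 := by
  simp [gArcs, level_lo]

theorem gArcs_height_hi (i : Fin (N - 1)) : (gArcs i).height (hi i) = i.val + 1 := by
  simp [gArcs, level_hi]

theorem gArcs_height_of_ne (i : Fin (N - 1)) {j : Fin N} (h : Sum.inl j ≠ hi i) :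
    (gArcs i).height (Sum.inl j) = j.val + 1 ∧ (gArcs i).height (Sum.inr j) = j.val + 1 := by
  have : j.val ≠ i.val + 1 := fun e => h (by simp [hi, ← e])
  simp [gArcs, level, this]

theorem distinct_of_not_adj {D : LabelledArcs N} (hD : D.IsOkada) {i : Fin (N - 1)}
    {p c : ArcNode N}
    (hp : D.graph.Adj (lo i) p) (hc : D.graph.Adj (hi i) c) (hne : p ≠ hi i) :
    p ≠ lo i ∧ p ≠ hi i ∧ c ≠ lo i ∧ c ≠ hi i ∧ p ≠ c := by
  refine ⟨hp.ne', hne, fun h => hne ?_, hc.ne', fun h => lo_ne_hi i ?_⟩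
  · exact hD.unique hp (h ▸ hc).symm
  · exact hD.unique (h ▸ hp).symm hc.symm

open Classical in
-- The middle copies of `lo i` and `hi i` are carried by the arcs of `D` to `p` and `c`, and the
-- right cap of `g_i` joins these two strands. Every other middle node continues straight to the
-- left boundary.
theorem swap_resolution {D : LabelledArcs N} (hD : D.IsOkada) {i : Fin (N - 1)} {p c : ArcNode N}
    (hp : D.graph.Adj (lo i) p) (hc : D.graph.Adj (hi i) c) (hne : p ≠ hi i) :
    IsResolution (gArcs i) D (SwapAdj D.graph (lo i) (hi i) p c)
    (resolve fun k => some (if Sum.inl k = lo i then p else if Sum.inl k = hi i then c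
      else Sum.inl k)) := by
  obtain ⟨h1, h2, h3, h4, h5⟩ := distinct_of_not_adj hD hp hc hne
  have h0 := lo_ne_hi i
  set ψ : Fin 3 × Fin N → Option (ArcNode N) := (resolve fun k => some (if Sum.inl k = lo i then p
    else if Sum.inl k = hi i then c else Sum.inl k)) with hψ
  have hlo : ψ (nodeSnd (lo i)) = some p := by simp [hψ, lo, nodeSnd, resolve]
  have hhi : ψ (nodeSnd (hi i)) = some c := by simp [hψ, hi, lo, nodeSnd, resolve]
  have hother : ∀ x, x ≠ lo i → x ≠ hi i → ψ (nodeSnd x) = some x := by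
    rintro (x | x) hx hx'
    · simp [hψ, nodeSnd, resolve, hx, hx']
    · rfl
  have hadj : ∀ x y, D.graph.Adj x y → x ≠ lo i → x ≠ hi i → x ≠ p → x ≠ c →
      y ≠ lo i ∧ y ≠ hi i ∧ y ≠ p ∧ y ≠ c := by
    intro x y h e1 e2 e3 e4
    refine ⟨?_, ?_, ?_, ?_⟩ <;> rintro rfl
    exacts [e3 (hD.unique h.symm hp), e4 (hD.unique h.symm hc), e1 (hD.unique h.symm hp.symm),
      e2 (hD.unique h.symm hc.symm)]
  have rlo := (reachable_snd (C := gArcs i) hp).trans (reachable_snd_outer i D h1 h2)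
  have rhi := (reachable_snd (C := gArcs i) hc).trans (reachable_snd_outer i D h3 h4)
  have rpc := (rlo.symm.trans (reachable_snd_lo_hi i D)).trans rhi
  refine ⟨?_, ?_, ?_, resolve_outer _, ?_, ?_, ?_, ?_⟩
  · exact fun a b h => h.symm
  · exact fun a h => h.ne h0 h5 rfl
  · exact fun a b b' h h' => h.unique (fun _ _ _ => hD.unique) h0 h5 h1.symm h3.symm h2.symm
      h4.symm h'
  · intro a b h
    refine gArcs_adj_induction i (P := fun a b => ψ (nodeFst a) = ψ (nodeFst b) ∨
      ∃ c' d, ψ (nodeFst a) = some c' ∧ ψ (nodeFst b) = some d ∧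
        SwapAdj D.graph (lo i) (hi i) p c c' d) ?_ ?_ ?_ ?_ h
    · rintro a b (h | ⟨c', d, h, h', h''⟩)
      · exact Or.inl h.symm
      · exact Or.inr ⟨d, c', h', h, h''.symm⟩
    · intro j hj hj'
      exact Or.inl (hother (Sum.inl j) hj hj').symm
    · exact Or.inr ⟨lo i, hi i, rfl, rfl, Or.inl ⟨rfl, rfl⟩⟩
    · exact Or.inr ⟨p, c, hlo, hhi, Or.inr (Or.inr (Or.inl ⟨rfl, rfl⟩))⟩
  · intro a b h
    by_cases ha : a = lo i
    · subst ha
      rw [hD.unique h hp, hlo, hother p h1 h2]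
      exact Or.inl rfl
    by_cases ha' : a = hi i
    · subst ha'
      rw [hD.unique h hc, hhi, hother c h3 h4]
      exact Or.inl rfl
    by_cases hap : a = p
    · subst hap
      rw [hD.unique h hp.symm, hlo, hother a h1 h2]
      exact Or.inl rfl
    by_cases hac : a = c
    · subst hac
      rw [hD.unique h hc.symm, hhi, hother a h3 h4]
      exact Or.inl rfl
    have hb := hadj a b h ha ha' hap hac
    exact Or.inr ⟨a, b, hother a ha ha', hother b hb.1 hb.2.1,
      Or.inr (Or.inr (Or.inr (Or.inr ⟨⟨ha, ha', hap, hac⟩, hb, h⟩)))⟩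
  · rintro ⟨d, k⟩ a h
    fin_cases d
    · cases h
      exact Reachable.refl _
    · change ψ (nodeSnd (Sum.inl k)) = some a at h
      change (glue (gArcs i) D).Reachable (nodeSnd (Sum.inl k)) _
      by_cases hk : Sum.inl k = lo i
      · rw [hk, hlo] at h
        rw [hk, ← Option.some.inj h]
        exact rlo
      by_cases hk' : Sum.inl k = hi i
      · rw [hk', hhi] at h
        rw [hk', ← Option.some.inj h]
        exact rhi
      rw [hother _ hk hk'] at h
      rw [← Option.some.inj h]
      exact reachable_snd_outer i D hk hk'
    · cases h
      exact Reachable.refl _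
  · rintro a b (⟨rfl, rfl⟩ | ⟨rfl, rfl⟩ | ⟨rfl, rfl⟩ | ⟨rfl, rfl⟩ | ⟨ha, hb, h⟩)
    · exact reachable_outer_lo_hi i D
    · exact (reachable_outer_lo_hi i D).symm
    · exact rpc
    · exact rpc.symm
    · exact ((reachable_snd_outer i D ha.1 ha.2.1).symm.trans (reachable_snd h)).trans
        (reachable_snd_outer i D hb.1 hb.2.1)

theorem g_comp_adj {D : LabelledArcs N} (hD : D.IsOkada) {i : Fin (N - 1)} {p c : ArcNode N}
    (hp : D.graph.Adj (lo i) p) (hc : D.graph.Adj (hi i) c) (hne : p ≠ hi i)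
    {a b : ArcNode N} : (comp (gArcs i) D).graph.Adj a b ↔
    SwapAdj D.graph (lo i) (hi i) p c a b :=
  (swap_resolution hD hp hc hne).comp_adj

theorem loops_g {D : LabelledArcs N} (hD : D.IsOkada) {i : Fin (N - 1)} {p c : ArcNode N}
    (hp : D.graph.Adj (lo i) p) (hc : D.graph.Adj (hi i) c) (hne : p ≠ hi i)
    (k : ℕ) : loops (gArcs i) D k = 0 := by
  refine (swap_resolution hD hp hc hne).loops_eq_zero ?_ k
  rintro ⟨d, k⟩
  fin_cases d <;> rfl

open Classical in
-- The strand from `p` to `c` passes through the right cap of `g_i`, but the cap's label `i.val + 1`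
-- bounds `D.height (lo i)` from above and so does not enter the minimum. Likewise a straight strand
-- of `g_i` is labelled by its level, which is at least the label of the arc that it prolongs.
theorem g_comp_height {D : LabelledArcs N} (hD : D.IsOkada) {i : Fin (N - 1)} {p c : ArcNode N}
    (hp : D.graph.Adj (lo i) p) (hc : D.graph.Adj (hi i) c) (hne : p ≠ hi i)
    (a : ArcNode N) : (comp (gArcs i) D).height a =
    if a = lo i ∨ a = hi i then i.val + 1
    else if a = p ∨ a = c then min (D.height (lo i)) (D.height (hi i)) else D.height a := by
  have r := swap_resolution hD hp hc hne
  obtain ⟨h1, h2, h3, h4, h5⟩ := distinct_of_not_adj hD hp hc hne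
  have h0 := lo_ne_hi i
  have hup := hD.height_eq _ _ hp
  have hvc := hD.height_eq _ _ hc
  have hu : D.height (lo i) ≤ i.val + 1 := hD.height_le_level (lo i)
  set H : ArcNode N → ℕ := fun a => if a = lo i ∨ a = hi i then i.val + 1
    else if a = p ∨ a = c then min (D.height (lo i)) (D.height (hi i)) else D.height a with hH
  have Hlo : H (lo i) = i.val + 1 := by simp [hH]
  have Hhi : H (hi i) = i.val + 1 := by simp [hH]
  have Hp : H p = min (D.height (lo i)) (D.height (hi i)) := by simp [hH, h1, h2]
  have Hc : H c = min (D.height (lo i)) (D.height (hi i)) := by simp [hH, h3, h4]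
  have Hle : ∀ x, x ≠ lo i → x ≠ hi i → H x ≤ D.height x := by
    intro x e1 e2
    by_cases e3 : x = p
    · rw [e3, Hp]
      omega
    by_cases e4 : x = c
    · rw [e4, Hc]
      omega
    simp [hH, e1, e2, e3, e4]
  refine r.comp_height (H := H) ?_ ?_ ?_ a ?_
  · rintro a b (⟨rfl, rfl⟩ | ⟨rfl, rfl⟩ | ⟨rfl, rfl⟩ | ⟨rfl, rfl⟩ | ⟨ha, hb, h⟩)
    · rw [Hlo, Hhi]
    · rw [Hlo, Hhi]
    · rw [Hp, Hc]
    · rw [Hp, Hc]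
    · simp [hH, ha, hb, hD.height_eq _ _ h]
  · rintro (x | x) b h
    · cases h
      by_cases hx : Sum.inl x = lo i
      · rw [hx, Hlo, gArcs_height_lo]
      by_cases hx' : Sum.inl x = hi i
      · rw [hx', Hhi, gArcs_height_hi]
      rw [(gArcs_height_of_ne i hx').1]
      exact (Hle _ hx hx').trans (hD.height_le_level _)
    · simp only [nodeFst, resolve, Option.some.injEq] at h
      by_cases hx : Sum.inl x = lo i
      · rw [if_pos hx] at h
        rw [← h, Hp, (gArcs_height_of_ne i (hx ▸ h0)).2]
        have : x.val = i.val := by simpa [lo, Fin.ext_iff] using hx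
        omega
      rw [if_neg hx] at h
      by_cases hx' : Sum.inl x = hi i
      · rw [if_pos hx'] at h
        have : x.val = i.val + 1 := by simpa [hi, Fin.ext_iff] using hx'
        have hg : (gArcs i).height (Sum.inr x) = i.val + 1 := by simp [gArcs, level, this]
        rw [← h, Hc, hg]
        omega
      rw [if_neg hx'] at h
      rw [← h, (gArcs_height_of_ne i hx').2]
      exact (Hle _ hx hx').trans (hD.height_le_level _)
  · rintro x b h
    by_cases hx : x = lo i
    · obtain rfl : p = b := by simpa [hx, lo, nodeSnd, resolve] using h
      rw [Hp, hx]
      omega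
    by_cases hx' : x = hi i
    · obtain rfl : c = b := by simpa [hx', hi, lo, nodeSnd, resolve] using h
      rw [Hc, hx']
      omega
    obtain rfl : x = b := by
      rcases x with x | x
      · simpa [nodeSnd, resolve, hx, hx'] using h
      · simpa [nodeSnd, resolve] using h
    exact Hle x hx hx'
  · by_cases e1 : a = lo i
    · rw [e1, Hlo]
      exact ⟨_, Reachable.refl _, Or.inl ⟨lo i, rfl, gArcs_height_lo i⟩⟩
    by_cases e2 : a = hi i
    · rw [e2, Hhi]
      exact ⟨_, Reachable.refl _, Or.inl ⟨hi i, rfl, gArcs_height_hi i⟩⟩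
    have rlo := ((reachable_snd (C := gArcs i) hp).trans (reachable_snd_outer i D h1 h2)).symm
    have rhi := ((reachable_snd (C := gArcs i) hc).trans (reachable_snd_outer i D h3 h4)).symm
    by_cases e3 : a = p
    · rw [e3, Hp]
      rcases min_choice (D.height (lo i)) (D.height (hi i)) with e | e <;> rw [e]
      · exact ⟨_, rlo, Or.inr ⟨lo i, rfl, rfl⟩⟩
      · exact ⟨_, rlo.trans (reachable_snd_lo_hi i D), Or.inr ⟨hi i, rfl, rfl⟩⟩
    by_cases e4 : a = c
    · rw [e4, Hc]
      rcases min_choice (D.height (lo i)) (D.height (hi i)) with e | e <;> rw [e]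
      · exact ⟨_, rhi.trans (reachable_snd_lo_hi i D).symm, Or.inr ⟨lo i, rfl, rfl⟩⟩
      · exact ⟨_, rhi, Or.inr ⟨hi i, rfl, rfl⟩⟩
    exact ⟨_, (reachable_snd_outer i D e1 e2).symm, Or.inr ⟨a, rfl, by simp [hH, e1, e2, e3, e4]⟩⟩

open Classical in
-- The value `none` marks the two middle nodes on the loop. The arc `{lo i, hi i}` of the
-- composition is now the left cap of `g_i`, so the matching is that of `D`.
theorem loop_resolution {D : LabelledArcs N} (hD : D.IsOkada) {i : Fin (N - 1)}
    (h : D.graph.Adj (lo i) (hi i)) :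
    IsResolution (gArcs i) D D.graph.Adj
    (resolve fun k => if Sum.inl k = lo i ∨ Sum.inl k = hi i then none else some (Sum.inl k)) := by
  set ψ : Fin 3 × Fin N → Option (ArcNode N) := (resolve fun k =>
    if Sum.inl k = lo i ∨ Sum.inl k = hi i then none else some (Sum.inl k)) with hψ
  have hlo : ψ (nodeSnd (lo i)) = none := by simp [hψ, lo, nodeSnd, resolve]
  have hhi : ψ (nodeSnd (hi i)) = none := by simp [hψ, hi, nodeSnd, resolve]
  have hother : ∀ x, x ≠ lo i → x ≠ hi i → ψ (nodeSnd x) = some x := by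
    rintro (x | x) hx hx'
    · simp [hψ, nodeSnd, resolve, hx, hx']
    · rfl
  have hadj : ∀ x y, D.graph.Adj x y → x ≠ lo i → x ≠ hi i → y ≠ lo i ∧ y ≠ hi i := by
    intro x y e e1 e2
    refine ⟨?_, ?_⟩ <;> rintro rfl
    exacts [e2 (hD.unique e.symm h), e1 (hD.unique e.symm h.symm)]
  refine ⟨fun _ _ h => h.symm, fun _ h => h.ne rfl, fun _ _ _ => hD.unique, resolve_outer _,
    ?_, ?_, ?_, ?_⟩
  · intro a b e
    refine gArcs_adj_induction i (P := fun a b => ψ (nodeFst a) = ψ (nodeFst b) ∨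
      ∃ c' d, ψ (nodeFst a) = some c' ∧ ψ (nodeFst b) = some d ∧ D.graph.Adj c' d) ?_ ?_ ?_ ?_ e
    · rintro a b (h | ⟨c', d, h, h', h''⟩)
      · exact Or.inl h.symm
      · exact Or.inr ⟨d, c', h', h, h''.symm⟩
    · intro j hj hj'
      exact Or.inl (hother (Sum.inl j) hj hj').symm
    · exact Or.inr ⟨lo i, hi i, rfl, rfl, h⟩
    · exact Or.inl (hlo.trans hhi.symm)
  · intro a b e
    by_cases ha : a = lo i
    · subst ha
      rw [hD.unique e h, hlo, hhi]
      exact Or.inl rfl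
    by_cases ha' : a = hi i
    · subst ha'
      rw [hD.unique e h.symm, hlo, hhi]
      exact Or.inl rfl
    have hb := hadj a b e ha ha'
    exact Or.inr ⟨a, b, hother a ha ha', hother b hb.1 hb.2, e⟩
  · rintro ⟨d, k⟩ a e
    fin_cases d
    · cases e
      exact Reachable.refl _
    · change ψ (nodeSnd (Sum.inl k)) = some a at e
      change (glue (gArcs i) D).Reachable (nodeSnd (Sum.inl k)) _
      by_cases hk : Sum.inl k = lo i
      · rw [hk, hlo] at e
        cases e
      by_cases hk' : Sum.inl k = hi i
      · rw [hk', hhi] at e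
        cases e
      rw [hother _ hk hk'] at e
      rw [← Option.some.inj e]
      exact reachable_snd_outer i D hk hk'
    · cases e
      exact Reachable.refl _
  · intro a b e
    by_cases ha : a = lo i
    · subst ha
      rw [hD.unique e h]
      exact reachable_outer_lo_hi i D
    by_cases ha' : a = hi i
    · subst ha'
      rw [hD.unique e h.symm]
      exact (reachable_outer_lo_hi i D).symm
    have hb := hadj a b e ha ha'
    exact ((reachable_snd_outer i D ha ha').symm.trans (reachable_snd e)).trans
      (reachable_snd_outer i D hb.1 hb.2)

theorem g_comp_adj_of_loop {D : LabelledArcs N} (hD : D.IsOkada) {i : Fin (N - 1)}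
    (h : D.graph.Adj (lo i) (hi i))
    {a b : ArcNode N} : (comp (gArcs i) D).graph.Adj a b ↔
    D.graph.Adj a b :=
  (loop_resolution hD h).comp_adj

open Classical in
theorem g_comp_height_of_loop {D : LabelledArcs N} (hD : D.IsOkada) {i : Fin (N - 1)}
    (h : D.graph.Adj (lo i) (hi i))
    (a : ArcNode N) : (comp (gArcs i) D).height a =
    if a = lo i ∨ a = hi i then i.val + 1 else D.height a := by
  have r := loop_resolution hD h
  set H : ArcNode N → ℕ := fun a => if a = lo i ∨ a = hi i then i.val + 1 else D.height a with hH
  have Hlo : H (lo i) = i.val + 1 := by simp [hH]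
  have Hhi : H (hi i) = i.val + 1 := by simp [hH]
  have Hother : ∀ x, x ≠ lo i → x ≠ hi i → H x = D.height x := by
    intro x e1 e2
    simp [hH, e1, e2]
  refine r.comp_height (H := H) ?_ ?_ ?_ a ?_
  · intro a b e
    by_cases ha : a = lo i
    · subst ha
      rw [hD.unique e h, Hlo, Hhi]
    by_cases ha' : a = hi i
    · subst ha'
      rw [hD.unique e h.symm, Hlo, Hhi]
    rw [Hother a ha ha', Hother b, hD.height_eq _ _ e]
    · rintro rfl
      exact ha' (hD.unique e.symm h)
    · rintro rfl
      exact ha (hD.unique e.symm h.symm)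
  · rintro (x | x) b e
    · cases e
      by_cases hx : Sum.inl x = lo i
      · rw [hx, Hlo, gArcs_height_lo]
      by_cases hx' : Sum.inl x = hi i
      · rw [hx', Hhi, gArcs_height_hi]
      rw [(gArcs_height_of_ne i hx').1, Hother _ hx hx']
      exact hD.height_le_level (Sum.inl x)
    · simp only [nodeFst, resolve] at e
      split_ifs at e with hx
      · push Not at hx
        rw [← Option.some.inj e, (gArcs_height_of_ne i hx.2).2, Hother _ hx.1 hx.2]
        exact hD.height_le_level (Sum.inl x)
  · rintro (x | x) b e
    · simp only [nodeSnd, resolve] at e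
      split_ifs at e with hx
      · push Not at hx
        rw [← Option.some.inj e, Hother _ hx.1 hx.2]
    · cases e
      exact (Hother _ (by simp [lo]) (by simp [hi])).le
  · by_cases e1 : a = lo i
    · rw [e1, Hlo]
      exact ⟨_, Reachable.refl _, Or.inl ⟨lo i, rfl, gArcs_height_lo i⟩⟩
    by_cases e2 : a = hi i
    · rw [e2, Hhi]
      exact ⟨_, Reachable.refl _, Or.inl ⟨hi i, rfl, gArcs_height_hi i⟩⟩
    exact ⟨_, (reachable_snd_outer i D e1 e2).symm, Or.inr ⟨a, rfl, (Hother a e1 e2).symm⟩⟩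

/-- The only loop consists of the arc of `D` at `lo i` and the right cap of `g_i`; the label of the
latter is at least that of the former. -/
theorem loops_g_of_loop {D : LabelledArcs N} (hD : D.IsOkada) {i : Fin (N - 1)}
    (h : D.graph.Adj (lo i) (hi i))
    (k : ℕ) :
    loops (gArcs i) D k = if k = D.height (lo i) then 1 else 0 := by
  classical
  have r := loop_resolution hD h
  have hu : D.height (lo i) ≤ i.val + 1 := hD.height_le_level (lo i)
  have hclosed : ∀ a, ¬ (glue (gArcs i) D).Reachable (nodeOuter a) (nodeSnd (lo i)) := by
    intro a ha
    obtain ⟨b, hb, -⟩ := r.reachable_iff.1 ha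
    simp [lo, nodeSnd, resolve] at hb
  set γ := (glue (gArcs i) D).connectedComponentMk (nodeSnd (lo i)) with hγ
  -- The component contains no boundary node, and every other middle node is connected to one.
  have hnone : ∀ w, (glue (gArcs i) D).Reachable (nodeSnd (lo i)) w →
      w = nodeSnd (lo i) ∨ w = nodeSnd (hi i) := by
    rintro ⟨d, k⟩ hw
    fin_cases d
    · exact (hclosed (Sum.inl k) hw.symm).elim
    · change nodeSnd (Sum.inl k) = _ ∨ nodeSnd (Sum.inl k) = _
      by_contra hk
      push Not at hk
      exact hclosed (Sum.inl k) ((hw.trans (reachable_snd_outer i D (x := Sum.inl k)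
        (fun e => hk.1 (e ▸ rfl)) (fun e => hk.2 (e ▸ rfl)))).symm)
    · exact (hclosed (Sum.inr k) hw.symm).elim
  have hheight : (glue (gArcs i) D).infLabel (ends (gArcs i) D) γ = D.height (lo i) := by
    have hmem : D.height (lo i) ∈ {h | ∃ x, (glue (gArcs i) D).connectedComponentMk x = γ ∧
        h ∈ ends (gArcs i) D x} := ⟨_, rfl, Or.inr ⟨lo i, rfl, rfl⟩⟩
    refine le_antisymm (Nat.sInf_le hmem) (le_csInf ⟨_, hmem⟩ ?_)
    rintro m ⟨x, hx, hm⟩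
    have hx := hnone x (ConnectedComponent.exact hx).symm
    rcases hm with ⟨y, rfl, rfl⟩ | ⟨y, rfl, rfl⟩
    · have hy : y = Sum.inr ⟨i.val, by omega⟩ ∨ y = Sum.inr ⟨i.val + 1, by omega⟩ :=
        hx.imp (fun e => nodeFst_injective e) (fun e => nodeFst_injective e)
      rcases hy with rfl | rfl <;> simpa [gArcs, level] using hu
    · rcases hx with e | e
      · rw [nodeSnd_injective e]
      · rw [nodeSnd_injective e, hD.height_eq _ _ h]
  have hset : (glue (gArcs i) D).closedComponents (ends (gArcs i) D) nodeOuter k =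
      if k = D.height (lo i) then {γ} else ∅ := by
    have huniq : ∀ δ, (∀ a, (glue (gArcs i) D).connectedComponentMk (nodeOuter a) ≠ δ) →
        δ = γ := by
      intro δ hδ
      induction δ using ConnectedComponent.ind with | _ w
      obtain ⟨d, k⟩ := w
      fin_cases d
      · exact (hδ (Sum.inl k) rfl).elim
      · change _ = (glue (gArcs i) D).connectedComponentMk _
        change (glue (gArcs i) D).connectedComponentMk (nodeSnd (Sum.inl k)) = _
        by_cases hk : Sum.inl k = lo i
        · rw [hk]
        by_cases hk' : Sum.inl k = hi i
        · rw [hk']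
          exact ConnectedComponent.sound (reachable_snd_lo_hi i D).symm
        exact (hδ (Sum.inl k) (ConnectedComponent.sound
          (reachable_snd_outer i D hk hk').symm)).elim
      · exact (hδ (Sum.inr k) rfl).elim
    ext δ
    split_ifs with hk
    · simp only [Set.mem_singleton_iff]
      constructor
      · exact fun hδ => huniq δ hδ.1
      · rintro rfl
        exact ⟨fun a ha => hclosed a (ConnectedComponent.exact ha), hheight.trans hk.symm⟩
    · simp only [Set.mem_empty_iff_false, iff_false]
      intro hδ
      rw [huniq δ hδ.1] at hδ
      exact hk (hδ.2.symm.trans hheight)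
  rw [loops_eq, hset]
  split_ifs <;> simp

end LabelledArcs

/-! ### Parity and nesting in Okada arc-diagrams -/

/-- In `ZMod 2` the constants `1` cancel in the pairs of a fixed-point-free involution. -/
theorem Finset.even_card_of_involution {α : Type*} (s : Finset α) (g : ∀ a ∈ s, α)
    (hne : ∀ a ha, g a ha ≠ a) (hmem : ∀ a ha, g a ha ∈ s)
    (hinv : ∀ a ha, g (g a ha) (hmem a ha) = a) : Even s.card := by
  have h : ∑ _a ∈ s, (1 : ZMod 2) = 0 :=
    Finset.sum_involution g (fun _ _ => by decide) (fun a ha _ => hne a ha) hmem hinv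
  rw [Finset.sum_const, nsmul_eq_mul, mul_one] at h
  exact (ZMod.natCast_eq_zero_iff_even).1 h

namespace LabelledArcs

open SimpleGraph ArcNode OkadaDiagram

variable {N : ℕ}

theorem exists_pos_eq {n : ℕ} (h : n < 2 * N) : ∃ a : ArcNode N, a.pos = n := by
  by_cases hn : n < N
  · exact ⟨Sum.inl ⟨n, hn⟩, rfl⟩
  · exact ⟨Sum.inr ⟨2 * N - 1 - n, by omega⟩, by simp only [pos]; omega⟩

/-- A node strictly under an arc has its partner there too, by noncrossing; nesting then makes its
label greater. The orientation of the inner arc is left open, unlike in `nested`. -/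
theorem IsOkada.inside {D : LabelledArcs N} (hD : D.IsOkada) {a b c d : ArcNode N}
    (hab : D.graph.Adj a b) (hcd : D.graph.Adj c d) (h₁ : a.pos < c.pos) (h₂ : c.pos < b.pos) :
    a.pos < d.pos ∧ d.pos < b.pos ∧ D.height a < D.height c := by
  have hda : d.pos ≠ a.pos := by
    intro e
    rw [pos_injective e] at hcd
    rw [hD.unique hab hcd.symm] at h₂
    exact h₂.ne rfl
  have hdb : d.pos ≠ b.pos := by
    intro e
    rw [pos_injective e] at hcd
    rw [hD.unique hab.symm hcd.symm] at h₁
    exact h₁.ne rfl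
  have h3 := hD.noncrossing _ _ _ _ hab hcd
  have h4 := hD.noncrossing _ _ _ _ hcd.symm hab
  have h5 : a.pos < d.pos ∧ d.pos < b.pos := by omega
  refine ⟨h5.1, h5.2, ?_⟩
  rcases lt_trichotomy c.pos d.pos with h | h | h
  · exact hD.nested _ _ _ _ hcd hab h₁ h h5.2
  · exact (hcd.ne (pos_injective h)).elim
  · rw [hD.height_eq _ _ hcd]
    exact hD.nested _ _ _ _ hcd.symm hab h5.1 h h₂

/-- The nodes strictly under an arc are matched among themselves, so their number is even. -/
theorem IsOkada.pos_parity {D : LabelledArcs N} (hD : D.IsOkada) {a b : ArcNode N}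
    (h : D.graph.Adj a b) : (a.pos + b.pos) % 2 = 1 := by
  wlog hab : a.pos < b.pos generalizing a b
  · rw [add_comm]
    exact this h.symm (lt_of_le_of_ne (not_lt.1 hab) fun e => h.ne (pos_injective e).symm)
  classical
  have hb : b.pos < 2 * N := by
    have := pos_level b
    omega
  choose f hf _ using hD.matching
  have hff : ∀ x, f (f x) = x := fun x => hD.unique (hf (f x)) (hf x).symm
  let s : Finset (ArcNode N) := {x | a.pos < x.pos ∧ x.pos < b.pos}
  have hs : Even s.card := by
    refine s.even_card_of_involution (fun x _ => f x) (fun x _ => (hf x).ne') (fun x hx => ?_)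
      fun x _ => hff x
    simp only [s, Finset.mem_filter, Finset.mem_univ, true_and] at hx ⊢
    have := hD.inside h (hf x) hx.1 hx.2
    exact ⟨this.1, this.2.1⟩
  have himg : s.image ArcNode.pos = Finset.Ioo a.pos b.pos := by
    ext n
    simp only [s, Finset.mem_image, Finset.mem_filter, Finset.mem_univ, true_and, Finset.mem_Ioo]
    constructor
    · rintro ⟨x, hx, rfl⟩
      exact hx
    · intro hn
      obtain ⟨x, rfl⟩ := exists_pos_eq (N := N) (hn.2.trans hb)
      exact ⟨x, hn, rfl⟩
  have hcard : s.card = b.pos - a.pos - 1 := by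
    rw [← Nat.card_Ioo, ← himg, Finset.card_image_of_injective _ fun _ _ => pos_injective]
  rw [hcard, Nat.even_iff] at hs
  omega

/-- A single condition on a node under an arc replaces noncrossing and nesting, so that the case
analysis of pairs of arcs is made only once. -/
theorem isOkada_of_inside {D : LabelledArcs N} (matching : ∀ a, ∃! b, D.graph.Adj a b)
    (height_eq : ∀ a b, D.graph.Adj a b → D.height a = D.height b)
    (one_le_height : ∀ a, 1 ≤ D.height a)
    (height_le : ∀ a b, D.graph.Adj a b → D.height a ≤ min a.level b.level)
    (parity : ∀ a b, D.graph.Adj a b → D.height a ≡ min a.level b.level [MOD 2])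
    (inside : ∀ a b c d, D.graph.Adj a b → D.graph.Adj c d → a.pos < c.pos → c.pos < b.pos →
      c.pos < d.pos → d.pos < b.pos ∧ D.height a < D.height c) : D.IsOkada where
  matching := matching
  height_eq := height_eq
  one_le_height := one_le_height
  height_le := height_le
  parity := parity
  noncrossing a b c d hac hbd h := by
    have := inside a c b d hac hbd h.1 h.2.1 (by omega)
    omega
  nested a b c d hab hcd h₁ h₂ h₃ := (inside c d a b hcd hab h₁ (by omega) h₂).2

theorem IsOkada.config {D : LabelledArcs N} (hD : D.IsOkada) {a b c d : ArcNode N}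
    (hab : D.graph.Adj a b) (hcd : D.graph.Adj c d) (h₁ : a.pos < b.pos) (h₂ : c.pos < d.pos)
    (hca : c ≠ a) :
    (a.pos < c.pos ∧ d.pos < b.pos ∧ D.height a < D.height c) ∨
    (c.pos < a.pos ∧ b.pos < d.pos ∧ D.height c < D.height a) ∨
    b.pos < c.pos ∨ d.pos < a.pos := by
  have h3 := hD.inside hab hcd
  have h4 := hD.inside hcd hab
  have h5 : c.pos ≠ a.pos := fun e => hca (pos_injective e)
  have h6 : c.pos ≠ b.pos := fun e => by
    have := pos_injective e
    subst this
    have := hD.unique hab.symm hcd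
    subst this
    omega
  have h7 : d.pos ≠ a.pos := fun e => by
    have := pos_injective e
    subst this
    have := hD.unique hab hcd.symm
    subst this
    omega
  omega

theorem pos_lo (i : Fin (N - 1)) : (lo i).pos = i.val := rfl

theorem pos_hi (i : Fin (N - 1)) : (hi i).pos = i.val + 1 := rfl

/-- The arcs that end in the left nodes `i` and `i + 1`, unless these are joined, are either
disjoint or nested. -/
theorem lo_hi_config {D : LabelledArcs N} (hD : D.IsOkada) {i : Fin (N - 1)} {p c : ArcNode N}
    (hp : D.graph.Adj (lo i) p) (hc : D.graph.Adj (hi i) c) (hne : p ≠ hi i) :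
    (p.pos < i.val ∧ i.val + 1 < c.pos) ∨
    (c.pos < p.pos ∧ p.pos < i.val ∧ D.height (hi i) < D.height (lo i)) ∨
    (c.pos < p.pos ∧ i.val + 1 < c.pos ∧ D.height (lo i) < D.height (hi i)) := by
  obtain ⟨h1, h2, h3, h4, h5⟩ := distinct_of_not_adj hD hp hc hne
  have e1 : p.pos ≠ i.val := fun e => h1 (pos_injective e)
  have e2 : p.pos ≠ i.val + 1 := fun e => h2 (pos_injective e)
  have e3 : c.pos ≠ i.val := fun e => h3 (pos_injective e)
  have e4 : c.pos ≠ i.val + 1 := fun e => h4 (pos_injective e)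
  have f1 := hD.inside hp hc
  have f2 := hD.inside hc.symm hp
  have := hD.height_eq _ _ hc
  simp only [pos_lo, pos_hi] at f1 f2
  omega

/-- Only the label of `{lo i, hi i}` changes, and it becomes as large as its level allows. No node
lies under this arc, so only the arcs over it need attention. -/
theorem g_comp_isOkada_of_loop {D : LabelledArcs N} (hD : D.IsOkada) {i : Fin (N - 1)}
    (h : D.graph.Adj (lo i) (hi i)) : (comp (gArcs i) D).IsOkada := by
  have hadj : ∀ a b, (comp (gArcs i) D).graph.Adj a b ↔ D.graph.Adj a b :=
    fun _ _ => g_comp_adj_of_loop hD h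
  have hH := g_comp_height_of_loop hD h
  have Hlo : (comp (gArcs i) D).height (lo i) = i.val + 1 := by simp [hH]
  have Hhi : (comp (gArcs i) D).height (hi i) = i.val + 1 := by simp [hH]
  have Hother : ∀ x, x ≠ lo i → x ≠ hi i → (comp (gArcs i) D).height x = D.height x := by
    intro x e1 e2
    simp [hH, e1, e2]
  have cases : ∀ a b, D.graph.Adj a b → (a = lo i ∧ b = hi i) ∨ (a = hi i ∧ b = lo i) ∨
      (a ≠ lo i ∧ a ≠ hi i ∧ b ≠ lo i ∧ b ≠ hi i) := by
    intro a b e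
    by_cases e1 : a = lo i
    · subst e1
      exact Or.inl ⟨rfl, hD.unique e h⟩
    by_cases e2 : a = hi i
    · subst e2
      exact Or.inr (Or.inl ⟨rfl, hD.unique e h.symm⟩)
    refine Or.inr (Or.inr ⟨e1, e2, ?_, ?_⟩) <;> rintro rfl
    exacts [e2 (hD.unique e.symm h), e1 (hD.unique e.symm h.symm)]
  apply isOkada_of_inside <;> try simp only [hadj]
  · exact hD.matching
  · intro a b e
    rcases cases a b e with ⟨rfl, rfl⟩ | ⟨rfl, rfl⟩ | ⟨h1, h2, h3, h4⟩
    · rw [Hlo, Hhi]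
    · rw [Hlo, Hhi]
    · rw [Hother a h1 h2, Hother b h3 h4, hD.height_eq _ _ e]
  · intro a
    rw [hH]
    split_ifs
    · omega
    · exact hD.one_le_height a
  · intro a b e
    rcases cases a b e with ⟨rfl, rfl⟩ | ⟨rfl, rfl⟩ | ⟨h1, h2, h3, h4⟩
    · rw [Hlo, level_lo, level_hi]
      omega
    · rw [Hhi, level_lo, level_hi]
      omega
    · rw [Hother a h1 h2]
      exact hD.height_le a b e
  · intro a b e
    rcases cases a b e with ⟨rfl, rfl⟩ | ⟨rfl, rfl⟩ | ⟨h1, h2, h3, h4⟩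
    · rw [Hlo, level_lo, level_hi, min_eq_left (by omega)]
    · rw [Hhi, level_lo, level_hi, min_eq_right (by omega)]
    · rw [Hother a h1 h2]
      exact hD.parity a b e
  · intro a b c d hab hcd h1 h2 h3
    refine ⟨(hD.inside hab hcd h1 h2).2.1, ?_⟩
    have la := hD.height_le_level a
    have pa := pos_level a
    rcases cases c d hcd with ⟨rfl, rfl⟩ | ⟨rfl, rfl⟩ | ⟨e1, e2, e3, e4⟩
    -- An arc over `{lo i, hi i}` starts at a left node of smaller level, which bounds its label by
    -- `i.val`.
    · rw [Hlo, Hother a (by rintro rfl; omega)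
        (by rintro rfl; simp only [pos_lo, pos_hi] at h1; omega)]
      simp only [pos_lo] at h1
      have := i.isLt
      omega
    · simp only [pos_lo, pos_hi] at h3
      omega
    · rcases cases a b hab with ⟨rfl, rfl⟩ | ⟨rfl, rfl⟩ | ⟨e5, e6, e7, e8⟩
      · simp only [pos_lo, pos_hi] at h1 h2
        omega
      · simp only [pos_lo, pos_hi] at h1 h2
        omega
      · rw [Hother a e5 e6, Hother c e1 e2]
        exact (hD.inside hab hcd h1 h2).2.2

/-- Here `hl`, `hh` are the labels at `lo i`, `hi i`, and `lp`, `pp`, `lc`, `pc` are the levels and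
positions of `p` and `c`. A level has the parity of the position on the right boundary and the
opposite parity on the left, so `posp` and `posc` fix the parities of the levels in each of the
three configurations. The first conclusion is the parity condition for the new arc `{p, c}`; the
second makes the interval of lost boxes have even length. -/
theorem swap_parity_aux {M i hl hh lp lc pp pc : ℕ}
    (plp : pp + 1 = lp ∨ pp + lp = 2 * M) (plc : pc + 1 = lc ∨ pc + lc = 2 * M)
    (hlp : lp ≤ M) (hlc : lc ≤ M)
    (parp : hl % 2 = min (i + 1) lp % 2) (parc : hh % 2 = min (i + 2) lc % 2)
    (posp : (i + pp) % 2 = 1) (posc : (i + 1 + pc) % 2 = 1)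
    (conf : (pp < i ∧ i + 1 < pc) ∨ (pc < pp ∧ pp < i ∧ hh < hl) ∨
      (pc < pp ∧ i + 1 < pc ∧ hl < hh)) (hi : i + 1 < M) :
    min hl hh % 2 = min lp lc % 2 ∧ max hl hh % 2 = i % 2 := by
  rcases conf with ⟨c1, c2⟩ | ⟨c1, c2, c3⟩ | ⟨c1, c2, c3⟩
  · rw [min_eq_right (by omega : lp ≤ i + 1)] at parp
    have h1 : hl % 2 = i % 2 := by omega
    have h2 : hh % 2 = i % 2 := by
      rcases le_total (i + 2) lc with h | h
      · rw [min_eq_left h] at parc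
        omega
      · rw [min_eq_right h] at parc
        omega
    have h3 : lp % 2 = i % 2 := by omega
    rcases plc with plc | plc
    · rw [min_eq_left (by omega : lp ≤ lc)]
      omega
    · have h5 : lc % 2 = i % 2 := by omega
      omega
  · rw [min_eq_right c3.le, max_eq_left c3.le, min_eq_right (by omega : lc ≤ lp)]
    rw [min_eq_right (by omega : lp ≤ i + 1)] at parp
    rw [min_eq_right (by omega : lc ≤ i + 2)] at parc
    omega
  · rw [min_eq_left c3.le, max_eq_right c3.le]
    have h1 : hl % 2 = (i + 1) % 2 := by
      rcases plp with plp | plp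
      · rw [min_eq_left (by omega)] at parp
        omega
      · have : lp % 2 = (i + 1) % 2 := by omega
        rcases min_choice (i + 1) lp with e | e <;> rw [e] at parp <;> omega
    have h2 : hh % 2 = i % 2 := by
      rcases plc with plc | plc
      · rw [min_eq_left (by omega)] at parc
        omega
      · rcases min_choice (i + 2) lc with e | e <;> rw [e] at parc <;> omega
    refine ⟨?_, h2⟩
    rcases plp with plp | plp
    · rw [min_eq_right (by omega)]
      omega
    · rcases plc with plc | plc
      · rcases min_choice lp lc with e | e <;> rw [e] <;> omega
      · rw [min_eq_left (by omega)]
        omega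

theorem swap_parity {D : LabelledArcs N} (hD : D.IsOkada) {i : Fin (N - 1)}
    {p c : ArcNode N} (hp : D.graph.Adj (lo i) p) (hc : D.graph.Adj (hi i) c) (hne : p ≠ hi i) :
    min (D.height (lo i)) (D.height (hi i)) % 2 = min p.level c.level % 2 ∧
      max (D.height (lo i)) (D.height (hi i)) % 2 = i.val % 2 :=
  swap_parity_aux (pos_level p).2.2 (pos_level c).2.2 (pos_level p).2.1 (pos_level c).2.1
    (hD.parity _ _ hp) (hD.parity _ _ hc) (hD.pos_parity hp) (hD.pos_parity hc)
    (lo_hi_config hD hp hc hne) (by omega)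

/-- The position of an arc relative to the arc that replaces the arcs at `i` and `i + 1`. -/
theorem swap_config {D : LabelledArcs N} (hD : D.IsOkada) {i : Fin (N - 1)}
    {p c : ArcNode N} (hp : D.graph.Adj (lo i) p) (hc : D.graph.Adj (hi i) c) (hne : p ≠ hi i)
    {a b : ArcNode N} (hab : D.graph.Adj a b) (h : a.pos < b.pos)
    (ha : a ≠ lo i ∧ a ≠ hi i ∧ a ≠ p ∧ a ≠ c) (hb : b ≠ lo i ∧ b ≠ hi i ∧ b ≠ p ∧ b ≠ c) :
    (a.pos < p.pos → p.pos < b.pos →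
      c.pos < b.pos ∧ D.height a < min (D.height (lo i)) (D.height (hi i))) ∧
    (a.pos < c.pos → c.pos < b.pos →
      p.pos < b.pos ∧ D.height a < min (D.height (lo i)) (D.height (hi i))) ∧
    (p.pos < a.pos → a.pos < c.pos →
      b.pos < c.pos ∧ min (D.height (lo i)) (D.height (hi i)) < D.height a) ∧
    (c.pos < a.pos → a.pos < p.pos →
      b.pos < p.pos ∧ min (D.height (lo i)) (D.height (hi i)) < D.height a) := by
  have e1 : a.pos ≠ i.val := fun e => ha.1 (pos_injective e)
  have e2 : a.pos ≠ i.val + 1 := fun e => ha.2.1 (pos_injective e)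
  have e3 : b.pos ≠ i.val := fun e => hb.1 (pos_injective e)
  have e4 : b.pos ≠ i.val + 1 := fun e => hb.2.1 (pos_injective e)
  have hep := hD.height_eq _ _ hp
  have hec := hD.height_eq _ _ hc
  have f1 : a.pos < b.pos → (lo i).pos < p.pos → _ :=
    fun h h' => hD.config hp hab h' h ha.1
  have f2 : a.pos < b.pos → p.pos < (lo i).pos → _ :=
    fun h h' => hD.config hp.symm hab h' h ha.2.2.1
  have f3 : a.pos < b.pos → (hi i).pos < c.pos → _ :=
    fun h h' => hD.config hc hab h' h ha.2.1
  have f4 : a.pos < b.pos → c.pos < (hi i).pos → _ :=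
    fun h h' => hD.config hc.symm hab h' h ha.2.2.2
  simp only [pos_lo, pos_hi] at f1 f2 f3 f4
  -- In each configuration the orientation of both replaced arcs is known, so `{a, b}` is nested
  -- with or disjoint from either of them; linear arithmetic settles the combinations.
  rcases lo_hi_config hD hp hc hne with conf | conf | conf
  · have g1 := f2 h conf.1
    have g2 := f3 h conf.2
    clear f1 f2 f3 f4
    rcases g1 with g1 | g1 | g1 | g1 <;> rcases g2 with g2 | g2 | g2 | g2 <;> omega
  · have g1 := f2 h conf.2.1
    have g2 := f4 h (by omega)
    clear f1 f2 f3 f4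
    rcases g1 with g1 | g1 | g1 | g1 <;> rcases g2 with g2 | g2 | g2 | g2 <;> omega
  · have g1 := f1 h (by omega)
    have g2 := f3 h conf.2.1
    clear f1 f2 f3 f4
    rcases g1 with g1 | g1 | g1 | g1 <;> rcases g2 with g2 | g2 | g2 | g2 <;> omega

/-- The cap `{lo i, hi i}` has the maximal label, which exceeds the level of the left end of any arc
over it. For the arc `{p, c}`, an arc over it has a label below both old labels, and an arc under it
has a label above the smaller one, by `swap_config`. -/
theorem g_comp_isOkada_of_swap {D : LabelledArcs N} (hD : D.IsOkada) {i : Fin (N - 1)}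
    {p c : ArcNode N} (hp : D.graph.Adj (lo i) p) (hc : D.graph.Adj (hi i) c) (hne : p ≠ hi i) :
    (comp (gArcs i) D).IsOkada := by
  classical
  have hadj : ∀ a b, (comp (gArcs i) D).graph.Adj a b ↔ SwapAdj D.graph (lo i) (hi i) p c a b :=
    fun _ _ => g_comp_adj hD hp hc hne
  have r := swap_resolution hD hp hc hne
  have hH := g_comp_height hD hp hc hne
  obtain ⟨n1, n2, n3, n4, n5⟩ := distinct_of_not_adj hD hp hc hne
  have Hlo : (comp (gArcs i) D).height (lo i) = i.val + 1 := by simp [hH]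
  have Hhi : (comp (gArcs i) D).height (hi i) = i.val + 1 := by simp [hH]
  have Hp : (comp (gArcs i) D).height p = min (D.height (lo i)) (D.height (hi i)) := by
    simp [hH, n1, n2]
  have Hc : (comp (gArcs i) D).height c = min (D.height (lo i)) (D.height (hi i)) := by
    simp [hH, n3, n4]
  have Hother : ∀ x, (x ≠ lo i ∧ x ≠ hi i ∧ x ≠ p ∧ x ≠ c) →
      (comp (gArcs i) D).height x = D.height x := by
    rintro x ⟨e1, e2, e3, e4⟩
    simp [hH, e1, e2, e3, e4]
  have hil := i.isLt
  have hplo := pos_lo i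
  have hphi := pos_hi i
  have hllo := level_lo i
  have hlhi := level_hi i
  have plp := pos_level p
  have plc := pos_level c
  have lep := hD.height_le _ _ hp
  have lec := hD.height_le _ _ hc
  have hep := hD.height_eq _ _ hp
  have hec := hD.height_eq _ _ hc
  have conf := lo_hi_config hD hp hc hne
  have olo := hD.one_le_height (lo i)
  have ohi := hD.one_le_height (hi i)
  rw [hllo] at lep
  rw [hlhi] at lec
  apply isOkada_of_inside
  · intro a
    simp only [hadj]
    obtain ⟨b, hb⟩ : ∃ b, SwapAdj D.graph (lo i) (hi i) p c a b := by
      by_cases e1 : a = lo i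
      · exact ⟨_, Or.inl ⟨e1, rfl⟩⟩
      by_cases e2 : a = hi i
      · exact ⟨_, Or.inr (Or.inl ⟨e2, rfl⟩)⟩
      by_cases e3 : a = p
      · exact ⟨_, Or.inr (Or.inr (Or.inl ⟨e3, rfl⟩))⟩
      by_cases e4 : a = c
      · exact ⟨_, Or.inr (Or.inr (Or.inr (Or.inl ⟨e4, rfl⟩)))⟩
      obtain ⟨b, hb, -⟩ := hD.matching a
      refine ⟨b, Or.inr (Or.inr (Or.inr (Or.inr ⟨⟨e1, e2, e3, e4⟩, ⟨?_, ?_, ?_, ?_⟩, hb⟩)))⟩ <;>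
        rintro rfl
      exacts [e3 (hD.unique hb.symm hp), e4 (hD.unique hb.symm hc), e1 (hD.unique hb.symm hp.symm),
        e2 (hD.unique hb.symm hc.symm)]
    exact ⟨b, hb, fun b' hb' => r.unique _ _ _ hb' hb⟩
  · intro a b e
    rcases (hadj a b).1 e with ⟨rfl, rfl⟩ | ⟨rfl, rfl⟩ | ⟨rfl, rfl⟩ | ⟨rfl, rfl⟩ | ⟨ha, hb, e⟩
    · rw [Hlo, Hhi]
    · rw [Hlo, Hhi]
    · rw [Hp, Hc]
    · rw [Hp, Hc]
    · rw [Hother a ha, Hother b hb, hD.height_eq _ _ e]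
  · intro a
    have := hD.one_le_height a
    rw [hH]
    split_ifs <;> omega
  · intro a b e
    rcases (hadj a b).1 e with ⟨rfl, rfl⟩ | ⟨rfl, rfl⟩ | ⟨rfl, rfl⟩ | ⟨rfl, rfl⟩ | ⟨ha, hb, e⟩
    · rw [Hlo]
      omega
    · rw [Hhi]
      omega
    · rw [Hp]
      omega
    · rw [Hc]
      omega
    · rw [Hother a ha]
      exact hD.height_le a b e
  · intro a b e
    unfold Nat.ModEq
    rcases (hadj a b).1 e with ⟨rfl, rfl⟩ | ⟨rfl, rfl⟩ | ⟨rfl, rfl⟩ | ⟨rfl, rfl⟩ | ⟨ha, hb, e⟩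
    · rw [Hlo]
      omega
    · rw [Hhi]
      omega
    · rw [Hp]
      exact (swap_parity hD hp hc hne).1
    · rw [Hc]
      exact (swap_parity hD hp hc hne).1.trans (by rw [min_comm])
    · rw [Hother a ha]
      exact hD.parity a b e
  · intro a b s t hab hst h1 h2 h3
    have la := hD.height_le_level a
    have pa := pos_level a
    rcases (hadj a b).1 hab with ⟨rfl, rfl⟩ | ⟨rfl, rfl⟩ | ⟨rfl, rfl⟩ | ⟨rfl, rfl⟩ | ⟨ha, hb, e⟩
    · omega
    · omega
    · rcases (hadj s t).1 hst with ⟨rfl, rfl⟩ | ⟨rfl, rfl⟩ | ⟨rfl, rfl⟩ | ⟨rfl, rfl⟩ | ⟨hs, ht, f⟩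
      · rw [Hp, Hlo]
        omega
      · omega
      · omega
      · omega
      · rw [Hp, Hother s hs]
        exact (swap_config hD hp hc hne f h3 hs ht).2.2.1 h1 h2
    · rcases (hadj s t).1 hst with ⟨rfl, rfl⟩ | ⟨rfl, rfl⟩ | ⟨rfl, rfl⟩ | ⟨rfl, rfl⟩ | ⟨hs, ht, f⟩
      · omega
      · omega
      · omega
      · omega
      · rw [Hc, Hother s hs]
        exact (swap_config hD hp hc hne f h3 hs ht).2.2.2 h1 h2
    · rw [Hother a ha]
      have hbh : b.pos ≠ (hi i).pos := fun e => hb.2.1 (pos_injective e)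
      rcases (hadj s t).1 hst with ⟨rfl, rfl⟩ | ⟨rfl, rfl⟩ | ⟨rfl, rfl⟩ | ⟨rfl, rfl⟩ | ⟨hs, ht, f⟩
      · rw [Hlo]
        omega
      · omega
      · rw [Hp]
        exact (swap_config hD hp hc hne e (by omega) ha hb).1 h1 h2
      · rw [Hc]
        exact (swap_config hD hp hc hne e (by omega) ha hb).2.1 h1 h2
      · rw [Hother s hs]
        exact (hD.inside e f h1 h2).2

theorem g_comp_isOkada (i : Fin (N - 1)) {D : LabelledArcs N} (hD : D.IsOkada) :
    (comp (gArcs i) D).IsOkada := by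
  obtain ⟨p, hp, -⟩ := hD.matching (lo i)
  obtain ⟨c, hc, -⟩ := hD.matching (hi i)
  by_cases h : p = hi i
  · exact g_comp_isOkada_of_loop hD (h ▸ hp)
  · exact g_comp_isOkada_of_swap hD hp hc h

end LabelledArcs

/-! ### The exponents of the product with an elementary diagram -/

theorem Finset.sum_add_four {α : Type*} [Fintype α] [DecidableEq α] (f f' : α → ℕ)
    {a b c d : α} (hab : a ≠ b) (hac : a ≠ c) (had : a ≠ d) (hbc : b ≠ c) (hbd : b ≠ d)
    (hcd : c ≠ d) (h : ∀ x, x ≠ a → x ≠ b → x ≠ c → x ≠ d → f x = f' x) :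
    ∑ x, f x + (f' a + f' b + f' c + f' d) = ∑ x, f' x + (f a + f b + f c + f d) := by
  have key : ∀ e : α → ℕ, ∑ x, e x = ∑ x ∈ {a, b, c, d}ᶜ, e x + (e a + e b + e c + e d) := by
    intro e
    rw [← Finset.sum_compl_add_sum {a, b, c, d}]
    congr 1
    rw [Finset.sum_insert (by simp [hab, hac, had]), Finset.sum_insert (by simp [hbc, hbd]),
      Finset.sum_insert (by simp [hcd]), Finset.sum_singleton]
    ring
  have hc : ∑ x ∈ {a, b, c, d}ᶜ, f x = ∑ x ∈ {a, b, c, d}ᶜ, f' x := by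
    refine Finset.sum_congr rfl fun x hx => ?_
    simp only [Finset.mem_compl, Finset.mem_insert, Finset.mem_singleton, not_or] at hx
    exact h x hx.1 hx.2.1 hx.2.2.1 hx.2.2.2
  rw [key f, key f', hc]
  ring

theorem Finset.sum_add_two {α : Type*} [Fintype α] [DecidableEq α] (f f' : α → ℕ)
    {a b : α} (hab : a ≠ b) (h : ∀ x, x ≠ a → x ≠ b → f x = f' x) :
    ∑ x, f x + (f' a + f' b) = ∑ x, f' x + (f a + f b) := by
  have key : ∀ e : α → ℕ, ∑ x, e x = ∑ x ∈ {a, b}ᶜ, e x + (e a + e b) := by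
    intro e
    rw [← Finset.sum_compl_add_sum {a, b}, Finset.sum_pair hab]
  have hc : ∑ x ∈ {a, b}ᶜ, f x = ∑ x ∈ {a, b}ᶜ, f' x := by
    refine Finset.sum_congr rfl fun x hx => ?_
    simp only [Finset.mem_compl, Finset.mem_insert, Finset.mem_singleton, not_or] at hx
    exact h x hx.1 hx.2
  rw [key f, key f', hc]
  ring

/-- By `hpar` the interval from `h` to `I` has an even number of elements, so its alternating sum
vanishes when the summation starts at or below `h`. Otherwise `I - k` terms remain, beginning with
`+1`, and they leave `1` exactly when `I - k` is odd and positive. -/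
theorem alternating_sum_interval {M h I : ℕ} (hI : I < M) (hpar : h % 2 = (I + 1) % 2) (k : ℕ) :
    ∑ j ∈ Finset.Ico (k + 1) M, (-1 : ℤ) ^ (j - (k + 1)) * (if h ≤ j ∧ j ≤ I then 1 else 0) =
      if h ≤ k ∧ k < I ∧ (I - k) % 2 = 1 then 1 else 0 := by
  induction hn : M - k generalizing k with
  | zero =>
    rw [Finset.Ico_eq_empty (by omega), Finset.sum_empty, if_neg (by omega)]
  | succ n ih =>
    by_cases hk : k + 1 < M
    · rw [Finset.sum_eq_sum_Ico_succ_bot hk]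
      have hs : ∑ j ∈ Finset.Ico (k + 1 + 1) M,
          (-1 : ℤ) ^ (j - (k + 1)) * (if h ≤ j ∧ j ≤ I then 1 else 0) =
          - ∑ j ∈ Finset.Ico (k + 1 + 1) M,
          (-1 : ℤ) ^ (j - (k + 1 + 1)) * (if h ≤ j ∧ j ≤ I then 1 else 0) := by
        rw [← Finset.sum_neg_distrib]
        refine Finset.sum_congr rfl fun j hj => ?_
        rw [Finset.mem_Ico] at hj
        rw [show j - (k + 1) = j - (k + 1 + 1) + 1 by omega, pow_succ]
        ring
      rw [hs, ih (k + 1) (by omega), Nat.sub_self, pow_zero, one_mul]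
      split_ifs <;> omega
    · rw [Finset.Ico_eq_empty (by omega), Finset.sum_empty, if_neg (by omega)]

namespace LabelledArcs

open SimpleGraph ArcNode OkadaDiagram

variable {N : ℕ}

theorem boxes_eq (D : LabelledArcs N) (j : ℕ) :
    boxes D j = (∑ a : ArcNode N, if D.height a ≤ j ∧ j < a.level then 1 else 0) / 2 := by
  classical
  rw [boxes, Set.ncard_eq_toFinset_card', ← Finset.card_filter]
  congr 2
  ext a
  simp

/-- Only the two nodes of level `i.val + 2` have labels below their level, and the gap consists of
the single row `i.val + 1`. -/
theorem boxes_g (i : Fin (N - 1)) (j : ℕ) :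
    boxes (gArcs i) j = if j = i.val + 1 then 1 else 0 := by
  classical
  have key := Finset.sum_add_two
    (fun a : ArcNode N => if (gArcs i).height a ≤ j ∧ j < a.level then 1 else 0) (fun _ => 0)
    (a := hi i) (b := Sum.inr ⟨i.val + 1, by omega⟩) (by simp [hi]) (by
      intro x h1 h2
      have : x.level ≠ i.val + 2 := by
        rintro e
        rcases x with ⟨x, hx⟩ | ⟨x, hx⟩
        · exact h1 (by simpa [hi, level] using e)
        · exact h2 (by simpa [level] using e)
      have := gArcs_height i x
      rw [if_neg (by omega)])
  have e1 : (gArcs i).height (Sum.inr ⟨i.val + 1, by omega⟩) = i.val + 1 := by simp [gArcs, level]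
  have e2 : level (N := N) (Sum.inr ⟨i.val + 1, by omega⟩) = i.val + 2 := rfl
  rw [boxes_eq]
  simp only [Finset.sum_const_zero, add_zero, zero_add, gArcs_height_hi, level_hi, e1, e2] at key
  rw [key]
  by_cases hj : j = i.val + 1
  · simp [hj]
  · have hn : ¬ (i.val + 1 ≤ j ∧ j < i.val + 2) := by omega
    rw [if_neg hn, if_neg hj]

theorem yExpInt_eq_of_defect {C D : LabelledArcs N} {h I : ℕ} (hI : I < N)
    (hpar : h % 2 = (I + 1) % 2)
    (hd : ∀ j, boxes (comp C D) j + loops C D j + (if h ≤ j ∧ j ≤ I then 1 else 0) =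
      boxes C j + boxes D j) (k : ℕ) :
    yExpInt C D k = if h ≤ k ∧ k < I ∧ (I - k) % 2 = 1 then 1 else 0 := by
  rw [← alternating_sum_interval hI hpar, yExpInt]
  refine Finset.sum_congr rfl fun j _ => ?_
  have := hd j
  congr 1
  split_ifs at this ⊢ <;> omega

/-- The boxes lost are one in each row from the greater of the two labels up to `i.val + 1`, and no
loop is removed. Above the greater label both arcs descended to the cap of `g_i` and are now cut off
there. -/
theorem yExpInt_g_of_swap {D : LabelledArcs N} (hD : D.IsOkada) {i : Fin (N - 1)}
    {p c : ArcNode N} (hp : D.graph.Adj (lo i) p) (hc : D.graph.Adj (hi i) c) (hne : p ≠ hi i)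
    (k : ℕ) : yExpInt (gArcs i) D k =
      if max (D.height (lo i)) (D.height (hi i)) ≤ k ∧ k < i.val + 1 ∧ (i.val + 1 - k) % 2 = 1
      then 1 else 0 := by
  classical
  refine yExpInt_eq_of_defect (by omega) ?_ (fun j => ?_) k
  · have := (swap_parity hD hp hc hne).2
    omega
  obtain ⟨n1, n2, n3, n4, n5⟩ := distinct_of_not_adj hD hp hc hne
  have hH := g_comp_height hD hp hc hne
  have Hlo : (comp (gArcs i) D).height (lo i) = i.val + 1 := by simp [hH]
  have Hhi : (comp (gArcs i) D).height (hi i) = i.val + 1 := by simp [hH]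
  have Hp : (comp (gArcs i) D).height p = min (D.height (lo i)) (D.height (hi i)) := by
    simp [hH, n1, n2]
  have Hc : (comp (gArcs i) D).height c = min (D.height (lo i)) (D.height (hi i)) := by
    simp [hH, n3, n4]
  -- Only the labels at these four nodes change, so the counts of passages can be compared there.
  have key := Finset.sum_add_four
    (fun a => if (comp (gArcs i) D).height a ≤ j ∧ j < a.level then 1 else 0)
    (fun a => if D.height a ≤ j ∧ j < a.level then 1 else 0) (lo_ne_hi i) n1.symm n3.symm
    n2.symm n4.symm n5 (by
      intro x h1 h2 h3 h4
      simp [hH, h1, h2, h3, h4])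
  have lep := hD.height_le _ _ hp
  have lec := hD.height_le _ _ hc
  have hep := hD.height_eq _ _ hp
  have hec := hD.height_eq _ _ hc
  rw [loops_g hD hp hc hne, boxes_g, boxes_eq, boxes_eq]
  simp only [Hlo, Hhi, Hp, Hc, level_lo, level_hi, ← hep, ← hec] at key lep lec
  generalize D.height (lo i) = hl at *
  generalize D.height (hi i) = hh at *
  generalize p.level = lp at *
  generalize c.level = lc at *
  generalize (∑ x : ArcNode N, if (comp (gArcs i) D).height x ≤ j ∧ j < x.level then 1 else 0) = A
    at *
  generalize (∑ x : ArcNode N, if D.height x ≤ j ∧ j < x.level then 1 else 0) = B at *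
  -- In terms of passages, two to a box. The counts `A` and `B` differ by an even number, so the
  -- truncated halves differ accordingly.
  suffices h : A + 2 * (if max hl hh ≤ j ∧ j ≤ i.val + 1 then 1 else 0) =
      B + 2 * (if j = i.val + 1 then 1 else 0) by
    split_ifs at h ⊢ <;> omega
  rcases le_total hl hh with hle | hle
  · rw [min_eq_left hle] at key
    rw [max_eq_right hle]
    clear hH Hlo Hhi Hp Hc hp hc hep hec
    grind
  · rw [min_eq_right hle] at key
    rw [max_eq_left hle]
    clear hH Hlo Hhi Hp Hc hp hc hep hec
    grind

/-- The boxes lost fill the rows from the label of the loop up to `i.val + 1`. The lowest of them is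
accounted for by the loop, which is why the interval starts one higher. -/
theorem yExpInt_g_of_loop {D : LabelledArcs N} (hD : D.IsOkada) {i : Fin (N - 1)}
    (h : D.graph.Adj (lo i) (hi i)) (k : ℕ) : yExpInt (gArcs i) D k =
      if D.height (lo i) + 1 ≤ k ∧ k < i.val + 1 ∧ (i.val + 1 - k) % 2 = 1 then 1 else 0 := by
  classical
  refine yExpInt_eq_of_defect (by omega) ?_ (fun j => ?_) k
  · have := hD.parity _ _ h
    rw [level_lo, level_hi, min_eq_left (by omega)] at this
    unfold Nat.ModEq at this
    omega
  have hH := g_comp_height_of_loop hD h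
  have Hlo : (comp (gArcs i) D).height (lo i) = i.val + 1 := by simp [hH]
  have Hhi : (comp (gArcs i) D).height (hi i) = i.val + 1 := by simp [hH]
  have key := Finset.sum_add_two
    (fun a => if (comp (gArcs i) D).height a ≤ j ∧ j < a.level then 1 else 0)
    (fun a => if D.height a ≤ j ∧ j < a.level then 1 else 0) (lo_ne_hi i) (by
      intro x h1 h2
      simp [hH, h1, h2])
  have le := hD.height_le _ _ h
  rw [loops_g_of_loop hD h, boxes_g, boxes_eq, boxes_eq]
  simp only [Hlo, Hhi, level_lo, level_hi, ← hD.height_eq _ _ h] at key le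
  generalize D.height (lo i) = hl at *
  generalize (∑ x : ArcNode N, if (comp (gArcs i) D).height x ≤ j ∧ j < x.level then 1 else 0) = A
    at *
  generalize (∑ x : ArcNode N, if D.height x ≤ j ∧ j < x.level then 1 else 0) = B at *
  rw [min_eq_left (by omega)] at le
  have h' : A + 2 * (if hl ≤ j ∧ j ≤ i.val + 1 then 1 else 0) =
      B + 2 * (if j = i.val + 1 then 1 else 0) := by
    clear hH Hlo Hhi h
    grind
  clear key
  split_ifs at h' ⊢ <;> omega

theorem yExpInt_g_nonneg (i : Fin (N - 1)) {D : LabelledArcs N} (hD : D.IsOkada) (k : ℕ) :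
    0 ≤ yExpInt (gArcs i) D k := by
  obtain ⟨p, hp, -⟩ := hD.matching (lo i)
  obtain ⟨c, hc, -⟩ := hD.matching (hi i)
  by_cases h : p = hi i
  · rw [yExpInt_g_of_loop hD (h ▸ hp)]
    split_ifs <;> simp
  · rw [yExpInt_g_of_swap hD hp hc h]
    split_ifs <;> simp

end LabelledArcs

/-! ### Factoring out an elementary diagram -/

namespace LabelledArcs

open SimpleGraph ArcNode OkadaDiagram

variable {N : ℕ}

open Classical in
/-- The diagram in which the arcs `{i, i + 1}` and `{p, c}` of `D` are replaced by `{i, p}`, with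
the label of `c`, and `{i + 1, c}`, with label `i + 1`. -/
noncomputable def unswap (D : LabelledArcs N) (i : Fin (N - 1)) (p c : ArcNode N) :
    LabelledArcs N where
  graph :=
    { Adj := fun a b => a ≠ b ∧ SwapAdj D.graph (lo i) p (hi i) c a b
      symm := ⟨fun _ _ h => ⟨h.1.symm, h.2.symm⟩⟩
      loopless := ⟨fun _ h => h.1 rfl⟩ }
  height := fun a => if a = hi i ∨ a = c then i.val + 2 else if a = lo i then D.height c
    else D.height a

theorem unswap_height_lo (D : LabelledArcs N) {i : Fin (N - 1)} (p : ArcNode N) {c : ArcNode N}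
    (h : c ≠ lo i) : (unswap D i p c).height (lo i) = D.height c := by
  simp [unswap, lo_ne_hi, h.symm]

theorem unswap_height_hi (D : LabelledArcs N) (i : Fin (N - 1)) (p c : ArcNode N) :
    (unswap D i p c).height (hi i) = i.val + 2 := by
  simp [unswap]

theorem unswap_height_snd (D : LabelledArcs N) (i : Fin (N - 1)) (p c : ArcNode N) :
    (unswap D i p c).height c = i.val + 2 := by
  simp [unswap]

theorem unswap_height_other (D : LabelledArcs N) {i : Fin (N - 1)} (p : ArcNode N)
    {a c : ArcNode N} (h₁ : a ≠ lo i) (h₂ : a ≠ hi i) (h₃ : a ≠ c) :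
    (unswap D i p c).height a = D.height a := by
  simp [unswap, h₁, h₂, h₃]

theorem unswap_parity_aux {M i h lp lc pp pc : ℕ}
    (plp : pp + 1 = lp ∨ pp + lp = 2 * M) (plc : pc + 1 = lc ∨ pc + lc = 2 * M)
    (hlp : lp ≤ M) (hlc : lc ≤ M) (hi : i + 1 < M) (hlevel : i + 2 ≤ lc)
    (par : h % 2 = min lc lp % 2) (posp : (pc + pp) % 2 = 1) (posc : pc % 2 = i % 2)
    (conf : pp < i ∨ pc < pp) (hpos : i + 1 < pc) : h % 2 = min (i + 1) lp % 2 := by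
  rcases conf with conf | conf
  · rw [min_eq_right (by omega)] at par ⊢
    exact par
  · rcases plp with plp | plp
    · rw [min_eq_left (by omega)] at par ⊢
      omega
    · have h1 : lp % 2 = (i + 1) % 2 := by omega
      have h2 : min (i + 1) lp % 2 = (i + 1) % 2 := by
        rcases min_choice (i + 1) lp with e | e <;> rw [e]
        exact h1
      rw [h2, par]
      rcases plc with plc | plc
      · rcases min_choice lc lp with e | e <;> rw [e] <;> omega
      · rw [min_eq_right (by omega), h1]

theorem unswap_distinct {D : LabelledArcs N} (hD : D.IsOkada) {i : Fin (N - 1)} {p c : ArcNode N}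
    (hadj : D.graph.Adj (lo i) (hi i)) (hpc : D.graph.Adj c p)
    (hclo : c ≠ lo i) (hchi : c ≠ hi i) :
    p ≠ lo i ∧ p ≠ hi i ∧ p ≠ c := by
  refine ⟨?_, ?_, hpc.ne'⟩ <;> rintro rfl
  exacts [hchi (hD.unique hpc.symm hadj), hclo (hD.unique hpc.symm hadj.symm)]

theorem unswap_adj {D : LabelledArcs N} (hD : D.IsOkada) {i : Fin (N - 1)} {p c : ArcNode N}
    (hadj : D.graph.Adj (lo i) (hi i)) (hpc : D.graph.Adj c p)
    (hclo : c ≠ lo i) (hchi : c ≠ hi i)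
    {a b : ArcNode N} : (unswap D i p c).graph.Adj a b ↔
    SwapAdj D.graph (lo i) p (hi i) c a b := by
  obtain ⟨n1, n2, n3⟩ := unswap_distinct hD hadj hpc hclo hchi
  exact ⟨fun h => h.2, fun h => ⟨h.ne n1.symm hchi.symm, h⟩⟩

theorem unswap_height_fst {D : LabelledArcs N} (hD : D.IsOkada) {i : Fin (N - 1)} {p c : ArcNode N}
    (hadj : D.graph.Adj (lo i) (hi i)) (hpc : D.graph.Adj c p)
    (hclo : c ≠ lo i) (hchi : c ≠ hi i) :
    (unswap D i p c).height p = D.height c := by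
  obtain ⟨n1, n2, n3⟩ := unswap_distinct hD hadj hpc hclo hchi
  rw [unswap_height_other D p n1 n2 n3, hD.height_eq _ _ hpc]

theorem unswap_other {D : LabelledArcs N} (hD : D.IsOkada) {i : Fin (N - 1)} {p c : ArcNode N}
    (hadj : D.graph.Adj (lo i) (hi i)) (hpc : D.graph.Adj c p)
    (hclo : c ≠ lo i) (hchi : c ≠ hi i)
    {a b : ArcNode N} (h : D.graph.Adj a b)
    (ha : a ≠ lo i ∧ a ≠ p ∧ a ≠ hi i ∧ a ≠ c) :
    b ≠ lo i ∧ b ≠ p ∧ b ≠ hi i ∧ b ≠ c := by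
  refine ⟨?_, ?_, ?_, ?_⟩ <;> rintro rfl
  exacts [ha.2.2.1 (hD.unique h.symm hadj), ha.2.2.2 (hD.unique h.symm hpc.symm),
    ha.1 (hD.unique h.symm hadj.symm), ha.2.1 (hD.unique h.symm hpc)]

/-- The labels at `hi i` and `c` rise to `i.val + 2`, while that at `lo i` falls from `i.val + 1` to
`D.height c`: the sum of the deficits drops by `2`. -/
theorem sum_level_sub_unswap {D : LabelledArcs N} (hD : D.IsOkada) {i : Fin (N - 1)}
    {p c : ArcNode N}
    (hadj : D.graph.Adj (lo i) (hi i)) (hpc : D.graph.Adj c p)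
    (hclo : c ≠ lo i) (hchi : c ≠ hi i)
    (hheight : D.height c ≤ i.val + 1)
    (hlevel : i.val + 2 ≤ c.level) (hlabel : D.height (lo i) = i.val + 1) :
    ∑ a : ArcNode N, (a.level - (unswap D i p c).height a) <
      ∑ a : ArcNode N, (a.level - D.height a) := by
  classical
  obtain ⟨n1, n2, n3⟩ := unswap_distinct hD hadj hpc hclo hchi
  have key := Finset.sum_add_four (fun a : ArcNode N => a.level - (unswap D i p c).height a)
    (fun a => a.level - D.height a) (lo_ne_hi i) n1.symm hclo.symm n2.symm hchi.symm n3 (by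
      intro x h1 h2 h3 h4
      rw [unswap_height_other D p h1 h2 h4])
  have le := hD.height_le _ _ hpc
  have h1 := hD.height_eq _ _ hpc
  have h2 := hD.height_eq _ _ hadj
  simp only [unswap_height_lo D p hclo, unswap_height_hi D i p c,
    unswap_height_fst hD hadj hpc hclo hchi, unswap_height_snd D i p c,
    level_lo, level_hi] at key
  omega

set_option maxHeartbeats 400000 in
-- By `hbetween` the nodes between `hi i` and `c` are matched among themselves with labels above
-- `i.val + 2`, the label of the new arc `{hi i, c}`. In particular `p` is not among them. An arc of
-- `D` that remains and lies over `hi i` starts left of `lo i`, so its level keeps its label small.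
theorem unswap_inside {D : LabelledArcs N} (hD : D.IsOkada) {i : Fin (N - 1)} {p c : ArcNode N}
    (hadj : D.graph.Adj (lo i) (hi i)) (hpc : D.graph.Adj c p)
    (hclo : c ≠ lo i) (hchi : c ≠ hi i)
    (hheight : D.height c ≤ i.val + 1)
    (hlevel : i.val + 2 ≤ c.level) (hpos : i.val + 1 < c.pos) (hpar : c.pos % 2 = i.val % 2)
    (hbetween : ∀ s t, D.graph.Adj s t → i.val + 1 < s.pos → s.pos < c.pos →
      i.val + 1 < t.pos ∧ t.pos < c.pos ∧ i.val + 2 < D.height s)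
    (a b s t : ArcNode N) (hab : (unswap D i p c).graph.Adj a b)
    (hst : (unswap D i p c).graph.Adj s t) (h1 : a.pos < s.pos) (h2 : s.pos < b.pos)
    (h3 : s.pos < t.pos) :
    t.pos < b.pos ∧ (unswap D i p c).height a < (unswap D i p c).height s := by
  obtain ⟨n1, n2, n3⟩ := unswap_distinct hD hadj hpc hclo hchi
  have hA : ∀ a b, (unswap D i p c).graph.Adj a b ↔ SwapAdj D.graph (lo i) p (hi i) c a b :=
    fun _ _ => unswap_adj hD hadj hpc hclo hchi
  have Hlo := unswap_height_lo D p hclo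
  have Hhi := unswap_height_hi D i p c
  have Hp := unswap_height_fst hD hadj hpc hclo hchi
  have Hc := unswap_height_snd D i p c
  have Hother : ∀ a, (a ≠ lo i ∧ a ≠ p ∧ a ≠ hi i ∧ a ≠ c) →
      (unswap D i p c).height a = D.height a :=
    fun a ha => unswap_height_other D p ha.1 ha.2.2.1 ha.2.2.2
  have hil := i.isLt
  have hplo := pos_lo i
  have hphi := pos_hi i
  have hllo := level_lo i
  have hlhi := level_hi i
  have plp := pos_level p
  have plc := pos_level c
  have he := hD.height_eq _ _ hpc
  have ep1 : p.pos ≠ i.val := fun e => n1 (pos_injective e)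
  have ep2 : p.pos ≠ i.val + 1 := fun e => n2 (pos_injective e)
  have ep3 : p.pos ≠ c.pos := fun e => n3 (pos_injective e)
  have conf : p.pos < i.val ∨ c.pos < p.pos := by
    have := hbetween p c hpc.symm
    omega
  rcases (hA a b).1 hab with ⟨rfl, rfl⟩ | ⟨rfl, rfl⟩ | ⟨rfl, rfl⟩ | ⟨rfl, rfl⟩ | ⟨ha, hb, e⟩
  · rcases (hA s t).1 hst with ⟨rfl, rfl⟩ | ⟨rfl, rfl⟩ | ⟨rfl, rfl⟩ | ⟨rfl, rfl⟩ | ⟨hs, ht, f⟩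
    · omega
    · omega
    · rw [Hlo, Hhi]
      omega
    · omega
    · rw [Hlo, Hother s hs]
      have e1 : s.pos ≠ (hi i).pos := fun e => hs.2.2.1 (pos_injective e)
      have e2 : s.pos ≠ c.pos := fun e => hs.2.2.2 (pos_injective e)
      have f1 := hbetween s t f
      have f2 := hD.inside hpc f
      omega
  · rcases (hA s t).1 hst with ⟨rfl, rfl⟩ | ⟨rfl, rfl⟩ | ⟨rfl, rfl⟩ | ⟨rfl, rfl⟩ | ⟨hs, ht, f⟩
    · omega
    · omega
    · omega
    · omega
    · rw [Hp, Hother s hs]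
      have e1 : t.pos ≠ (hi i).pos := fun e => ht.2.2.1 (pos_injective e)
      have e2 : t.pos ≠ (lo i).pos := fun e => ht.1 (pos_injective e)
      have f1 := hbetween t s f.symm
      have f2 := hD.inside hpc.symm f
      omega
  · rcases (hA s t).1 hst with ⟨rfl, rfl⟩ | ⟨rfl, rfl⟩ | ⟨rfl, rfl⟩ | ⟨rfl, rfl⟩ | ⟨hs, ht, f⟩
    · omega
    · omega
    · omega
    · omega
    · rw [Hhi, Hother s hs]
      have f1 := hbetween s t f
      omega
  · omega
  · rw [Hother a ha]
    have e1 : b.pos ≠ (hi i).pos := fun e => hb.2.2.1 (pos_injective e)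
    have e2 : b.pos ≠ c.pos := fun e => hb.2.2.2 (pos_injective e)
    have e3 : a.pos ≠ (lo i).pos := fun e => ha.1 (pos_injective e)
    have f1 := hbetween b a e.symm
    have f2 := hD.inside e hpc
    have la := hD.height_le_level a
    have pa := pos_level a
    rcases (hA s t).1 hst with ⟨rfl, rfl⟩ | ⟨rfl, rfl⟩ | ⟨rfl, rfl⟩ | ⟨rfl, rfl⟩ | ⟨hs, ht, f⟩
    · rw [Hlo]
      omega
    · rw [Hp]
      have f3 := hD.inside e hpc.symm h1 h2
      omega
    · rw [Hhi]
      omega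
    · omega
    · rw [Hother s hs]
      exact (hD.inside e f h1 h2).2

theorem unswap_isOkada {D : LabelledArcs N} (hD : D.IsOkada) {i : Fin (N - 1)} {p c : ArcNode N}
    (hadj : D.graph.Adj (lo i) (hi i)) (hpc : D.graph.Adj c p)
    (hclo : c ≠ lo i) (hchi : c ≠ hi i)
    (hheight : D.height c ≤ i.val + 1)
    (hlevel : i.val + 2 ≤ c.level) (hpos : i.val + 1 < c.pos) (hpar : c.pos % 2 = i.val % 2)
    (hbetween : ∀ s t, D.graph.Adj s t → i.val + 1 < s.pos → s.pos < c.pos →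
      i.val + 1 < t.pos ∧ t.pos < c.pos ∧ i.val + 2 < D.height s) :
    (unswap D i p c).IsOkada := by
  obtain ⟨n1, n2, n3⟩ := unswap_distinct hD hadj hpc hclo hchi
  have hA : ∀ a b, (unswap D i p c).graph.Adj a b ↔ SwapAdj D.graph (lo i) p (hi i) c a b :=
    fun _ _ => unswap_adj hD hadj hpc hclo hchi
  have Hlo := unswap_height_lo D p hclo
  have Hhi := unswap_height_hi D i p c
  have Hp := unswap_height_fst hD hadj hpc hclo hchi
  have Hc := unswap_height_snd D i p c
  have Hother : ∀ a, (a ≠ lo i ∧ a ≠ p ∧ a ≠ hi i ∧ a ≠ c) →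
      (unswap D i p c).height a = D.height a :=
    fun a ha => unswap_height_other D p ha.1 ha.2.2.1 ha.2.2.2
  have hil := i.isLt
  have hplo := pos_lo i
  have hphi := pos_hi i
  have hllo := level_lo i
  have hlhi := level_hi i
  have plp := pos_level p
  have plc := pos_level c
  have le := hD.height_le _ _ hpc
  have he := hD.height_eq _ _ hpc
  have o := hD.one_le_height c
  have ep1 : p.pos ≠ i.val := fun e => n1 (pos_injective e)
  have ep2 : p.pos ≠ i.val + 1 := fun e => n2 (pos_injective e)
  have ep3 : p.pos ≠ c.pos := fun e => n3 (pos_injective e)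
  have conf : p.pos < i.val ∨ c.pos < p.pos := by
    have := hbetween p c hpc.symm
    omega
  apply isOkada_of_inside
  · intro a
    simp only [hA]
    obtain ⟨b, hb⟩ : ∃ b, SwapAdj D.graph (lo i) p (hi i) c a b := by
      by_cases e1 : a = lo i
      · exact ⟨_, Or.inl ⟨e1, rfl⟩⟩
      by_cases e2 : a = p
      · exact ⟨_, Or.inr (Or.inl ⟨e2, rfl⟩)⟩
      by_cases e3 : a = hi i
      · exact ⟨_, Or.inr (Or.inr (Or.inl ⟨e3, rfl⟩))⟩
      by_cases e4 : a = c
      · exact ⟨_, Or.inr (Or.inr (Or.inr (Or.inl ⟨e4, rfl⟩)))⟩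
      obtain ⟨b, hb, -⟩ := hD.matching a
      exact ⟨b, Or.inr (Or.inr (Or.inr (Or.inr ⟨⟨e1, e2, e3, e4⟩,
        unswap_other hD hadj hpc hclo hchi hb ⟨e1, e2, e3, e4⟩, hb⟩)))⟩
    exact ⟨b, hb, fun b' hb' => hb'.unique (fun _ _ _ => hD.unique) n1.symm hchi.symm
      (lo_ne_hi i) hclo.symm n2 n3 hb⟩
  · intro a b e
    rcases (hA a b).1 e with ⟨rfl, rfl⟩ | ⟨rfl, rfl⟩ | ⟨rfl, rfl⟩ | ⟨rfl, rfl⟩ | ⟨ha, hb, e⟩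
    · rw [Hlo, Hp]
    · rw [Hlo, Hp]
    · rw [Hhi, Hc]
    · rw [Hhi, Hc]
    · rw [Hother a ha, Hother b hb, hD.height_eq _ _ e]
  · intro a
    have := hD.one_le_height a
    unfold unswap
    dsimp only
    split_ifs <;> omega
  · intro a b e
    rcases (hA a b).1 e with ⟨rfl, rfl⟩ | ⟨rfl, rfl⟩ | ⟨rfl, rfl⟩ | ⟨rfl, rfl⟩ | ⟨ha, hb, e⟩
    · rw [Hlo]
      omega
    · rw [Hp]
      omega
    · rw [Hhi]
      omega
    · rw [Hc]
      omega
    · rw [Hother a ha]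
      exact hD.height_le a b e
  · have par : D.height c % 2 = min (i.val + 1) p.level % 2 :=
      unswap_parity_aux plp.2.2 plc.2.2 plp.2.1 plc.2.1 (by omega) hlevel (hD.parity _ _ hpc)
        (hD.pos_parity hpc) hpar conf hpos
    intro a b e
    unfold Nat.ModEq
    rcases (hA a b).1 e with ⟨rfl, rfl⟩ | ⟨rfl, rfl⟩ | ⟨rfl, rfl⟩ | ⟨rfl, rfl⟩ | ⟨ha, hb, e⟩
    · rw [Hlo, hllo, par]
    · rw [Hp, hllo, par, min_comm]
    · rw [Hhi, hlhi, min_eq_left hlevel]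
    · rw [Hc, hlhi, min_eq_right hlevel]
    · rw [Hother a ha]
      exact hD.parity a b e
  · exact unswap_inside hD hadj hpc hclo hchi hheight hlevel hpos hpar hbetween

/-- Multiplication by `g_i` joins `lo i, hi i` and `p, c` again. The smaller label `D.height c`
returns to `{p, c}`, and `hlabel` says that the label of the cap is the original one. -/
theorem g_comp_unswap {D : LabelledArcs N} (hD : D.IsOkada) {i : Fin (N - 1)} {p c : ArcNode N}
    (hadj : D.graph.Adj (lo i) (hi i)) (hpc : D.graph.Adj c p)
    (hclo : c ≠ lo i) (hchi : c ≠ hi i)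
    (hheight : D.height c ≤ i.val + 1)
    (hlevel : i.val + 2 ≤ c.level) (hpos : i.val + 1 < c.pos) (hpar : c.pos % 2 = i.val % 2)
    (hbetween : ∀ s t, D.graph.Adj s t → i.val + 1 < s.pos → s.pos < c.pos →
      i.val + 1 < t.pos ∧ t.pos < c.pos ∧ i.val + 2 < D.height s)
    (hlabel : D.height (lo i) = i.val + 1) :
    comp (gArcs i) (unswap D i p c) = D ∧ (∀ k, loops (gArcs i) (unswap D i p c) k = 0) ∧
      ∀ k, yExpInt (gArcs i) (unswap D i p c) k = 0 := by
  have hU := unswap_isOkada hD hadj hpc hclo hchi hheight hlevel hpos hpar hbetween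
  obtain ⟨n1, n2, n3⟩ := unswap_distinct hD hadj hpc hclo hchi
  have hA : ∀ a b, (unswap D i p c).graph.Adj a b ↔ SwapAdj D.graph (lo i) p (hi i) c a b :=
    fun _ _ => unswap_adj hD hadj hpc hclo hchi
  have hp : (unswap D i p c).graph.Adj (lo i) p := (hA _ _).2 (Or.inl ⟨rfl, rfl⟩)
  have hc : (unswap D i p c).graph.Adj (hi i) c :=
    (hA _ _).2 (Or.inr (Or.inr (Or.inl ⟨rfl, rfl⟩)))
  have Hlo := unswap_height_lo D p hclo
  have Hhi := unswap_height_hi D i p c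
  refine ⟨?_, loops_g hU hp hc n2, fun k => ?_⟩
  · ext a b
    · rw [g_comp_adj hU hp hc n2]
      constructor
      · rintro (⟨rfl, rfl⟩ | ⟨rfl, rfl⟩ | ⟨rfl, rfl⟩ | ⟨rfl, rfl⟩ | ⟨ha, hb, h⟩)
        · exact hadj
        · exact hadj.symm
        · exact hpc.symm
        · exact hpc
        · rcases (hA a b).1 h with h | h | h | h | h
          · exact (ha.1 h.1).elim
          · exact (ha.2.2.1 h.1).elim
          · exact (ha.2.1 h.1).elim
          · exact (ha.2.2.2 h.1).elim
          · exact h.2.2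
      · intro h
        by_cases e1 : a = lo i
        · subst e1
          exact Or.inl ⟨rfl, hD.unique h hadj⟩
        by_cases e2 : a = hi i
        · subst e2
          exact Or.inr (Or.inl ⟨rfl, hD.unique h hadj.symm⟩)
        by_cases e3 : a = p
        · subst e3
          exact Or.inr (Or.inr (Or.inl ⟨rfl, hD.unique h hpc.symm⟩))
        by_cases e4 : a = c
        · subst e4
          exact Or.inr (Or.inr (Or.inr (Or.inl ⟨rfl, hD.unique h hpc⟩)))
        have hb := unswap_other hD hadj hpc hclo hchi h ⟨e1, e3, e2, e4⟩
        exact Or.inr (Or.inr (Or.inr (Or.inr ⟨⟨e1, e2, e3, e4⟩, ⟨hb.1, hb.2.2.1, hb.2.1, hb.2.2.2⟩,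
          (hA a b).2 (Or.inr (Or.inr (Or.inr (Or.inr ⟨⟨e1, e3, e2, e4⟩, hb, h⟩))))⟩)))
    · rw [g_comp_height hU hp hc n2, Hlo, Hhi]
      split_ifs with h1 h2
      · rcases h1 with rfl | rfl
        · exact hlabel.symm
        · rw [← hD.height_eq _ _ hadj, hlabel]
      · rw [min_eq_left (by omega)]
        rcases h2 with rfl | rfl
        · exact hD.height_eq _ _ hpc
        · rfl
      · push Not at h1 h2
        exact unswap_height_other D p h1.1 h1.2 h2.2
  -- The greater label is `i.val + 2`, above row `i.val + 1`, so no boxes are lost.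
  · rw [yExpInt_g_of_swap hU hp hc n2, Hlo, Hhi, if_neg]
    omega

/-! ### The top of a diagram and the factorization that it determines. -/

/-- All labels at levels above `k` are maximal. -/
def MaximalAbove (D : LabelledArcs N) (k : ℕ) : Prop :=
  ∀ a : ArcNode N, k < a.level → D.height a = a.level

/-- All labels at levels above `k` are maximal, and `j + 1` is the greatest level up to `k` at which
the label of the left node is maximal. -/
structure HasTop (D : LabelledArcs N) (k : ℕ) (j : Fin N) : Prop where
  above : MaximalAbove D k
  lt : j.val < k
  height_eq : D.height (Sum.inl j) = j.val + 1
  height_le : ∀ l : Fin N, j < l → l.val < k → D.height (Sum.inl l) ≤ l.val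

theorem MaximalAbove.level_eq {D : LabelledArcs N} (hD : D.IsOkada) {k : ℕ}
    (h : MaximalAbove D k) {a b : ArcNode N} (hab : D.graph.Adj a b) (ha : k < a.level) :
    b.level = a.level := by
  have h1 := h a ha
  have h2 := hD.height_le _ _ hab
  have h3 := hD.height_eq _ _ hab
  have h4 := h b (by omega)
  omega

/-- The partner of `lo i` has level at least the label `i.val + 1`, so it lies to the right of `lo
i`. If it were not `hi i`, then `hi i` would lie under the arc and have a label above `i.val + 1`,
which the choice of the top excludes. -/
theorem HasTop.adj_hi {D : LabelledArcs N} (hD : D.IsOkada) {k : ℕ} {i : Fin (N - 1)}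
    (h : HasTop D k ⟨i.val, by omega⟩) (hik : i.val + 1 < k) : D.graph.Adj (lo i) (hi i) := by
  obtain ⟨b, hb, -⟩ := hD.matching (lo i)
  obtain ⟨d, hd, -⟩ := hD.matching (hi i)
  have h1 : D.height (lo i) = i.val + 1 := h.height_eq
  have h2 : D.height (hi i) ≤ i.val + 1 := h.height_le ⟨i.val + 1, by omega⟩ (by simp) hik
  have h3 := hD.height_le _ _ hb
  have h4 := pos_level b
  have h5 := hD.inside hb hd
  have h6 : b.pos ≠ (lo i).pos := fun e => hb.ne (pos_injective e).symm
  rw [pos_lo] at h5 h6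
  rw [pos_hi] at h5
  have h7 : b.pos = (hi i).pos := by
    rw [pos_hi]
    omega
  rwa [← pos_injective h7]

/-- The maximal label forces the partner to have level at least `k`; a level above `k` would be
shared by both ends. So the partner is the other node of level `k`. -/
theorem HasTop.adj_inr {D : LabelledArcs N} (hD : D.IsOkada) {k : ℕ} {j : Fin N}
    (h : HasTop D k j) (hjk : j.val + 1 = k) : D.graph.Adj (Sum.inl j) (Sum.inr j) := by
  obtain ⟨b, hb, -⟩ := hD.matching (Sum.inl j)
  have h1 := h.height_eq
  have h2 := hD.height_le _ _ hb
  have h3 := fun hk => h.above.level_eq hD hb.symm hk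
  have h4 : ArcNode.level (N := N) (Sum.inl j) = j.val + 1 := rfl
  have h5 : b.level = j.val + 1 := by omega
  rcases b with b | b
  · obtain rfl : b = j := Fin.ext (by simpa [level] using h5)
    exact (hb.ne rfl).elim
  · obtain rfl : b = j := Fin.ext (by simpa [level] using h5)
    exact hb

theorem eq_id_of_maximalAbove {D : LabelledArcs N} (hD : D.IsOkada) (h : MaximalAbove D 0) :
    D = (OkadaDiagram.id N).1 := by
  have key : ∀ a b, (OkadaDiagram.id N).1.graph.Adj a b → D.graph.Adj a b := by
    intro a b hab
    obtain ⟨c, hc, -⟩ := hD.matching a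
    have h1 := h.level_eq hD hc (by have := pos_level a; omega)
    have h2 := hc.ne
    suffices hcb : c = b from hcb ▸ hc
    obtain ⟨j, ⟨rfl, rfl⟩ | ⟨rfl, rfl⟩⟩ := id_adj.1 hab <;> rcases c with c | c
    · exact (h2 (by simpa [level, Fin.ext_iff, eq_comm] using h1)).elim
    · simpa [level, Fin.ext_iff] using h1
    · simpa [level, Fin.ext_iff] using h1
    · exact (h2 (by simpa [level, Fin.ext_iff, eq_comm] using h1)).elim
  ext a b
  · refine ⟨fun hab => ?_, key a b⟩
    obtain ⟨c, hc, -⟩ := (OkadaDiagram.id N).2.matching a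
    rwa [hD.unique hab (key a c hc)]
  · exact h a (by have := pos_level a; omega)

/-- A diagram other than the identity has a greatest level at which a label is not maximal, and
below it a greatest level at which the label of the left node is maximal. -/
theorem exists_hasTop {D : LabelledArcs N} (hD : D.IsOkada) (hne : D ≠ (OkadaDiagram.id N).1) :
    ∃ (k : ℕ) (i : Fin (N - 1)), HasTop D k ⟨i.val, by omega⟩ ∧ i.val + 1 < k ∧ k ≤ N := by
  classical
  have hN : MaximalAbove D N := fun a ha => by
    have := pos_level a
    omega
  have hex : ∃ k, MaximalAbove D k := ⟨N, hN⟩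
  set k := Nat.find hex with hk
  have hkN : k ≤ N := Nat.find_min' hex hN
  have habove : MaximalAbove D k := Nat.find_spec hex
  have hk0 : k ≠ 0 := fun e => hne (eq_id_of_maximalAbove hD (e ▸ habove))
  have hnot : ¬ MaximalAbove D (k - 1) := Nat.find_min hex (by omega)
  unfold MaximalAbove at hnot
  push Not at hnot
  obtain ⟨a, ha, hane⟩ := hnot
  have hale := hD.height_le_level a
  have hak : a.level = k := by
    by_contra hak
    exact hane (habove a (by omega))
  let t : Fin N := ⟨k - 1, by omega⟩
  -- If the left node of level `k` had maximal label, it would be joined to the opposite node, so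
  -- both nodes of this level would have maximal labels.
  have ht : D.height (Sum.inl t) ≤ t.val := by
    by_contra hlt
    have h1 := hD.height_le_level (Sum.inl t)
    have h2 : ArcNode.level (N := N) (Sum.inl t) = t.val + 1 := rfl
    have h3 : HasTop D k t :=
      ⟨habove, by simp only [t]; omega, by omega, fun l hl hlk => by
        simp only [t, Fin.lt_def] at hl
        omega⟩
    have h4 := hD.height_eq _ _ (h3.adj_inr hD (by simp only [t]; omega))
    rcases a with x | x
    · have hx : x = t := Fin.ext (by simp only [level] at hak; simp only [t]; omega)
      rw [hx] at hane
      omega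
    · have hx : x = t := Fin.ext (by simp only [level] at hak; simp only [t]; omega)
      have h5 : ArcNode.level (N := N) (Sum.inr t) = t.val + 1 := rfl
      rw [hx] at hane
      omega
  have hone := hD.one_le_height (Sum.inl t)
  have htk : t.val + 1 = k := by simp only [t]; omega
  let s : Finset (Fin N) := {l | l.val < k ∧ D.height (Sum.inl l) = l.val + 1}
  -- The left node of level `1` always has the maximal label `1`.
  have hs : s.Nonempty := by
    refine ⟨⟨0, by omega⟩, ?_⟩
    have h1 := hD.height_le_level (Sum.inl ⟨0, by omega⟩)
    have h2 := hD.one_le_height (Sum.inl ⟨0, by omega⟩)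
    simp only [level] at h1
    simp only [s, Finset.mem_filter, Finset.mem_univ, true_and]
    omega
  have hm := s.max'_mem hs
  set m := s.max' hs with hmdef
  simp only [s, Finset.mem_filter, Finset.mem_univ, true_and] at hm
  have hmt : m.val ≠ t.val := fun e => by
    have : m = t := Fin.ext e
    rw [this] at hm
    omega
  refine ⟨k, ⟨m.val, by omega⟩, ⟨habove, hm.1, hm.2, fun l hl hlk => ?_⟩, by simp only; omega, hkN⟩
  by_contra hlt
  have h1 := hD.height_le_level (Sum.inl l)
  simp only [level] at h1
  have h2 : l ≤ m := s.le_max' l (by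
    simp only [s, Finset.mem_filter, Finset.mem_univ, true_and]
    omega)
  exact absurd (lt_of_lt_of_le hl h2) (lt_irrefl _)

/-- Every diagram other than the identity is the product of an elementary diagram and a diagram
with greater labels. -/
theorem exists_factorization {D : LabelledArcs N} (hD : D.IsOkada)
    (hne : D ≠ (OkadaDiagram.id N).1) :
    ∃ (i : Fin (N - 1)) (D' : LabelledArcs N), D'.IsOkada ∧ comp (gArcs i) D' = D ∧
      (∀ k, loops (gArcs i) D' k = 0) ∧ (∀ k, yExpInt (gArcs i) D' k = 0) ∧
      ∑ a : ArcNode N, (a.level - D'.height a) < ∑ a : ArcNode N, (a.level - D.height a) := by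
  obtain ⟨k, i, htop, hik, hkN⟩ := exists_hasTop hD hne
  have hadj := htop.adj_hi hD hik
  have hlabel : D.height (lo i) = i.val + 1 := htop.height_eq
  -- The node `c` is the one to be joined to `hi i` with label `i.val + 2`: the next left node as
  -- long as its level is at most `k`, and otherwise the node opposite `hi i`.
  suffices h : ∃ c : ArcNode N, c ≠ lo i ∧ c ≠ hi i ∧ D.height c ≤ i.val + 1 ∧
      i.val + 2 ≤ c.level ∧ i.val + 1 < c.pos ∧ c.pos % 2 = i.val % 2 ∧
      ∀ s t, D.graph.Adj s t → i.val + 1 < s.pos → s.pos < c.pos →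
        i.val + 1 < t.pos ∧ t.pos < c.pos ∧ i.val + 2 < D.height s by
    obtain ⟨c, h1, h2, h3, h4, h5, h6, h7⟩ := h
    obtain ⟨p, hp, -⟩ := hD.matching c
    obtain ⟨e1, e2, e3⟩ := g_comp_unswap hD hadj hp h1 h2 h3 h4 h5 h6 h7 hlabel
    exact ⟨i, unswap D i p c, unswap_isOkada hD hadj hp h1 h2 h3 h4 h5 h6 h7, e1, e2, e3,
      sum_level_sub_unswap hD hadj hp h1 h2 h3 h4 hlabel⟩
  by_cases hk : i.val + 2 < k
  · set c : ArcNode N := Sum.inl ⟨i.val + 2, by omega⟩ with hc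
    have hpos : c.pos = i.val + 2 := rfl
    have hlev : c.level = i.val + 3 := rfl
    have h1 : c ≠ lo i := by simp [hc, lo]
    have h2 : c ≠ hi i := by simp [hc, hi]
    have h3 : D.height c ≤ i.val + 2 := htop.height_le ⟨i.val + 2, by omega⟩ (by
      rw [Fin.lt_def]
      simp only
      omega) hk
    obtain ⟨p, hp, -⟩ := hD.matching c
    obtain ⟨n1, n2, n3⟩ := unswap_distinct hD hadj hp h1 h2
    have e1 : p.pos ≠ (lo i).pos := fun e => n1 (pos_injective e)
    have e2 : p.pos ≠ (hi i).pos := fun e => n2 (pos_injective e)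
    have h4 := hD.height_le _ _ hp
    have h5 := hD.parity _ _ hp
    have h6 := hD.pos_parity hp
    have h7 := pos_level p
    rw [pos_lo] at e1
    rw [pos_hi] at e2
    rw [hlev] at h4 h5
    unfold Nat.ModEq at h5
    refine ⟨c, h1, h2, ?_, by omega, by omega, by omega, fun s t _ _ _ => by omega⟩
    -- The choice of the top gives only the bound `i.val + 2`; parity of labels and of positions
    -- rules out equality.
    rcases le_total (i.val + 3) p.level with hle | hle
    · rw [min_eq_left hle] at h5
      omega
    · omega
  · set c : ArcNode N := Sum.inr ⟨i.val + 1, by omega⟩ with hc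
    have hpos : c.pos = 2 * N - 1 - (i.val + 1) := rfl
    have hlev : c.level = i.val + 2 := rfl
    have h1 : c ≠ lo i := by simp [hc, lo]
    have h2 : c ≠ hi i := by simp [hc, hi]
    refine ⟨c, h1, h2, ?_, by omega, by omega, by omega, fun s t hst hs1 hs2 => ?_⟩
    -- A label `i.val + 2` at `c` would force a partner of level `i.val + 2 = k`, but only `hi i`
    -- and `c` have this level.
    · by_contra hlt
      obtain ⟨p, hp, -⟩ := hD.matching c
      obtain ⟨n1, n2, n3⟩ := unswap_distinct hD hadj hp h1 h2
      have h4 := hD.height_le _ _ hp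
      have h5 := fun hk => htop.above.level_eq hD hp.symm hk
      have h6 : p.level = i.val + 2 := by omega
      rcases p with p | p
      · exact n2 (by simpa [hi, level, Fin.ext_iff] using h6)
      · exact n3 (by simpa [hc, level, Fin.ext_iff] using h6)
    -- The nodes between `hi i` and its opposite are those of level above `k`, where labels are
    -- maximal and arcs join nodes of equal level.
    · have h3 := pos_level s
      have h4 := pos_level t
      have h5 := htop.above s (by omega)
      have h6 := htop.above.level_eq hD hst (by omega)
      omega

theorem okada_induction {P : LabelledArcs N → Prop} (hid : P (OkadaDiagram.id N).1)
    (hg : ∀ (i : Fin (N - 1)) (D : LabelledArcs N), D.IsOkada →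
      (∀ k, loops (gArcs i) D k = 0) → (∀ k, yExpInt (gArcs i) D k = 0) → P D →
      P (comp (gArcs i) D)) {D : LabelledArcs N} (hD : D.IsOkada) : P D := by
  induction hn : ∑ a : ArcNode N, (a.level - D.height a) using Nat.strong_induction_on
    generalizing D with
  | _ n ih =>
    by_cases hne : D = (OkadaDiagram.id N).1
    · rw [hne]
      exact hid
    · obtain ⟨i, D', hD', h1, h2, h3, h4⟩ := exists_factorization hD hne
      rw [← h1]
      exact hg i D' hD' h2 h3 (ih _ (hn ▸ h4) hD' rfl)

/-! ### The composition of diagrams -/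

theorem comp_isOkada {C D : LabelledArcs N} (hC : C.IsOkada) (hD : D.IsOkada) :
    (comp C D).IsOkada := by
  refine okada_induction (P := fun C => (comp C D).IsOkada) ?_ ?_ hC
  · rwa [id_comp hD]
  · intro i C _ _ _ ih
    rw [comp_assoc]
    exact g_comp_isOkada i ih

/-- Since the factor `g_i` was split off with exponent `0`, the cocycle identity writes the exponent
as a sum of one for a smaller left factor and one for `g_i`. Hence the truncation in `yExp` loses
nothing. -/
theorem yExpInt_nonneg {C D : LabelledArcs N} (hC : C.IsOkada) (hD : D.IsOkada) (k : ℕ) :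
    0 ≤ yExpInt C D k := by
  refine okada_induction (P := fun C => 0 ≤ yExpInt C D k) ?_ ?_ hC
  · rw [yExpInt_id hD]
  · intro i C hC _ h ih
    have h1 := yExpInt_cocycle (gArcs i) C D k
    have h2 := yExpInt_g_nonneg i (comp_isOkada hC hD) k
    rw [h] at h1
    omega

/-- By associativity the right unit law passes from a factor to the product, so it needs no
computation beyond that of the left unit law. -/
theorem comp_id {C : LabelledArcs N} (hC : C.IsOkada) : comp C (OkadaDiagram.id N).1 = C := by
  refine okada_induction (P := fun C => comp C (OkadaDiagram.id N).1 = C) ?_ ?_ hC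
  · exact id_comp (OkadaDiagram.id N).2
  · intro i C _ _ _ ih
    rw [comp_assoc, ih]

theorem loops_id_right {C : LabelledArcs N} (hC : C.IsOkada) (k : ℕ) :
    loops C (OkadaDiagram.id N).1 k = 0 := by
  refine okada_induction (P := fun C => loops C (OkadaDiagram.id N).1 k = 0) ?_ ?_ hC
  · exact loops_id (OkadaDiagram.id N).2 k
  · intro i C hC h _ ih
    have h1 := loops_cocycle (gArcs i) C (OkadaDiagram.id N).1 k
    rw [comp_id hC, h] at h1
    omega

theorem yExpInt_id_right {C : LabelledArcs N} (hC : C.IsOkada) (k : ℕ) :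
    yExpInt C (OkadaDiagram.id N).1 k = 0 := by
  refine Finset.sum_eq_zero fun j _ => ?_
  rw [comp_id hC, boxes_id, loops_id_right hC]
  simp

end LabelledArcs

/-! ### The number of diagrams -/

namespace LabelledArcs

open SimpleGraph ArcNode OkadaDiagram

variable {N : ℕ}

instance : Finite (OkadaDiagram N) := by
  classical
  let F : OkadaDiagram N → SimpleGraph (ArcNode N) × (ArcNode N → Fin (N + 1)) :=
    fun D => (D.1.graph, fun a => ⟨D.1.height a, by
      have := D.2.height_le_level a
      have := pos_level a
      omega⟩)
  refine Finite.of_injective F fun C D h => Subtype.ext (LabelledArcs.ext ?_ ?_)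
  · exact congrArg Prod.fst h
  · funext a
    exact congrArg Fin.val (congrFun (congrArg Prod.snd h) a)

/-- Arcs with equal labels are not nested, so a diagram is determined by its labels. -/
theorem eq_of_height_eq {C D : LabelledArcs N} (hC : C.IsOkada) (hD : D.IsOkada)
    (h : ∀ a, C.height a = D.height a) : C = D := by
  have key : ∀ n, ∀ a b c : ArcNode N, a.pos = n → C.graph.Adj a b → D.graph.Adj a c → b = c := by
    intro n
    induction n using Nat.strong_induction_on with
    | _ n ih =>
      intro a b c ha hab hac
      by_contra hbc
      have e1 : b.pos ≠ c.pos := fun e => hbc (pos_injective e)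
      have e2 : b.pos ≠ a.pos := fun e => hab.ne (pos_injective e).symm
      have e3 : c.pos ≠ a.pos := fun e => hac.ne (pos_injective e).symm
      have hb : a.pos < b.pos := by
        by_contra hlt
        obtain ⟨d, hd, -⟩ := hD.matching b
        rw [← ih b.pos (by omega) b a d rfl hab.symm hd] at hd
        exact hbc (hD.unique hd.symm hac)
      have hc : a.pos < c.pos := by
        by_contra hlt
        obtain ⟨d, hd, -⟩ := hC.matching c
        rw [ih c.pos (by omega) c d a rfl hd hac.symm] at hd
        exact hbc (hC.unique hab hd.symm)
      have f1 := h a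
      have f2 := h b
      have f3 := h c
      have f4 := hC.height_eq _ _ hab
      have f5 := hD.height_eq _ _ hac
      rcases lt_or_gt_of_ne e1 with hlt | hlt
      · obtain ⟨d, hd, -⟩ := hD.matching b
        have := (hD.inside hac hd hb hlt).2.2
        omega
      · obtain ⟨d, hd, -⟩ := hC.matching c
        have := (hC.inside hab hd hc hlt).2.2
        omega
  ext a b
  · constructor
    · intro hab
      obtain ⟨c, hc, -⟩ := hD.matching a
      rwa [key _ a b c rfl hab hc]
    · intro hab
      obtain ⟨c, hc, -⟩ := hC.matching a
      rwa [← key _ a c b rfl hc hab]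
  · exact h a

/-! ### Counting diagrams by the position of the top. -/

theorem HasTop.unique {D : LabelledArcs N} {k : ℕ} {j j' : Fin N} (h : HasTop D k j)
    (h' : HasTop D k j') : j = j' := by
  rcases lt_trichotomy j j' with hj | hj | hj
  · have := h.height_le j' hj h'.lt
    have := h'.height_eq
    omega
  · exact hj
  · have := h'.height_le j hj h.lt
    have := h.height_eq
    omega

/-- The node joined to `i + 1` if the greatest level with maximal label is `i + 1`. -/
def topPartner (i : Fin (N - 1)) (k : ℕ) : ArcNode N :=
  if h : i.val + 2 < k ∧ k ≤ N then Sum.inl ⟨i.val + 2, by omega⟩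
  else Sum.inr ⟨i.val + 1, by omega⟩

theorem HasTop.adj_topPartner {D : LabelledArcs N} (hD : D.IsOkada) {k : ℕ} (hk : k ≤ N)
    {i : Fin (N - 1)} (h : HasTop D k ⟨i.val + 1, by omega⟩) :
    D.graph.Adj (hi i) (topPartner i k) := by
  unfold topPartner
  split_ifs with hik
  · exact HasTop.adj_hi (i := ⟨i.val + 1, by omega⟩) hD h hik.1
  · have hlt := h.lt
    exact h.adj_inr hD (by simp only at hlt ⊢; omega)

theorem HasTop.lo_not_adj_hi {D : LabelledArcs N} (hD : D.IsOkada) {k : ℕ} {i : Fin (N - 1)}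
    (h : HasTop D k ⟨i.val + 1, by omega⟩) {p : ArcNode N} (hp : D.graph.Adj (lo i) p) :
    p ≠ hi i := by
  rintro rfl
  have h1 : D.height (hi i) = i.val + 2 := h.height_eq
  have h2 := hD.height_le _ _ hp
  have h3 := hD.height_eq _ _ hp
  rw [level_lo] at h2
  omega

/-- Multiplication by `g_i` gives both `lo i` and `hi i` the label `i.val + 1`, which is maximal
only at `lo i`, so the top moves down by one. No other label increases, and the labels above level
`k` are untouched: `p` and the partner of `hi i` have labels at most `k`. -/
theorem HasTop.g_comp {D : LabelledArcs N} (hD : D.IsOkada) {k : ℕ} (hk : k ≤ N)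
    {i : Fin (N - 1)} (h : HasTop D k ⟨i.val + 1, by omega⟩) :
    HasTop (comp (gArcs i) D) k ⟨i.val, by omega⟩ := by
  classical
  obtain ⟨p, hp, -⟩ := hD.matching (lo i)
  have hc := h.adj_topPartner hD hk
  have hne := h.lo_not_adj_hi hD hp
  set c := topPartner i k
  have hH := g_comp_height hD hp hc hne
  have h1 : D.height (hi i) = i.val + 2 := h.height_eq
  have h2 := hD.height_le_level (lo i)
  have hep := hD.height_eq _ _ hp
  have hec := hD.height_eq _ _ hc
  have hlt : i.val + 1 < k := h.lt
  rw [level_lo] at h2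
  refine ⟨fun a ha => ?_, by simp only; omega, ?_, fun l hl hlk => ?_⟩
  · have h3 := h.above a ha
    rw [hH]
    split_ifs with e1 e2
    · rcases e1 with rfl | rfl
      · rw [level_lo] at ha
        omega
      · rw [level_hi] at ha
        omega
    · rcases e2 with rfl | rfl <;> omega
    · exact h3
  · have : (comp (gArcs i) D).height (lo i) = i.val + 1 := by simp [hH]
    exact this
  · rw [Fin.lt_def] at hl
    simp only at hl
    rw [hH]
    split_ifs with e1 e2
    · omega
    · omega
    · refine h.height_le l ?_ hlk
      rw [Fin.lt_def]
      have : l.val ≠ i.val + 1 := fun e => e1 (Or.inr (by simp [hi, ← e]))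
      simp only
      omega

/-- The label at `lo i` is smaller than the maximal label at `hi i`, so it survives and is moved to
the partner of `hi i`, from which it can be recovered. -/
theorem HasTop.g_comp_height {D : LabelledArcs N} (hD : D.IsOkada) {k : ℕ} (hk : k ≤ N)
    {i : Fin (N - 1)} (h : HasTop D k ⟨i.val + 1, by omega⟩) :
    (comp (gArcs i) D).height (topPartner i k) = D.height (lo i) ∧
      ∀ a, a ≠ lo i → a ≠ hi i → a ≠ topPartner i k →
        (comp (gArcs i) D).height a = D.height a := by
  classical
  obtain ⟨p, hp, -⟩ := hD.matching (lo i)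
  have hc := h.adj_topPartner hD hk
  have hne := h.lo_not_adj_hi hD hp
  obtain ⟨n1, n2, n3, n4, n5⟩ := distinct_of_not_adj hD hp hc hne
  have hH := LabelledArcs.g_comp_height hD hp hc hne
  have h1 : D.height (hi i) = i.val + 2 := h.height_eq
  have h2 : D.height (lo i) ≤ i.val + 1 := hD.height_le_level (lo i)
  rw [h1, min_eq_left (by omega)] at hH
  refine ⟨by simp [hH, n3, n4], fun a e1 e2 e3 => ?_⟩
  by_cases e4 : a = p
  · simp [hH, e4, n1, n2, hD.height_eq _ _ hp]
  · simp [hH, e1, e2, e3, e4]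

theorem HasTop.g_comp_injective {D D' : LabelledArcs N} (hD : D.IsOkada) (hD' : D'.IsOkada)
    {k : ℕ} (hk : k ≤ N) {i : Fin (N - 1)} (h : HasTop D k ⟨i.val + 1, by omega⟩)
    (h' : HasTop D' k ⟨i.val + 1, by omega⟩)
    (heq : comp (gArcs i) D = comp (gArcs i) D') : D = D' := by
  have h1 : D.height (hi i) = i.val + 2 := h.height_eq
  have h1' : D'.height (hi i) = i.val + 2 := h'.height_eq
  obtain ⟨h2, h3⟩ := h.g_comp_height hD hk
  obtain ⟨h2', h3'⟩ := h'.g_comp_height hD' hk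
  refine eq_of_height_eq hD hD' fun a => ?_
  by_cases e1 : a = lo i
  · rw [e1, ← h2, ← h2', heq]
  by_cases e2 : a = hi i
  · rw [e2, h1, h1']
  by_cases e3 : a = topPartner i k
  · rw [e3, ← hD.height_eq _ _ (h.adj_topPartner hD hk),
      ← hD'.height_eq _ _ (h'.adj_topPartner hD' hk), h1, h1']
  rw [← h3 a e1 e2 e3, ← h3' a e1 e2 e3, heq]

/-- If all labels above level `k` are maximal, then the top for `k + 1` is the left node of level `k
+ 1`. Successive elementary diagrams push it down to `j`, injectively at every stage. -/
theorem card_maximalAbove_le_card_hasTop {k : ℕ} (hk : k < N) (j : Fin N) (hj : j.val ≤ k) :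
    {D : OkadaDiagram N | MaximalAbove D.1 k}.ncard ≤
      {D : OkadaDiagram N | HasTop D.1 (k + 1) j}.ncard := by
  obtain ⟨n, hn⟩ : ∃ n, k - j.val = n := ⟨_, rfl⟩
  induction n generalizing j with
  | zero =>
    refine Set.ncard_le_ncard (fun D hD => ⟨fun a ha => hD a (by omega), by omega, ?_, ?_⟩)
      (Set.toFinite _)
    · exact hD (Sum.inl j) (by simp only [level]; omega)
    · intro l hl hlk
      rw [Fin.lt_def] at hl
      omega
  | succ n ih =>
    refine (ih ⟨j.val + 1, by omega⟩ (by simp only; omega) (by simp only; omega)).trans ?_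
    let i : Fin (N - 1) := ⟨j.val, by omega⟩
    refine Set.ncard_le_ncard_of_injOn (fun D => ⟨comp (gArcs i) D.1, g_comp_isOkada i D.2⟩)
      (fun D hD => ?_) (fun D hD D' hD' heq => ?_) (Set.toFinite _)
    · exact HasTop.g_comp (i := i) D.2 (by omega) hD
    · exact Subtype.ext (HasTop.g_comp_injective (i := i) D.2 D'.2 (by omega) hD hD'
        (congrArg Subtype.val heq))

/-- The top is unique, so its `k + 1` possible positions define disjoint classes, each with at least
`k!` diagrams. -/
theorem factorial_le_card_maximalAbove {k : ℕ} (hk : k ≤ N) :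
    k.factorial ≤ {D : OkadaDiagram N | MaximalAbove D.1 k}.ncard := by
  classical
  have := Fintype.ofFinite (OkadaDiagram N)
  induction k with
  | zero =>
    exact (Set.ncard_pos (Set.toFinite _)).2 ⟨OkadaDiagram.id N, fun a _ => rfl⟩
  | succ k ih =>
    let s : Fin (k + 1) → Finset (OkadaDiagram N) :=
      fun j => {D | HasTop D.1 (k + 1) (Fin.castLE hk j)}
    have hs : ∀ j, {D : OkadaDiagram N | HasTop D.1 (k + 1) (Fin.castLE hk j)}.ncard =
        (s j).card := fun j => by
      rw [← Set.ncard_coe_finset]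
      congr 1
      ext D
      simp [s]
    have hdisj : ∀ i ∈ Finset.univ, ∀ j ∈ Finset.univ, i ≠ j → Disjoint (s i) (s j) := by
      intro i _ j _ hij
      rw [Finset.disjoint_left]
      intro D hi hj
      simp only [s, Finset.mem_filter, Finset.mem_univ, true_and] at hi hj
      exact hij (Fin.castLE_injective hk (hi.unique hj))
    have hsum : (k + 1) * k.factorial ≤ ∑ j, (s j).card := by
      have h := Finset.card_nsmul_le_sum Finset.univ (fun j => (s j).card) k.factorial fun j _ => by
        rw [← hs]
        exact (ih (by omega)).trans
          (card_maximalAbove_le_card_hasTop (by omega) _ (by simp only [Fin.val_castLE]; omega))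
      simpa using h
    rw [Nat.factorial_succ]
    refine hsum.trans ?_
    rw [← Finset.card_biUnion hdisj, ← Set.ncard_coe_finset]
    refine Set.ncard_le_ncard (fun D hD => ?_) (Set.toFinite _)
    simp only [Finset.coe_biUnion, Finset.coe_univ, Set.mem_univ, Set.iUnion_true, Set.mem_iUnion,
      Finset.mem_coe, s, Finset.mem_filter, Finset.mem_univ, true_and] at hD
    obtain ⟨j, hj⟩ := hD
    exact hj.above

theorem factorial_le_card : N.factorial ≤ Nat.card (OkadaDiagram N) := by
  rw [← Set.ncard_univ]
  exact (factorial_le_card_maximalAbove le_rfl).trans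
    (Set.ncard_le_ncard (Set.subset_univ _) (Set.toFinite _))

end LabelledArcs

/-! ### Spanning words of the Okada algebra -/

namespace OkadaWords

open Submodule

variable {K A : Type*} [Field K] [Ring A] [Algebra K A]

/-- The product `E (n - 1) * E (n - 2) * ⋯ * E (n - d)`. -/
def descend (E : ℕ → A) (n : ℕ) : ℕ → A
  | 0 => 1
  | d + 1 => descend E n d * E (n - (d + 1))

/-- The products of descending words. -/
def words (E : ℕ → A) : ℕ → Set A
  | 0 => {1}
  | n + 1 => Set.image2 (fun w (d : Fin (n + 1)) => w * descend E n d) (words E n) Set.univ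

theorem finite_words (E : ℕ → A) (n : ℕ) : (words E n).Finite := by
  induction n with
  | zero => exact Set.finite_singleton 1
  | succ n ih => exact ih.image2 _ Set.finite_univ

theorem ncard_words_le (E : ℕ → A) (n : ℕ) : (words E n).ncard ≤ n.factorial := by
  induction n with
  | zero => simp [words]
  | succ n ih =>
    have h : words E (n + 1) =
        (fun p : A × Fin (n + 1) => p.1 * descend E n p.2) '' (words E n ×ˢ Set.univ) := by
      exact (Set.image_prod (fun w (d : Fin (n + 1)) => w * descend E n d)).symm
    rw [h, Nat.factorial_succ, mul_comm]
    refine (Set.ncard_image_le ((finite_words E n).prod Set.finite_univ)).trans ?_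
    rw [Set.ncard_prod, Set.ncard_univ, Nat.card_eq_fintype_card, Fintype.card_fin]
    exact Nat.mul_le_mul_right _ ih

theorem one_mem_words (E : ℕ → A) (n : ℕ) : (1 : A) ∈ words E n := by
  induction n with
  | zero => exact rfl
  | succ n ih => exact ⟨1, ih, 0, Set.mem_univ _, by simp [descend]⟩

variable {E : ℕ → A}

theorem descend_add (E : ℕ → A) (n d e : ℕ) :
    descend E n (d + e) = descend E n d * descend E (n - d) e := by
  induction e with
  | zero => simp [descend]
  | succ e ih =>
    rw [← add_assoc, descend, ih, descend, mul_assoc, Nat.sub_sub, add_assoc]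

theorem descend_mul_comm (hcomm : ∀ i j, i + 2 ≤ j → E i * E j = E j * E i) {n d i : ℕ}
    (hd : d ≤ n) (hi : i + d + 2 ≤ n) : descend E n d * E i = E i * descend E n d := by
  induction d with
  | zero => simp [descend]
  | succ d ih =>
    rw [descend, mul_assoc, ← hcomm i _ (by omega), ← mul_assoc, ih (by omega) (by omega),
      mul_assoc]

theorem mul_descend_comm (hcomm : ∀ i j, i + 2 ≤ j → E i * E j = E j * E i) {n d i : ℕ}
    (hi : n + 1 ≤ i) (hd : d ≤ n) : descend E n d * E i = E i * descend E n d := by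
  induction d with
  | zero => simp [descend]
  | succ d ih =>
    rw [descend, mul_assoc, hcomm _ i (by omega), ← mul_assoc, ih (by omega), mul_assoc]

theorem descend_comm_descend (hcomm : ∀ i j, i + 2 ≤ j → E i * E j = E j * E i) {n d m e : ℕ}
    (hd : d ≤ n) (he : e ≤ m) (h : m + d + 1 ≤ n) :
    descend E n d * descend E m e = descend E m e * descend E n d := by
  induction e with
  | zero => simp [descend]
  | succ e ih =>
    rw [descend, ← mul_assoc, ih (by omega), mul_assoc,
      descend_mul_comm hcomm hd (by omega), mul_assoc]

theorem mul_descend_mem {n m e : ℕ} {z : A} (hz : z ∈ span K (words E n)) (he : e ≤ m)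
    (hm : m + 1 ≤ n)
    (ih : ∀ i, i + 1 < n → ∀ w ∈ span K (words E n), w * E i ∈ span K (words E n)) :
    z * descend E m e ∈ span K (words E n) := by
  induction e with
  | zero => simpa [descend] using hz
  | succ e ihe =>
    rw [descend, ← mul_assoc]
    exact ih _ (by omega) _ (ihe (by omega))

theorem mul_descend_mem_succ {n d : ℕ} (hd : d ≤ n) {z : A} (hz : z ∈ span K (words E n)) :
    z * descend E n d ∈ span K (words E (n + 1)) := by
  induction hz using span_induction with
  | mem w hw => exact subset_span ⟨w, hw, ⟨d, by omega⟩, Set.mem_univ _, rfl⟩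
  | zero => simp
  | add u v _ _ hu hv => rw [add_mul]; exact add_mem hu hv
  | smul r u _ hu => rw [smul_mul_assoc]; exact smul_mem _ r hu

/-- A letter `E i` to the right of `w * descend E n d` either commutes past the descending word into
`w`, or lengthens it by one letter, or already occurs in it. In the last case it is absorbed by the
square relation if it is the last letter, and by the shift relation otherwise. -/
theorem mul_mem_span_words {x y : ℕ → K} (hsq : ∀ i, E i * E i = x i • E i)
    (hcomm : ∀ i j, i + 2 ≤ j → E i * E j = E j * E i)
    (hshift : ∀ i, E (i + 1) * E i * E (i + 1) = y i • E (i + 1)) (n : ℕ) :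
    ∀ i, i + 1 < n → ∀ w ∈ span K (words E n), w * E i ∈ span K (words E n) := by
  induction n with
  | zero => intro i hi; omega
  | succ n ih =>
    intro i hi w hw
    induction hw using span_induction with
    | zero => simp
    | add u v _ _ hu hv => rw [add_mul]; exact add_mem hu hv
    | smul r u _ hu => rw [smul_mul_assoc]; exact smul_mem _ r hu
    | mem w hw =>
      obtain ⟨w, hw, ⟨d, hd⟩, -, rfl⟩ := hw
      have hw' : w ∈ span K (words E n) := subset_span hw
      simp only
      rw [mul_assoc]
      rcases lt_trichotomy (i + d + 1) n with h | h | h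
      · rw [descend_mul_comm hcomm (by omega) (by omega), ← mul_assoc]
        exact mul_descend_mem_succ (by omega) (ih i (by omega) w hw')
      · have : descend E n d * E i = descend E n (d + 1) := by
          rw [descend, show n - (d + 1) = i by omega]
        rw [this]
        exact mul_descend_mem_succ (by omega) hw'
      · obtain ⟨e, rfl⟩ : ∃ e, d = (n - i) + e := ⟨d - (n - i), by omega⟩
        have hin : descend E n (n - i) = descend E n (n - i - 1) * E i := by
          obtain ⟨f, hf⟩ : ∃ f, n - i = f + 1 := ⟨n - i - 1, by omega⟩
          rw [hf, descend, Nat.add_sub_cancel, show n - (f + 1) = i by omega]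
        rcases e with _ | e
        · rw [add_zero, hin, mul_assoc (descend E n (n - i - 1)), hsq, mul_smul_comm, ← hin,
            mul_smul_comm]
          exact smul_mem _ _ (mul_descend_mem_succ (by omega) hw')
        · obtain ⟨i, rfl⟩ : ∃ m, i = m + 1 := ⟨i - 1, by omega⟩
          -- The new letter commutes back to the adjacent `E i`, and the shift relation removes
          -- both. The tail below `E i` then commutes with all remaining letters and moves left into
          -- `w`, where the induction hypothesis absorbs it.
          have key : descend E n (n - (i + 1) + (e + 1)) * E (i + 1) =
              y i • (descend E i e * descend E n (n - (i + 1))) := by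
            have h1 : n - (n - (i + 1)) = i + 1 := by omega
            have h2 : descend E (i + 1) (e + 1) = E i * descend E i e := by
              rw [add_comm e 1, descend_add]
              simp [descend]
            rw [descend_add, h1, h2, mul_assoc, mul_assoc, mul_descend_comm hcomm le_rfl (by omega),
              hin, ← mul_assoc, ← mul_assoc, ← mul_assoc,
              mul_assoc (descend E n (n - (i + 1) - 1) * E (i + 1)), mul_assoc (descend E n _),
              ← mul_assoc (E (i + 1)), hshift, mul_smul_comm, smul_mul_assoc, ← hin,
              descend_comm_descend hcomm (by omega) (by omega) (by omega), hin, mul_assoc]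
          rw [key, mul_smul_comm, ← mul_assoc]
          exact smul_mem _ _ (mul_descend_mem_succ (by omega)
            (mul_descend_mem hw' (by omega) (by omega) ih))

end OkadaWords

/-! ### The structure constants -/

namespace LabelledArcs

open SimpleGraph ArcNode OkadaDiagram

variable {N : ℕ} {K : Type*} [Field K] (X : Fin (N - 1) → K) (Y : Fin (N - 2) → K)

theorem yExp_cocycle {C D E : LabelledArcs N} (hC : C.IsOkada) (hD : D.IsOkada) (hE : E.IsOkada)
    (i : ℕ) : yExp C D i + yExp (comp C D) E i = yExp D E i + yExp C (comp D E) i := by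
  have h := yExpInt_cocycle C D E i
  have h1 := yExpInt_nonneg hC hD i
  have h2 := yExpInt_nonneg (comp_isOkada hC hD) hE i
  have h3 := yExpInt_nonneg hD hE i
  have h4 := yExpInt_nonneg hC (comp_isOkada hD hE) i
  change (yExpInt C D i).toNat + (yExpInt (comp C D) E i).toNat =
    (yExpInt D E i).toNat + (yExpInt C (comp D E) i).toNat
  omega

theorem weight_cocycle {C D E : LabelledArcs N} (hC : C.IsOkada) (hD : D.IsOkada)
    (hE : E.IsOkada) : weight X Y C D * weight X Y (comp C D) E =
      weight X Y D E * weight X Y C (comp D E) := by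
  unfold weight
  rw [mul_mul_mul_comm, mul_mul_mul_comm (∏ k, X k ^ loops D E (k.val + 1)),
    ← Finset.prod_mul_distrib, ← Finset.prod_mul_distrib, ← Finset.prod_mul_distrib,
    ← Finset.prod_mul_distrib]
  simp only [← pow_add, loops_cocycle, yExp_cocycle hC hD hE]

theorem weight_eq_one {C D : LabelledArcs N} (hl : ∀ k, loops C D k = 0)
    (hy : ∀ k, yExpInt C D k = 0) : weight X Y C D = 1 := by
  have hy' : ∀ k, yExp C D k = 0 := fun k => congrArg Int.toNat (hy k)
  simp [weight, hl, hy']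

/-! ### The relations between the elementary diagrams. -/

theorem gArcs_isOkada (i : Fin (N - 1)) : (gArcs i).IsOkada := (g i).2

theorem weight_g_g (i : Fin (N - 1)) : weight X Y (gArcs i) (gArcs i) = X i := by
  have h := gArcs_adj_lo_hi i
  have hl := loops_g_of_loop (gArcs_isOkada i) h
  have hy := yExpInt_g_of_loop (gArcs_isOkada i) h
  simp only [gArcs_height_lo] at hl hy
  have hy' : ∀ k, yExp (gArcs i) (gArcs i) k = 0 := fun k =>
    congrArg Int.toNat ((hy k).trans (if_neg (by omega)))
  simp [weight, hl, hy', Fin.val_inj, Finset.prod_ite_eq', pow_ite]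

/-- Labels determine a diagram (`eq_of_height_eq`), so this relation, like those below, is checked
on labels only. -/
theorem g_comp_g (i : Fin (N - 1)) : comp (gArcs i) (gArcs i) = gArcs i := by
  refine eq_of_height_eq (comp_isOkada (gArcs_isOkada i) (gArcs_isOkada i)) (gArcs_isOkada i)
    fun a => ?_
  rw [g_comp_height_of_loop (gArcs_isOkada i) (gArcs_adj_lo_hi i)]
  split_ifs with h
  · rcases h with rfl | rfl
    · exact (gArcs_height_lo i).symm
    · exact (gArcs_height_hi i).symm
  · rfl

theorem gArcs_height_eq (i : Fin (N - 1)) (a : ArcNode N) :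
    (gArcs i).height a = if a.level = i.val + 2 then i.val + 1 else a.level := rfl

theorem eq_lo_iff (i : Fin (N - 1)) (x : Fin N) :
    (Sum.inl x : ArcNode N) = lo i ↔ x.val = i.val := by
  simp [lo, Fin.ext_iff]

theorem eq_hi_iff (i : Fin (N - 1)) (x : Fin N) :
    (Sum.inl x : ArcNode N) = hi i ↔ x.val = i.val + 1 := by
  simp [hi, Fin.ext_iff]

theorem gArcs_adj_lo_of_far {i j : Fin (N - 1)} (h : i.val + 2 ≤ j.val ∨ j.val + 2 ≤ i.val) :
    (gArcs j).graph.Adj (lo i) (Sum.inr ⟨i.val, by omega⟩) :=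
  gArcs_adj_through j (by rw [Ne, eq_lo_iff]; simp only; omega)
    (by rw [Ne, eq_hi_iff]; simp only; omega)

theorem gArcs_adj_hi_of_far {i j : Fin (N - 1)} (h : i.val + 2 ≤ j.val ∨ j.val + 2 ≤ i.val) :
    (gArcs j).graph.Adj (hi i) (Sum.inr ⟨i.val + 1, by omega⟩) :=
  gArcs_adj_through j (by rw [Ne, eq_lo_iff]; simp only; omega)
    (by rw [Ne, eq_hi_iff]; simp only; omega)

theorem weight_g_of_far {i j : Fin (N - 1)} (h : i.val + 2 ≤ j.val ∨ j.val + 2 ≤ i.val) :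
    weight X Y (gArcs i) (gArcs j) = 1 := by
  have hp := gArcs_adj_lo_of_far h
  have hc := gArcs_adj_hi_of_far h
  refine weight_eq_one X Y (loops_g (gArcs_isOkada j) hp hc (by simp [hi])) fun k => ?_
  have hy := yExpInt_g_of_swap (gArcs_isOkada j) hp hc (by simp [hi]) k
  refine hy.trans (if_neg ?_)
  have h1 : (gArcs j).height (lo i) = i.val + 1 := by
    rw [gArcs_height_eq, level_lo, if_neg (by omega)]
  have h2 : (gArcs j).height (hi i) = i.val + 2 := by
    rw [gArcs_height_eq, level_hi, if_neg (by omega)]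
  rw [h1, h2]
  omega

theorem g_comp_height_of_far {i j : Fin (N - 1)} (h : i.val + 2 ≤ j.val ∨ j.val + 2 ≤ i.val)
    (a : ArcNode N) : (comp (gArcs i) (gArcs j)).height a =
      if a.level = i.val + 2 then i.val + 1 else if a.level = j.val + 2 then j.val + 1
      else a.level := by
  have hp := gArcs_adj_lo_of_far h
  have hc := gArcs_adj_hi_of_far h
  have hH := g_comp_height (gArcs_isOkada j) hp hc (by simp [hi]) a
  refine hH.trans ?_
  have h1 : (gArcs j).height (lo i) = i.val + 1 := by
    rw [gArcs_height_eq, level_lo, if_neg (by omega)]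
  have h2 : (gArcs j).height (hi i) = i.val + 2 := by
    rw [gArcs_height_eq, level_hi, if_neg (by omega)]
  rcases a with a | a
  · have hl : level (Sum.inl a) = a.val + 1 := rfl
    by_cases e : a.val = i.val ∨ a.val = i.val + 1
    · rw [if_pos (by rwa [eq_lo_iff, eq_hi_iff])]
      split_ifs <;> omega
    · rw [if_neg (by rwa [eq_lo_iff, eq_hi_iff]), if_neg (by simp), gArcs_height_eq]
      split_ifs <;> omega
  · have hl : level (Sum.inr a) = a.val + 1 := rfl
    rw [if_neg (by simp [lo, hi])]
    by_cases e : a.val = i.val ∨ a.val = i.val + 1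
    · rw [if_pos (by simpa [Fin.ext_iff] using e), h1, h2]
      split_ifs <;> omega
    · rw [if_neg (by simpa [Fin.ext_iff] using e), gArcs_height_eq]
      split_ifs <;> omega

theorem g_comp_comm {i j : Fin (N - 1)} (h : i.val + 2 ≤ j.val ∨ j.val + 2 ≤ i.val) :
    comp (gArcs i) (gArcs j) = comp (gArcs j) (gArcs i) := by
  refine eq_of_height_eq (comp_isOkada (gArcs_isOkada i) (gArcs_isOkada j))
    (comp_isOkada (gArcs_isOkada j) (gArcs_isOkada i)) fun a => ?_
  rw [g_comp_height_of_far h, g_comp_height_of_far h.symm]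
  split_ifs <;> omega

theorem hi_eq_lo {i j : Fin (N - 1)} (h : j.val = i.val + 1) : hi i = lo j := by
  simp [hi, lo, h]

theorem gArcs_adj_lo_of_succ {i j : Fin (N - 1)} (h : j.val = i.val + 1) :
    (gArcs j).graph.Adj (lo i) (Sum.inr ⟨i.val, by omega⟩) :=
  gArcs_adj_through j (by rw [Ne, eq_lo_iff]; simp only; omega)
    (by rw [Ne, eq_hi_iff]; simp only; omega)

theorem gArcs_adj_hi_of_succ {i j : Fin (N - 1)} (h : j.val = i.val + 1) :
    (gArcs j).graph.Adj (hi i) (hi j) := by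
  rw [hi_eq_lo h]
  exact gArcs_adj_lo_hi j

theorem gArcs_height_lo_of_succ {i j : Fin (N - 1)} (h : j.val = i.val + 1) :
    (gArcs j).height (lo i) = i.val + 1 := by
  rw [gArcs_height_eq, level_lo, if_neg (by omega)]

theorem gArcs_height_hi_of_succ {i j : Fin (N - 1)} (h : j.val = i.val + 1) :
    (gArcs j).height (hi i) = i.val + 2 := by
  rw [gArcs_height_eq, level_hi, if_neg (by omega)]

theorem weight_g_of_succ {i j : Fin (N - 1)} (h : j.val = i.val + 1) :
    weight X Y (gArcs i) (gArcs j) = 1 := by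
  have hp := gArcs_adj_lo_of_succ h
  have hc := gArcs_adj_hi_of_succ h
  refine weight_eq_one X Y (loops_g (gArcs_isOkada j) hp hc (by simp [hi])) fun k => ?_
  have hy := yExpInt_g_of_swap (gArcs_isOkada j) hp hc (by simp [hi]) k
  refine hy.trans (if_neg ?_)
  simp only [gArcs_height_lo_of_succ h, gArcs_height_hi_of_succ h]
  omega

theorem g_comp_succ_adj {i j : Fin (N - 1)} (h : j.val = i.val + 1) :
    (comp (gArcs i) (gArcs j)).graph.Adj (lo j) (lo i) ∧
      (comp (gArcs i) (gArcs j)).graph.Adj (hi j) (Sum.inr ⟨i.val, by omega⟩) := by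
  have hp := gArcs_adj_lo_of_succ h
  have hc := gArcs_adj_hi_of_succ h
  have hA : ∀ a b, (comp (gArcs i) (gArcs j)).graph.Adj a b ↔ _ :=
    fun a b => g_comp_adj (gArcs_isOkada j) hp hc (by simp [hi]) (a := a) (b := b)
  rw [hA, hA, ← hi_eq_lo h]
  exact ⟨Or.inr (Or.inl ⟨rfl, rfl⟩), Or.inr (Or.inr (Or.inr (Or.inl ⟨rfl, rfl⟩)))⟩

theorem g_comp_succ_height {i j : Fin (N - 1)} (h : j.val = i.val + 1) (a : ArcNode N) :
    (comp (gArcs i) (gArcs j)).height a =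
      if a = lo i ∨ a = lo j ∨ a = hi j then i.val + 1 else (gArcs j).height a := by
  classical
  have hp := gArcs_adj_lo_of_succ h
  have hc := gArcs_adj_hi_of_succ h
  have hH := g_comp_height (gArcs_isOkada j) hp hc (by simp [hi]) a
  simp only [gArcs_height_lo_of_succ h, gArcs_height_hi_of_succ h] at hH
  rw [min_eq_left (by omega), hi_eq_lo h] at hH
  rw [hH]
  have key : (gArcs j).height (Sum.inr ⟨i.val, by omega⟩) = i.val + 1 := by
    rw [gArcs_height_eq, if_neg]
    · rfl
    · simp only [level]
      omega
  by_cases e1 : a = lo i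
  · simp [e1]
  by_cases e2 : a = lo j
  · simp [e2]
  by_cases e3 : a = hi j
  · simp [e3]
  by_cases e4 : a = Sum.inr ⟨i.val, by omega⟩
  · rw [if_neg (by simp [e1, e2]), if_pos (Or.inl e4), if_neg (by simp [e1, e2, e3]), e4, key]
  · rw [if_neg (by simp [e1, e2]), if_neg (by simp [e3, e4]), if_neg (by simp [e1, e2, e3])]

theorem g_comp_g_comp_g {i j : Fin (N - 1)} (h : j.val = i.val + 1) :
    comp (gArcs j) (comp (gArcs i) (gArcs j)) = gArcs j := by
  classical
  have hR := comp_isOkada (gArcs_isOkada i) (gArcs_isOkada j)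
  obtain ⟨hp, hc⟩ := g_comp_succ_adj h
  have hne : lo i ≠ hi j := by
    simp only [lo, Ne, eq_hi_iff]
    omega
  have hH := g_comp_height hR hp hc hne
  refine eq_of_height_eq (comp_isOkada (gArcs_isOkada j) hR) (gArcs_isOkada j)
    fun a => (hH a).trans ?_
  simp only [g_comp_succ_height h, true_or, or_true, if_true, min_self]
  by_cases e1 : a = lo j
  · rw [if_pos (Or.inl e1), e1, gArcs_height_lo]
  by_cases e2 : a = hi j
  · rw [if_pos (Or.inr e2), e2, gArcs_height_hi]
  rw [if_neg (by simp [e1, e2])]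
  by_cases e3 : a = lo i
  · rw [if_pos (Or.inl e3), e3, gArcs_height_lo_of_succ h]
  by_cases e4 : a = Sum.inr ⟨i.val, by omega⟩
  · rw [if_pos (Or.inr e4), e4, gArcs_height_eq, if_neg]
    · rfl
    · simp only [level]
      omega
  rw [if_neg (by simp [e3, e4]), if_neg (by simp [e1, e2, e3])]

/-- In `comp (gArcs i) (gArcs j)` the arcs at `lo j` and `hi j` both have label `i.val + 1 = j.val`,
so boxes are lost in the two rows `j.val` and `j.val + 1`. This is one shift move, with weight `Y
m`. -/
theorem weight_g_comp_g {i j : Fin (N - 1)} (h : j.val = i.val + 1) (m : Fin (N - 2))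
    (hm : i.val = m.val) : weight X Y (gArcs j) (comp (gArcs i) (gArcs j)) = Y m := by
  have hR := comp_isOkada (gArcs_isOkada i) (gArcs_isOkada j)
  obtain ⟨hp, hc⟩ := g_comp_succ_adj h
  have hne : lo i ≠ hi j := by
    simp only [lo, Ne, eq_hi_iff]
    omega
  have hl : ∀ k, loops (gArcs j) (comp (gArcs i) (gArcs j)) k = 0 := loops_g hR hp hc hne
  have hy : ∀ k : Fin (N - 2), yExp (gArcs j) (comp (gArcs i) (gArcs j)) (k.val + 1) =
      if k = m then 1 else 0 := by
    intro k
    have hy : yExpInt (gArcs j) (comp (gArcs i) (gArcs j)) (k.val + 1) = _ :=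
      yExpInt_g_of_swap hR hp hc hne _
    simp only [g_comp_succ_height h, true_or, or_true, if_true, max_self] at hy
    change (yExpInt _ _ _).toNat = _
    rw [hy]
    by_cases hk : k = m
    · rw [if_pos hk, if_pos (by omega)]
      rfl
    · have : k.val ≠ m.val := fun e => hk (Fin.ext e)
      rw [if_neg hk, if_neg (by omega)]
      rfl
  simp [weight, hl, hy, pow_ite, Finset.prod_ite_eq']

end LabelledArcs

/-! ### The diagram algebra is associative and unital -/

namespace OkArc

open LabelledArcs OkadaDiagram

variable {K : Type*} [Field K] {N : ℕ} (X : Fin (N - 1) → K) (Y : Fin (N - 2) → K)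

theorem diagram_mul_diagram (C D : OkadaDiagram N) :
    diagram X Y C * diagram X Y D =
      weight X Y C.1 D.1 • diagram X Y ⟨comp C.1 D.1, comp_isOkada C.2 D.2⟩ := by
  have h₁ : mulHom X Y (diagram X Y C) = Finsupp.linearCombination K (mulDiagram X Y C) :=
    (Finsupp.linearCombination_single K 1 C).trans (one_smul K _)
  have h₂ : mulHom X Y (diagram X Y C) (diagram X Y D) = mulDiagram X Y C D :=
    (LinearMap.congr_fun h₁ _).trans
      ((Finsupp.linearCombination_single K 1 D).trans (one_smul K _))
  exact h₂.trans (dif_pos (comp_isOkada C.2 D.2))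

variable {X Y}

theorem induction_on {p : OkArc N X Y → Prop} (a : OkArc N X Y) (zero : p 0)
    (add : ∀ a b, p a → p b → p (a + b)) (smul : ∀ (r : K) D, p (r • diagram X Y D)) : p a := by
  refine Finsupp.induction_linear (motive := p) a zero (fun a b => add a b) fun D r => ?_
  have h := smul r D
  have e : r • diagram X Y D = Finsupp.single D r := by
    refine (Finsupp.smul_single (M := K) r D 1).trans ?_
    rw [smul_eq_mul, mul_one]
  rwa [e] at h

/-- By trilinearity it suffices to take diagrams, for which `comp_assoc` compares the diagrams and
`weight_cocycle` the scalars. -/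
theorem mul_assoc' (a b c : OkArc N X Y) : a * b * c = a * (b * c) := by
  refine induction_on (p := fun a => a * b * c = a * (b * c)) a ?_ ?_ fun r C => ?_
  · simp only [zero_mul]
  · intro a a' h h'
    simp only [add_mul, h, h']
  refine induction_on (p := fun b => r • diagram X Y C * b * c = r • diagram X Y C * (b * c)) b
    ?_ ?_ fun s D => ?_
  · simp only [zero_mul, mul_zero]
  · intro a a' h h'
    simp only [add_mul, mul_add, h, h']
  refine induction_on (p := fun c => r • diagram X Y C * (s • diagram X Y D) * c =
    r • diagram X Y C * (s • diagram X Y D * c)) c ?_ ?_ fun t E => ?_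
  · simp only [mul_zero]
  · intro a a' h h'
    simp only [mul_add, h, h']
  simp only [smul_mul_assoc, mul_smul_comm, diagram_mul_diagram, smul_smul]
  have e : (⟨comp (comp C.1 D.1) E.1, comp_isOkada (comp_isOkada C.2 D.2) E.2⟩ : OkadaDiagram N) =
      ⟨comp C.1 (comp D.1 E.1), comp_isOkada C.2 (comp_isOkada D.2 E.2)⟩ :=
    Subtype.ext (comp_assoc _ _ _)
  have w := weight_cocycle X Y C.2 D.2 E.2
  rw [e]
  congr 1
  linear_combination r * s * t * w

theorem one_mul' (a : OkArc N X Y) : 1 * a = a := by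
  refine induction_on (p := fun a => 1 * a = a) a (mul_zero _) ?_ fun r D => ?_
  · intro a b h h'
    rw [mul_add, h, h']
  rw [mul_smul_comm]
  change r • (diagram X Y (OkadaDiagram.id N) * diagram X Y D) = _
  rw [diagram_mul_diagram, weight_eq_one X Y (loops_id D.2) (yExpInt_id D.2), one_smul]
  congr 2
  exact Subtype.ext (id_comp D.2)

theorem mul_one' (a : OkArc N X Y) : a * 1 = a := by
  refine induction_on (p := fun a => a * 1 = a) a (zero_mul _) ?_ fun r D => ?_
  · intro a b h h'
    rw [add_mul, h, h']
  rw [smul_mul_assoc]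
  change r • (diagram X Y D * diagram X Y (OkadaDiagram.id N)) = _
  rw [diagram_mul_diagram, weight_eq_one X Y (loops_id_right D.2) (yExpInt_id_right D.2), one_smul]
  congr 2
  exact Subtype.ext (comp_id D.2)

variable (X Y)

/-- The ring structure on `OkArc_N(X, Y)`. -/
noncomputable abbrev ring : Ring (OkArc N X Y) where
  __ := (inferInstance : NonUnitalNonAssocRing (OkArc N X Y))
  __ := (inferInstance : One (OkArc N X Y))
  mul_assoc := mul_assoc'
  one_mul := one_mul'
  mul_one := mul_one'

/-- The algebra structure on `OkArc_N(X, Y)`. -/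
noncomputable abbrev algebra : @Algebra K (OkArc N X Y) _ (ring X Y).toSemiring :=
  letI := ring X Y
  Algebra.ofModule (fun r a b => smul_mul_assoc r a b) fun r a b => mul_smul_comm r a b

theorem diagram_g_mul_self (i : Fin (N - 1)) :
    diagram X Y (g i) * diagram X Y (g i) = X i • diagram X Y (g i) := by
  rw [diagram_mul_diagram]
  congr 1
  · exact weight_g_g X Y i
  · congr 1
    exact Subtype.ext (g_comp_g i)

theorem diagram_g_comm {i j : Fin (N - 1)} (h : i.val + 2 ≤ j.val ∨ j.val + 2 ≤ i.val) :
    diagram X Y (g i) * diagram X Y (g j) = diagram X Y (g j) * diagram X Y (g i) := by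
  rw [diagram_mul_diagram, diagram_mul_diagram]
  congr 1
  · exact (weight_g_of_far X Y h).trans (weight_g_of_far X Y h.symm).symm
  · congr 1
    exact Subtype.ext (g_comp_comm h)

theorem diagram_g_shift {i j : Fin (N - 1)} (h : j.val = i.val + 1) (m : Fin (N - 2))
    (hm : i.val = m.val) :
    diagram X Y (g j) * diagram X Y (g i) * diagram X Y (g j) = Y m • diagram X Y (g j) := by
  rw [mul_assoc', diagram_mul_diagram X Y (g i), mul_smul_comm, diagram_mul_diagram, smul_smul]
  congr 1
  · have h1 : weight X Y (g i).1 (g j).1 = 1 := weight_g_of_succ X Y h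
    rw [h1, one_mul]
    exact weight_g_comp_g X Y h m hm
  · congr 1
    exact Subtype.ext (g_comp_g_comp_g h)

theorem diagram_induction {p : OkArc N X Y → Prop} (one : p 1)
    (mul : ∀ i a, p a → p (diagram X Y (g i) * a)) (D : OkadaDiagram N) : p (diagram X Y D) := by
  refine okada_induction (P := fun D => ∀ hD : D.IsOkada, p (diagram X Y ⟨D, hD⟩))
    (fun _ => one) (fun i D hD hl hy ih hD' => ?_) D.2 D.2
  have h := mul i _ (ih hD)
  rwa [diagram_mul_diagram, show weight X Y (g i).1 D = 1 from weight_eq_one X Y hl hy,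
    one_smul] at h

theorem finrank_eq_card : Module.finrank K (OkArc N X Y) = Nat.card (OkadaDiagram N) := by
  classical
  have := Fintype.ofFinite (OkadaDiagram N)
  rw [Nat.card_eq_fintype_card]
  exact Module.finrank_finsupp_self K

theorem finite : Module.Finite K (OkArc N X Y) :=
  inferInstanceAs (Module.Finite K (OkadaDiagram N →₀ K))

theorem adjoin_eq_top : NonUnitalAlgebra.adjoin K
    (insert 1 (Set.range fun i => diagram X Y (g i))) = ⊤ := by
  rw [eq_top_iff]
  rintro a -
  refine induction_on a (zero_mem _) (fun a b => add_mem) fun r D => SMulMemClass.smul_mem r ?_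
  refine diagram_induction X Y (p := (· ∈ NonUnitalAlgebra.adjoin K _)) ?_ (fun i a ha => ?_) D
  · exact NonUnitalAlgebra.subset_adjoin K (Set.mem_insert _ _)
  · exact mul_mem (NonUnitalAlgebra.subset_adjoin K (Set.mem_insert_of_mem _ ⟨i, rfl⟩)) ha

end OkArc

/-! ### The presented algebra and the isomorphism -/

namespace OkadaAlgebra

open OkadaDiagram

variable {K : Type*} [Field K] {N : ℕ} (X : Fin (N - 1) → K) (Y : Fin (N - 2) → K)

theorem e_mul_self (i : Fin (N - 1)) : e X Y i * e X Y i = X i • e X Y i := by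
  simpa only [e, map_mul, map_smul] using RingQuot.mkAlgHom_rel K (OkadaRel.sq (Y := Y) (X := X) i)

theorem e_comm {i j : Fin (N - 1)} (h : i.val + 2 ≤ j.val ∨ j.val + 2 ≤ i.val) :
    e X Y i * e X Y j = e X Y j * e X Y i := by
  simpa only [e, map_mul] using RingQuot.mkAlgHom_rel K (OkadaRel.comm (Y := Y) (X := X) i j h)

theorem e_shift (m : Fin (N - 2)) {i j : Fin (N - 1)} (hi : i.val = m.val)
    (hj : j.val = m.val + 1) : e X Y j * e X Y i * e X Y j = Y m • e X Y j := by
  simpa only [e, map_mul, map_smul] using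
    RingQuot.mkAlgHom_rel K (OkadaRel.shift (Y := Y) (X := X) m i j hi hj)

theorem induction_on {p : OkadaAlgebra N X Y → Prop} (a : OkadaAlgebra N X Y)
    (scalar : ∀ r : K, p (algebraMap K _ r)) (gen : ∀ i, p (e X Y i))
    (mul : ∀ a b, p a → p b → p (a * b)) (add : ∀ a b, p a → p b → p (a + b)) : p a := by
  obtain ⟨a, rfl⟩ := RingQuot.mkAlgHom_surjective K (OkadaRel N X Y) a
  refine FreeAlgebra.induction K (Fin (N - 1))
    (motive := fun a => p (RingQuot.mkAlgHom K (OkadaRel N X Y) a)) (fun r => ?_) gen ?_ ?_ a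
  · rw [AlgHom.commutes]
    exact scalar r
  · intro a b ha hb
    rw [map_mul]
    exact mul _ _ ha hb
  · intro a b ha hb
    rw [map_add]
    exact add _ _ ha hb

theorem exists_finite_span : ∃ S : Set (OkadaAlgebra N X Y),
    S.Finite ∧ S.ncard ≤ N.factorial ∧ Submodule.span K S = ⊤ := by
  -- The generators are extended by `0` to all indices. The relations persist, because both sides
  -- vanish as soon as the greatest index is out of range.
  set E : ℕ → OkadaAlgebra N X Y := fun i => if h : i < N - 1 then e X Y ⟨i, h⟩ else 0 with hE
  set x : ℕ → K := fun i => if h : i < N - 1 then X ⟨i, h⟩ else 0 with hx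
  set y : ℕ → K := fun i => if h : i < N - 2 then Y ⟨i, h⟩ else 0 with hy
  have Epos : ∀ i (h : i < N - 1), E i = e X Y ⟨i, h⟩ := fun i h => dif_pos h
  have Eneg : ∀ i, ¬ i < N - 1 → E i = 0 := fun i h => dif_neg h
  have hsq : ∀ i, E i * E i = x i • E i := by
    intro i
    by_cases h : i < N - 1
    · rw [Epos i h, e_mul_self, hx]
      simp only [dif_pos h]
    · simp [Eneg i h]
  have hcomm : ∀ i j, i + 2 ≤ j → E i * E j = E j * E i := by
    intro i j hij
    by_cases h : j < N - 1
    · rw [Epos j h, Epos i (by omega), e_comm]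
      exact Or.inl hij
    · simp [Eneg j h]
  have hshift : ∀ i, E (i + 1) * E i * E (i + 1) = y i • E (i + 1) := by
    intro i
    by_cases h : i + 1 < N - 1
    · have h' : i < N - 2 := by omega
      rw [Epos _ h, Epos i (by omega), e_shift X Y ⟨i, h'⟩ rfl rfl, hy]
      simp only [dif_pos h']
    · simp [Eneg _ h]
  refine ⟨OkadaWords.words E N, OkadaWords.finite_words E N, OkadaWords.ncard_words_le E N, ?_⟩
  -- The span contains `1`, so it is everything once it is stable under right multiplication.
  have key : ∀ a w : OkadaAlgebra N X Y, w ∈ Submodule.span K (OkadaWords.words E N) →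
      w * a ∈ Submodule.span K (OkadaWords.words E N) := by
    intro a
    refine induction_on X Y (p := fun a => ∀ w ∈ Submodule.span K (OkadaWords.words E N),
      w * a ∈ Submodule.span K (OkadaWords.words E N)) a (fun r w hw => ?_) (fun i w hw => ?_)
      (fun a b ha hb w hw => ?_) fun a b ha hb w hw => ?_
    · rw [← Algebra.commutes, ← Algebra.smul_def]
      exact Submodule.smul_mem _ _ hw
    · rw [← Epos i.val i.isLt]
      exact OkadaWords.mul_mem_span_words hsq hcomm hshift N _ (by omega) w hw
    · rw [← mul_assoc]
      exact hb _ (ha _ hw)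
    · rw [mul_add]
      exact add_mem (ha _ hw) (hb _ hw)
  rw [eq_top_iff]
  rintro a -
  simpa using key a 1 (Submodule.subset_span (OkadaWords.one_mem_words E N))

theorem finite : Module.Finite K (OkadaAlgebra N X Y) := by
  obtain ⟨S, hS, -, hs⟩ := exists_finite_span X Y
  exact ⟨Submodule.fg_def.2 ⟨S, hS, hs⟩⟩

theorem finrank_le : Module.finrank K (OkadaAlgebra N X Y) ≤ N.factorial := by
  obtain ⟨S, hS, hc, hs⟩ := exists_finite_span X Y
  have := hS.fintype
  refine le_trans ?_ hc
  rw [← finrank_top, ← hs, Set.ncard_eq_toFinset_card']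
  exact finrank_span_le_card S

theorem exists_hom : ∃ Θ : OkadaAlgebra N X Y →ₙₐ[K] OkArc N X Y, Θ 1 = 1 ∧
    ∀ i, Θ (e X Y i) = OkArc.diagram X Y (g i) := by
  -- The ring structure is local and extends the given product and unit, so the algebra homomorphism
  -- obtained is also one for the product in the statement.
  let _ := OkArc.ring X Y
  let _ := OkArc.algebra X Y
  let f : FreeAlgebra K (Fin (N - 1)) →ₐ[K] OkArc N X Y :=
    FreeAlgebra.lift K fun i => OkArc.diagram X Y (g i)
  have hf : ∀ i, f (FreeAlgebra.ι K i) = OkArc.diagram X Y (g i) :=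
    fun i => FreeAlgebra.lift_ι_apply _ i
  have hrel : ∀ ⦃a b⦄, OkadaRel N X Y a b → f a = f b := by
    rintro _ _ (i | ⟨i, j, h⟩ | ⟨m, i, j, h, h'⟩)
    · rw [map_mul, map_smul, hf]
      exact OkArc.diagram_g_mul_self X Y i
    · rw [map_mul, map_mul, hf, hf]
      exact OkArc.diagram_g_comm X Y h
    · rw [map_mul, map_mul, map_smul, hf, hf]
      exact OkArc.diagram_g_shift X Y (h'.trans (by rw [h])) m h
  let φ : OkadaAlgebra N X Y →ₐ[K] OkArc N X Y := RingQuot.liftAlgHom K ⟨f, hrel⟩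
  refine ⟨{ toFun := φ, map_smul' := fun r a => map_smul φ r a, map_zero' := map_zero φ,
            map_add' := map_add φ, map_mul' := map_mul φ }, map_one φ, fun i => ?_⟩
  change φ (RingQuot.mkAlgHom K _ _) = _
  rw [← hf i]
  exact RingQuot.liftAlgHom_mkAlgHom_apply K f hrel _

variable {X Y}

theorem surjective_of_hom {Θ : OkadaAlgebra N X Y →ₙₐ[K] OkArc N X Y} (h1 : Θ 1 = 1)
    (hg : ∀ i, Θ (e X Y i) = OkArc.diagram X Y (g i)) : Function.Surjective Θ := by
  intro a
  refine OkArc.induction_on (p := fun a => ∃ b, Θ b = a) a ⟨0, map_zero Θ⟩ ?_ fun r D => ?_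
  · rintro _ _ ⟨a, rfl⟩ ⟨b, rfl⟩
    exact ⟨a + b, map_add Θ a b⟩
  · obtain ⟨b, hb⟩ := OkArc.diagram_induction X Y (p := fun a => ∃ b, Θ b = a) ⟨1, h1⟩
      (by
        rintro i _ ⟨b, rfl⟩
        exact ⟨e X Y i * b, by rw [map_mul, hg]⟩) D
    exact ⟨r • b, by rw [map_smul, hb]⟩

theorem hom_unique {Θ Θ' : OkadaAlgebra N X Y →ₙₐ[K] OkArc N X Y} (h1 : Θ 1 = 1) (h1' : Θ' 1 = 1)
    (hg : ∀ i, Θ (e X Y i) = Θ' (e X Y i)) : Θ = Θ' := by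
  refine NonUnitalAlgHom.ext fun a => ?_
  refine induction_on X Y (p := fun a => Θ a = Θ' a) a (fun r => ?_) hg
    (fun a b ha hb => ?_) fun a b ha hb => ?_
  · rw [Algebra.algebraMap_eq_smul_one, map_smul, map_smul, h1, h1']
  · rw [map_mul, map_mul, ha, hb]
  · rw [map_add, map_add, ha, hb]

/-- The linear map that underlies a homomorphism to the diagram algebra. -/
noncomputable def toLinearMap (Θ : OkadaAlgebra N X Y →ₙₐ[K] OkArc N X Y) :
    OkadaAlgebra N X Y →ₗ[K] OkArc N X Y where
  toFun := Θ
  map_add' := map_add Θ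
  map_smul' := map_smul Θ

/-- The bounds close up: `N!` is at most the number of diagrams, which is the dimension of the
target, hence at most that of the source, which is at most `N!` by the spanning words. -/
theorem finrank_eq_of_surjective {Θ : OkadaAlgebra N X Y →ₙₐ[K] OkArc N X Y}
    (h : Function.Surjective Θ) : Module.finrank K (OkadaAlgebra N X Y) = N.factorial ∧
      Module.finrank K (OkArc N X Y) = N.factorial := by
  have := finite X Y
  have h1 := finrank_le X Y
  have h2 := LinearMap.finrank_le_finrank_of_surjective (f := toLinearMap Θ) h
  have h3 := LabelledArcs.factorial_le_card (N := N)
  rw [← OkArc.finrank_eq_card X Y] at h3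
  omega

theorem bijective_of_surjective {Θ : OkadaAlgebra N X Y →ₙₐ[K] OkArc N X Y}
    (h : Function.Surjective Θ) : Function.Bijective Θ := by
  have := finite X Y
  have := OkArc.finite X Y
  obtain ⟨h1, h2⟩ := finrank_eq_of_surjective h
  exact ⟨(LinearMap.injective_iff_surjective_of_finrank_eq_finrank (h1.trans h2.symm)
    (f := toLinearMap Θ)).2 h, h⟩

end OkadaAlgebra

theorem mainTheorem2 {K : Type*} [Field K] (N : ℕ) (X : Fin (N - 1) → K) (Y : Fin (N - 2) → K) :
    -- `OkArc_N(X, Y)` is well defined: diagrams are closed under composition, and the product is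
    -- associative with the identity diagram as unit
    (∀ C D : OkadaDiagram N, (LabelledArcs.comp C.1 D.1).IsOkada) ∧
    (∀ a b c : OkArc N X Y, a * b * c = a * (b * c)) ∧
    (∀ a : OkArc N X Y, 1 * a = a ∧ a * 1 = a) ∧
    -- the dimension
    Module.finrank K (OkArc N X Y) = N.factorial ∧
    -- generation, as a unital algebra, by the elementary diagrams
    NonUnitalAlgebra.adjoin K
      (insert 1 (Set.range fun i => OkArc.diagram X Y (OkadaDiagram.g i))) = ⊤ ∧
    -- the isomorphism, and its uniqueness among all unital algebra homomorphisms
    ∃ Θ : OkadaAlgebra N X Y →ₙₐ[K] OkArc N X Y,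
      (Function.Bijective Θ ∧ Θ 1 = 1 ∧
        ∀ i, Θ (OkadaAlgebra.e X Y i) = OkArc.diagram X Y (OkadaDiagram.g i)) ∧
      ∀ Θ' : OkadaAlgebra N X Y →ₙₐ[K] OkArc N X Y, Θ' 1 = 1 →
        (∀ i, Θ' (OkadaAlgebra.e X Y i) = OkArc.diagram X Y (OkadaDiagram.g i)) → Θ' = Θ := by

  obtain ⟨Θ, h1, hg⟩ := OkadaAlgebra.exists_hom X Y
  have hs := OkadaAlgebra.surjective_of_hom h1 hg
  exact ⟨fun C D => LabelledArcs.comp_isOkada C.2 D.2, OkArc.mul_assoc',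
    fun a => ⟨OkArc.one_mul' a, OkArc.mul_one' a⟩, (OkadaAlgebra.finrank_eq_of_surjective hs).2,
    OkArc.adjoin_eq_top X Y, Θ, ⟨OkadaAlgebra.bijective_of_surjective hs, h1, hg⟩,
    fun Θ' h1' hg' => OkadaAlgebra.hom_unique h1' h1 fun i => (hg' i).trans (hg i).symm⟩
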